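/- **Setting.** For an interval $E\subset\mathbb R$ let $\mathcal P(E)$ be the set of Borel probability measures on $E$ with finite moments of all orders, $m_j(\mu)=\int x^j\,d\mu(x)$, and let $$\mathcal M_n(E)=\{(m_1(\mu),\dots,m_n(\mu)):\mu\in\mathcal P(E)\}\subset\mathbb R^n .$$ For a vector $m=(m_1,\dots,m_n)\in\operatorname{Int}\mathcal M_n(E)$, $m_0=1$, let $m_j^-$ and $m_j^+$ be the infimum and the supremum of $\{m_j(\mu):\mu\in\mathcal P(E),\ m_i(\mu)=m_i \text{ for } i<j\}$ for $j\ge 1$. Canonical coordinates $y_1,\dots,y_n$ of $m$, probability densities and functions $W_1,W_2$ are defined in three cases. * $E=[a,b]$, $a<b$: $y_j=p_j=\dfrac{m_j-m_j^-}{m_j^+-m_j^-}\in D_1=D_2=(0,1)$. $V_1,V_2:[0,1]\to\mathbb R$ are continuous and $C^2$ on $(0,1)$; $W_i(p)=V_i(p)-\log(p(1-p))$. * $E=\mathbb R_+=[0,\infty)$: $y_j=z_j=\dfrac{m_j-m_j^-}{m_{j-1}-m_{j-1}^-}\in D_1=D_2=(0,\infty)$, where $m_0^-=0$. $V_1,V_2:[0,\infty)\to\mathbb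 R$ are continuous and $C^2$ on $(0,\infty)$, and for some $\varepsilon>0$, $V_i(z)/\log z\ge 2+\varepsilon$ for all large $z$; $W_i(z)=V_i(z)-\log z$. * $E=\mathbb R$: $y_{2j-1}=\alpha_j\in D_1=\mathbb R$ and $y_{2j}=\beta_j\in D_2=(0,\infty)$ are the coefficients in the recurrence $P_0=1$, $P_1(x)=x-\alpha_1$, $P_{j+1}(x)=(x-\alpha_{j+1})P_j(x)-\beta_jP_{j-1}(x)$ of the monic orthogonal polynomials of the moment vector. $V_1:\mathbb R\to\mathbb R$ is $C^2$, $V_2:[0,\infty)\to\mathbb R$ is continuous and $C^2$ on $(0,\infty)$, and for some $\varepsilon>0$, $V_1(\alpha)/\log|\alpha|\ge1+\varepsilon$ and $V_2(\beta)/\log\beta\ge3+\varepsilon$ for all large $|\alpha|$, $\beta$; $W_1(\alpha)=V_1(\alpha)$, $W_2(\beta)=V_2(\beta)-\log\beta$. In each case suppose that $W_1$ on $D_1$ and $W_2$ on $D_2$ have unique minimizers $y_1^*\in D_1$ and $y_2^*\in D_2$. Let $\mathbb P_n$ be the measure on $\mathcal M_n(E)$ with $\mathbb P_n(\partial\mathcal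 M_n(E))=0$ and with Lebesgue density on $\operatorname{Int}\mathcal M_n(E)$ $$\frac1{Z_n}\exp\Big[-n\sum_{j=1}^{\lfloor (n+1)/2\rfloor}V_1(y_{2j-1})-n\sum_{j=1}^{\lfloor n/2\rfloor}V_2(y_{2j})\Big],$$ where $Z_n$ is the normalization constant. **Theorem.** In each of the three cases, $\mathbb P_n$ is a well-defined probability measure for every $n\ge1$. If random vectors $(m_1^{(n)},\dots,m_n^{(n)})$, $n\geq 1$, defined on a common probability space, have the laws $\mathbb P_n$, then for every $k\ge1$ the sequence $X_n=(m_1^{(n)},\dots,m_k^{(n)})$, $n\ge k$, satisfies a large deviations principle on $\mathcal M_k(E)$ (with the topology induced from $\mathbb R^k$) with speed $n$ and good rate function $I$, where $I(m)=\infty$ for $m\in\mathcal M_k(E)\cap\partial\mathcal M_k(E)$ and, for $m\in\operatorname{Int}\mathcal M_k(E)$ with canonical coordinates $y_1,\dots,y_k$, $$I(m)=\sum_{j=1}^{\lfloor (k+1)/2\rfloor}\{W_1(y_{2j-1})-W_1(y_1^*)\}+\sum_{j=1}^{\lfloor k/2\rfloor}\{W_2(y_{2j})-W_2(y_2^*)\}.$$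 That is, $I:\mathcal M_k(E)\to[0,\infty]$ is lower semicontinuous with compact level sets $\{I\le K\}$, $K\ge 0$, and $$\liminf_{n\to\infty}\tfrac1n\log P(X_n\in O)\ge-\inf_{O}I,\qquad \limsup_{n\to\infty}\tfrac1n\log P(X_n\in U)\le-\inf_{U}I$$ for all relatively open $O$ and relatively closed $U$ in $\mathcal M_k(E)$. -/

import Mathlib

open MeasureTheory ProbabilityTheory Filter Set Polynomial

noncomputable section

/-- `IsMomentMeasure E μ`: the measure `μ` belongs to `𝒫(E)`, i.e. it is a Borel probability measure
on the real line that is carried by `E` and has finite moments of all orders. -/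
structure IsMomentMeasure (E : Set ℝ) (μ : Measure ℝ) : Prop where
  isProbabilityMeasure : IsProbabilityMeasure μ
  carried : μ Eᶜ = 0
  integrable_pow : ∀ j : ℕ, Integrable (fun x : ℝ => x ^ j) μ

/-- The moment space `ℳₙ(E)` of all vectors `(m₁(μ), …, mₙ(μ))` with `μ ∈ 𝒫(E)`.
The entry with index `i : Fin n` is the moment of order `i + 1`. -/
def momentSpace (E : Set ℝ) (n : ℕ) : Set (Fin n → ℝ) :=
  {m | ∃ μ : Measure ℝ, IsMomentMeasure E μ ∧ ∀ i : Fin n, m i = ∫ x, x ^ ((i : ℕ) + 1) ∂μ}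

/-- The first `k` entries of a moment vector of length `n ≥ k`, as a point of `ℳₖ(E)`. -/
def firstMoments {E : Set ℝ} {k n : ℕ} (h : k ≤ n) (m : momentSpace E n) : momentSpace E k :=
  ⟨fun i => m.1 (Fin.castLE h i), by
    obtain ⟨μ, hμ, hm⟩ := m.2
    exact ⟨μ, hμ, fun i => hm (Fin.castLE h i)⟩⟩

/-- The moment `mⱼ` read off from the vector `m = (m₁, …, mₙ)`, with `m₀ = 1`
(and the irrelevant value `0` for `j > n`). -/
def momentAt {n : ℕ} (m : Fin n → ℝ) : ℕ → ℝ
  | 0 => 1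
  | j + 1 => if h : j < n then m ⟨j, h⟩ else 0

/-- The set of possible values of the `j`-th moment of measures in `𝒫(E)` whose moments of order
less than `j` are the ones prescribed by `m`. -/
def momentSection (E : Set ℝ) {n : ℕ} (m : Fin n → ℝ) (j : ℕ) : Set ℝ :=
  {t | ∃ μ : Measure ℝ, IsMomentMeasure E μ ∧
    (∀ i < j, ∫ x, x ^ i ∂μ = momentAt m i) ∧ ∫ x, x ^ j ∂μ = t}

/-- `mⱼ⁻`, the lower end point of the section. -/
def lowerMoment (E : Set ℝ) {n : ℕ} (m : Fin n → ℝ) (j : ℕ) : ℝ := sInf (momentSection E m j)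

/-- `mⱼ⁺`, the upper end point of the section. -/
def upperMoment (E : Set ℝ) {n : ℕ} (m : Fin n → ℝ) (j : ℕ) : ℝ := sSup (momentSection E m j)

/-- The canonical moments `pⱼ = (mⱼ - mⱼ⁻) / (mⱼ⁺ - mⱼ⁻)`, `1 ≤ j ≤ n`, on `E = [a, b]`. -/
def compactCoord (a b : ℝ) (n : ℕ) (m : Fin n → ℝ) (j : ℕ) : ℝ :=
  (momentAt m j - lowerMoment (Icc a b) m j) /
    (upperMoment (Icc a b) m j - lowerMoment (Icc a b) m j)

/-- The differences `mⱼ - mⱼ⁻` on `E = [0, ∞)`, with the conventions `m₀ = 1`, `m₀⁻ = 0`. -/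
def halfLineGap {n : ℕ} (m : Fin n → ℝ) : ℕ → ℝ
  | 0 => 1
  | j + 1 => momentAt m (j + 1) - lowerMoment (Ici 0) m (j + 1)

/-- The canonical moments `zⱼ = (mⱼ - mⱼ⁻) / (mⱼ₋₁ - mⱼ₋₁⁻)`, `1 ≤ j ≤ n`, on `E = [0, ∞)`. -/
def halfLineCoord (n : ℕ) (m : Fin n → ℝ) (j : ℕ) : ℝ := halfLineGap m j / halfLineGap m (j - 1)

/-- The linear functional on polynomials that sends `x ^ i` to `s i`; if the `s i` are the moments
of `μ`, this is `p ↦ ∫ p dμ`. -/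
def momentFunctional (s : ℕ → ℝ) (p : ℝ[X]) : ℝ := p.sum fun i c => c * s i

/-- The monic orthogonal polynomials of a moment sequence `s`, generated by their three-term
recurrence `P₀ = 1`, `P₁ = x - α₁`, `Pⱼ₊₁ = (x - αⱼ₊₁) Pⱼ - βⱼ Pⱼ₋₁`, where orthogonality forces
`αⱼ₊₁ = ⟨x Pⱼ, Pⱼ⟩ / ⟨Pⱼ, Pⱼ⟩` and `βⱼ = ⟨Pⱼ, Pⱼ⟩ / ⟨Pⱼ₋₁, Pⱼ₋₁⟩`. -/
def orthoPoly (s : ℕ → ℝ) : ℕ → ℝ[X]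
  | 0 => 1
  | 1 => X - C (momentFunctional s X / momentFunctional s 1)
  | j + 2 =>
    (X - C (momentFunctional s (X * orthoPoly s (j + 1) ^ 2) /
        momentFunctional s (orthoPoly s (j + 1) ^ 2))) * orthoPoly s (j + 1) -
      C (momentFunctional s (orthoPoly s (j + 1) ^ 2) /
        momentFunctional s (orthoPoly s j ^ 2)) * orthoPoly s j

/-- The recurrence coefficient `αⱼ`, `j ≥ 1`; it depends on the moments up to order `2j - 1`. -/
def recurrenceAlpha (s : ℕ → ℝ) (j : ℕ) : ℝ :=
  momentFunctional s (X * orthoPoly s (j - 1) ^ 2) / momentFunctional s (orthoPoly s (j - 1) ^ 2)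

/-- The recurrence coefficient `βⱼ`, `j ≥ 1`; it depends on the moments up to order `2j`. -/
def recurrenceBeta (s : ℕ → ℝ) (j : ℕ) : ℝ :=
  momentFunctional s (orthoPoly s j ^ 2) / momentFunctional s (orthoPoly s (j - 1) ^ 2)

/-- The coordinates `(α₁, β₁, α₂, β₂, …)` on `E = ℝ`: the `j`-th one is `α_{(j+1)/2}` for `j` odd
and `β_{j/2}` for `j` even, `1 ≤ j ≤ n`. -/
def realLineCoord (n : ℕ) (m : Fin n → ℝ) (j : ℕ) : ℝ :=
  if Odd j then recurrenceAlpha (momentAt m) ((j + 1) / 2) else recurrenceBeta (momentAt m) (j / 2)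

/-- `∑_{j=1}^{⌊(n+1)/2⌋} F₁(y_{2j-1}) + ∑_{j=1}^{⌊n/2⌋} F₂(y_{2j})`. -/
def alternatingSum (F₁ F₂ : ℝ → ℝ) (n : ℕ) (y : ℕ → ℝ) : ℝ :=
  ∑ j ∈ Finset.Icc 1 ((n + 1) / 2), F₁ (y (2 * j - 1)) + ∑ j ∈ Finset.Icc 1 (n / 2), F₂ (y (2 * j))

/-- The measure on `ℳₙ(E)` that vanishes on the boundary of `ℳₙ(E)` and has on the interior the
Lebesgue density `exp(-n ∑ V₁(y_{2j-1}) - n ∑ V₂(y_{2j}))`, where `y` are the coordinates of `m`. -/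
def weightedLaw (E : Set ℝ) (y : ∀ n : ℕ, (Fin n → ℝ) → ℕ → ℝ) (V₁ V₂ : ℝ → ℝ) (n : ℕ) :
    Measure (momentSpace E n) :=
  (((volume : Measure (Fin n → ℝ)).comap Subtype.val).restrict
      {m | (m : Fin n → ℝ) ∈ interior (momentSpace E n)}).withDensity
    fun m => ENNReal.ofReal (Real.exp (-(n : ℝ) * alternatingSum V₁ V₂ n (y n m)))

/-- The probability measure `ℙ_{n,E,V}` on `ℳₙ(E)`: the normalized version of `weightedLaw`. -/
def momentLaw (E : Set ℝ) (y : ∀ n : ℕ, (Fin n → ℝ) → ℕ → ℝ) (V₁ V₂ : ℝ → ℝ) (n : ℕ) :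
    Measure (momentSpace E n) :=
  (weightedLaw E y V₁ V₂ n univ)⁻¹ • weightedLaw E y V₁ V₂ n

open Classical in
/-- The function on `ℳₖ(E)` that is `∞` on the boundary and equal to
`∑ (W₁(y_{2j-1}) - W₁(w₁)) + ∑ (W₂(y_{2j}) - W₂(w₂))` on the interior; here `w₁`, `w₂` are the
minimizers of `W₁`, `W₂`. -/
def momentRate (E : Set ℝ) (y : ∀ n : ℕ, (Fin n → ℝ) → ℕ → ℝ) (W₁ W₂ : ℝ → ℝ) (w₁ w₂ : ℝ) (k : ℕ)
    (m : momentSpace E k) : EReal :=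
  if (m : Fin k → ℝ) ∈ interior (momentSpace E k) then
    ((alternatingSum (fun t => W₁ t - W₁ w₁) (fun t => W₂ t - W₂ w₂) k (y k m) : ℝ) : EReal)
  else ⊤

/-- `w` is the unique minimizer of `W` on `S`. -/
def IsUniqueMinimizerOn (W : ℝ → ℝ) (S : Set ℝ) (w : ℝ) : Prop :=
  w ∈ S ∧ ∀ t ∈ S, t ≠ w → W w < W t

/-- The large deviations principle with speed `b` and good rate function `I` for a sequence `Y` of
random elements of the topological space `S`. -/
structure SatisfiesLDP {Ω S : Type*} [MeasurableSpace Ω] [TopologicalSpace S] (P : Measure Ω)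
    (Y : ℕ → Ω → S) (b : ℕ → ℝ) (I : S → EReal) : Prop where
  speed : Tendsto b atTop atTop
  nonneg : ∀ x, 0 ≤ I x
  lowerSemicontinuous : LowerSemicontinuous I
  isCompact_le : ∀ K : ℝ, 0 ≤ K → IsCompact {x | I x ≤ (K : EReal)}
  lower_bound : ∀ O : Set S, IsOpen O →
    -(⨅ x ∈ O, I x) ≤
      liminf (fun n => (((b n)⁻¹ : ℝ) : EReal) * ENNReal.log (P (Y n ⁻¹' O))) atTop
  upper_bound : ∀ U : Set S, IsClosed U →
    limsup (fun n => (((b n)⁻¹ : ℝ) : EReal) * ENNReal.log (P (Y n ⁻¹' U))) atTop ≤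
      -(⨅ x ∈ U, I x)

end

/-! In each case the coordinate $y_j$ depends on $m_1,\dots,m_j$ only, is affine in $m_j$, and has
slope $1/(C\prod_{i<j}h_i(y_i))$ there, with a constant $C$ that may depend on $j$. The weight is
$h(p)=p(1-p)$ on $[a,b]$ and $h(z)=z$ on $[0,\infty)$; on $\mathbb R$ it is $1$ for the $\alpha$'s
and $h(\beta)=\beta$ for the $\beta$'s. Integrating out the last moment of a density on
$\operatorname{Int}\mathcal M_{n}$ therefore multiplies what remains by a constant and by one factor
$h_i(y_i)$ for every $i<n$. After $d=n-k$ integrations, the first $k$ moments have a density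
proportional to $\prod_{j\le k}e^{-nV_j(y_j)}h_j(y_j)^{d}$.

Since $W=V-\log h$ and $n=k+d$, this equals $\prod_{j\le k} e^{-kV_j(y_j)}\cdot e^{-d\,I}$ up to a
factor independent of $m$. So the law of $X_n$ is the Gibbs measure with energy $I$ at inverse
temperature $n-k$, relative to one fixed finite measure (`exists_gibbs_representation`), and the
large deviations principle is Laplace's method (`neg_le_liminf_gibbsMass`, `limsup_gibbsMass_le`).
Sublevel sets of $I$ are compact because they lie in coordinate boxes, which are continuous images
of compact sets.

What remains is the triangular structure. A vector is interior exactly when its functional is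
strictly positive on nonzero polynomials that are nonnegative on $E$
(`mem_interior_momentSpace_iff`). On the half line the slopes telescope. On $[a,b]$ the formula
$m_{n+1}^+-m_{n+1}^-=(b-a)^{n+1}\prod_{j\le n} p_j(1-p_j)$ comes from orthogonality relations of the
extremal polynomials at the two end points (`moment_range_relation`). On $\mathbb R$ the product of
the $\beta$'s is the squared norm of an orthogonal polynomial (`prod_recurrenceBeta`). -/

/-! ### Triangular coordinate systems: regularity, lifting, compact boxes. -/

/-- A system of triangular coordinates on the open sets `G n ⊆ ℝⁿ`: the `j`-th coordinate depends
only on the first `j` entries, is affine in the last one of them with a slope governed by the weights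
`h` of the preceding coordinates, and takes its values in `D j`. -/
structure TriangularCoordinates (G : ∀ n, Set (Fin n → ℝ)) (y : ∀ n, (Fin n → ℝ) → ℕ → ℝ)
    (D : ℕ → Set ℝ) (h : ℕ → ℝ → ℝ) : Prop where
  isOpen : ∀ n, IsOpen (G n)
  zero_eq : G 0 = univ
  coord_init : ∀ n (m : Fin (n + 1) → ℝ), Fin.init m ∈ G n → ∀ j ∈ Finset.Icc 1 n,
    y (n + 1) m j = y n (Fin.init m) j
  mem_succ_iff : ∀ n (m : Fin (n + 1) → ℝ),
    m ∈ G (n + 1) ↔ Fin.init m ∈ G n ∧ y (n + 1) m (n + 1) ∈ D (n + 1)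
  isOpen_range : ∀ j, IsOpen (D j)
  weight_pos : ∀ j, ∀ t ∈ D j, 0 < h j t
  weight_cont : ∀ j, ContinuousOn (h j) (D j)
  affine : ∀ n, ∃ (c : (Fin n → ℝ) → ℝ) (C : ℝ), 0 < C ∧ ContinuousOn c (G n) ∧
    ∀ m : Fin (n + 1) → ℝ, Fin.init m ∈ G n → y (n + 1) m (n + 1) =
      (m (Fin.last n) - c (Fin.init m)) /
        (C * ∏ j ∈ Finset.Icc 1 n, h j (y n (Fin.init m) j))

theorem continuous_finInit (n : ℕ) :
    Continuous (fun m : Fin (n + 1) → ℝ => (Fin.init m : Fin n → ℝ)) :=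
  continuous_pi fun i => continuous_apply i.castSucc

theorem prod_Icc_one_succ {M : Type*} [CommMonoid M] (f : ℕ → M) (n : ℕ) :
    ∏ j ∈ Finset.Icc 1 (n + 1), f j = (∏ j ∈ Finset.Icc 1 n, f j) * f (n + 1) :=
  Finset.prod_Icc_succ_top (by omega) f

theorem sum_Icc_one_succ {M : Type*} [AddCommMonoid M] (f : ℕ → M) (n : ℕ) :
    ∑ j ∈ Finset.Icc 1 (n + 1), f j = (∑ j ∈ Finset.Icc 1 n, f j) + f (n + 1) :=
  Finset.sum_Icc_succ_top (by omega) f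

theorem measurable_indicator_of_continuousOn {α β : Type*} [TopologicalSpace α] [MeasurableSpace α]
    [OpensMeasurableSpace α] [TopologicalSpace β] [MeasurableSpace β] [BorelSpace β] [Zero β]
    {f : α → β} {s : Set α} (hf : ContinuousOn f s) (hs : MeasurableSet s) :
    Measurable (s.indicator f) := by
  classical
  exact hf.measurable_piecewise continuousOn_const hs

namespace TriangularCoordinates

variable {G : ∀ n, Set (Fin n → ℝ)} {y : ∀ n, (Fin n → ℝ) → ℕ → ℝ}
    {D : ℕ → Set ℝ} {h : ℕ → ℝ → ℝ}

theorem coord_mem (T : TriangularCoordinates G y D h) (n : ℕ) {m : Fin n → ℝ} (hm : m ∈ G n)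
    {j : ℕ} (hj : j ∈ Finset.Icc 1 n) : y n m j ∈ D j := by
  induction n with
  | zero => simp at hj
  | succ n ih =>
    have h1 := (T.mem_succ_iff n m).1 hm
    by_cases hjn : j = n + 1
    · subst hjn; exact h1.2
    · have hj' : j ∈ Finset.Icc 1 n := by simp at hj ⊢; omega
      rw [T.coord_init n m h1.1 j hj']
      exact ih h1.1 hj'

theorem prod_weight_pos (T : TriangularCoordinates G y D h) (n : ℕ) {m : Fin n → ℝ}
    (hm : m ∈ G n) : 0 < ∏ j ∈ Finset.Icc 1 n, h j (y n m j) :=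
  Finset.prod_pos fun j hj => T.weight_pos j _ (T.coord_mem n hm hj)

theorem continuousOn_comp_coord (T : TriangularCoordinates G y D h) {n j : ℕ} {f : ℝ → ℝ}
    (hy : ContinuousOn (fun m => y n m j) (G n)) (hj : j ∈ Finset.Icc 1 n)
    (hf : ContinuousOn f (D j)) : ContinuousOn (fun m => f (y n m j)) (G n) :=
  hf.comp hy fun _ hm => T.coord_mem n hm hj

theorem continuousOn_coord (T : TriangularCoordinates G y D h) (n : ℕ) :
    ∀ j ∈ Finset.Icc 1 n, ContinuousOn (fun m => y n m j) (G n) := by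
  induction n with
  | zero => intro j hj; simp at hj
  | succ n ih =>
    intro j hj
    have hmaps : MapsTo (fun m : Fin (n + 1) → ℝ => (Fin.init m : Fin n → ℝ)) (G (n + 1)) (G n) :=
      fun m hm => ((T.mem_succ_iff n m).1 hm).1
    by_cases hjn : j = n + 1
    · subst hjn
      obtain ⟨c, C, hC, hc, hy⟩ := T.affine n
      have : ContinuousOn (fun m : Fin (n + 1) → ℝ => (m (Fin.last n) - c (Fin.init m)) /
          (C * ∏ j ∈ Finset.Icc 1 n, h j (y n (Fin.init m) j))) (G (n + 1)) := by
        apply ContinuousOn.div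
        · exact (continuous_apply _).continuousOn.sub
            (hc.comp (continuous_finInit n).continuousOn hmaps)
        · apply continuousOn_const.mul
          refine (continuousOn_finsetProd (f := fun j m => h j (y n m j)) _ fun j hj =>
            T.continuousOn_comp_coord (ih j hj) hj (T.weight_cont j)).comp
              (continuous_finInit n).continuousOn hmaps
        · intro m hm
          exact (mul_pos hC (T.prod_weight_pos n (hmaps hm))).ne'
      exact this.congr fun m hm => hy m (hmaps hm)
    · have hj' : j ∈ Finset.Icc 1 n := by simp at hj ⊢; omega
      exact ((ih j hj').comp (continuous_finInit n).continuousOn hmaps).congr fun m hm =>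
        T.coord_init n m (hmaps hm) j hj'

theorem continuousOn_weight (T : TriangularCoordinates G y D h) (n : ℕ) :
    ContinuousOn (fun m => ∏ j ∈ Finset.Icc 1 n, h j (y n m j)) (G n) :=
  continuousOn_finsetProd _ fun j hj =>
    T.continuousOn_comp_coord (T.continuousOn_coord n j hj) hj (T.weight_cont j)

/-- The entry of order `n + 1` as a function of the preceding ones and of the coordinate. -/
theorem exists_lift (T : TriangularCoordinates G y D h) (n : ℕ) :
    ∃ ψ : (Fin n → ℝ) × ℝ → (Fin (n + 1) → ℝ), ContinuousOn ψ (G n ×ˢ univ) ∧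
      (∀ m ∈ G n, ∀ t, Fin.init (ψ (m, t)) = m ∧ y (n + 1) (ψ (m, t)) (n + 1) = t) ∧
      ∀ m : Fin (n + 1) → ℝ, Fin.init m ∈ G n → ψ (Fin.init m, y (n + 1) m (n + 1)) = m := by
  obtain ⟨c, C, hC, hc, hy⟩ := T.affine n
  refine ⟨fun p => Fin.snoc (α := fun _ => ℝ) p.1
    (c p.1 + (C * ∏ j ∈ Finset.Icc 1 n, h j (y n p.1 j)) * p.2), ?_, ?_, ?_⟩
  · refine ContinuousOn.finSnoc (X := fun _ => ℝ) continuousOn_fst ?_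
    have hm : MapsTo (Prod.fst : (Fin n → ℝ) × ℝ → _) (G n ×ˢ (univ : Set ℝ)) (G n) := fun p hp => hp.1
    exact (hc.comp continuousOn_fst hm).add
      ((continuousOn_const.mul ((T.continuousOn_weight n).comp continuousOn_fst hm)).mul
        continuousOn_snd)
  · intro m hm t
    have h1 : Fin.init (Fin.snoc (α := fun _ => ℝ) m
      (c m + (C * ∏ j ∈ Finset.Icc 1 n, h j (y n m j)) * t)) = m := Fin.init_snoc ..
    refine ⟨h1, ?_⟩
    dsimp only
    rw [hy _ (by rw [h1]; exact hm), h1, Fin.snoc_last]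
    have := (mul_pos hC (T.prod_weight_pos n hm)).ne'
    rw [add_sub_cancel_left, mul_div_cancel_left₀ _ this]
  · intro m hm
    have := (mul_pos hC (T.prod_weight_pos n hm)).ne'
    dsimp only
    rw [hy m hm, mul_div_cancel₀ _ this, add_sub_cancel]
    exact Fin.snoc_init_self m

/-- Each new moment can be solved for from its coordinate. This yields the point whose coordinates
are the minimizers, where the rate vanishes. -/
theorem exists_coord_eq (T : TriangularCoordinates G y D h) {w : ℕ → ℝ} (hw : ∀ j, w j ∈ D j)
    (n : ℕ) : ∃ m ∈ G n, ∀ j ∈ Finset.Icc 1 n, y n m j = w j := by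
  induction n with
  | zero => exact ⟨0, by rw [T.zero_eq]; trivial, fun j hj => by simp at hj⟩
  | succ n ih =>
    obtain ⟨m, hm, hmw⟩ := ih
    obtain ⟨ψ, -, hψ, -⟩ := T.exists_lift n
    obtain ⟨h1, h2⟩ := hψ m hm (w (n + 1))
    refine ⟨ψ (m, w (n + 1)), (T.mem_succ_iff _ _).2 ⟨by rwa [h1], by rw [h2]; exact hw _⟩,
      fun j hj => ?_⟩
    by_cases hjn : j = n + 1
    · subst hjn; exact h2
    · have hj' : j ∈ Finset.Icc 1 n := by simp at hj ⊢; omega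
      rw [T.coord_init n _ (by rwa [h1]) j hj', h1, hmw j hj']

/-- A box of length `n + 1` is the image of a box of length `n` times `K (n + 1)` under the
continuous lift. Since `K j ⊆ D j`, the image stays inside `G (n + 1)`. -/
theorem isCompact_box (T : TriangularCoordinates G y D h) {K : ℕ → Set ℝ}
    (hK : ∀ j, IsCompact (K j)) (hKD : ∀ j, K j ⊆ D j) (n : ℕ) :
    IsCompact {m ∈ G n | ∀ j ∈ Finset.Icc 1 n, y n m j ∈ K j} := by
  induction n with
  | zero => exact Set.Finite.isCompact (Set.toFinite _)
  | succ n ih =>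
    obtain ⟨ψ, hψc, hψ, hψ'⟩ := T.exists_lift n
    convert (ih.prod (hK (n + 1))).image_of_continuousOn
      (hψc.mono (prod_mono (fun m hm => hm.1) (subset_univ _))) using 1
    ext m
    constructor
    · rintro ⟨hm, hj⟩
      have h1 := ((T.mem_succ_iff n m).1 hm).1
      refine ⟨(Fin.init m, y (n + 1) m (n + 1)), ⟨⟨h1, fun j hjn => ?_⟩, hj _ (by simp)⟩, hψ' m h1⟩
      rw [← T.coord_init n m h1 j hjn]
      exact hj j (by simp at hjn ⊢; omega)
    · rintro ⟨⟨m', t⟩, ⟨⟨hm', hj⟩, ht⟩, rfl⟩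
      obtain ⟨h1, h2⟩ := hψ m' hm' t
      refine ⟨(T.mem_succ_iff _ _).2 ⟨by rwa [h1], by rw [h2]; exact hKD _ ht⟩, fun j hjn => ?_⟩
      by_cases hjn' : j = n + 1
      · subst hjn'; rw [h2]; exact ht
      · have hj' : j ∈ Finset.Icc 1 n := by simp at hjn ⊢; omega
        rw [T.coord_init n _ (by rwa [h1]) j hj', h1]
        exact hj j hj'

end TriangularCoordinates

/-! ### Integrating out moments one at a time. -/

theorem lintegral_comp_sub_div (φ : ℝ → ENNReal) (hφ : Measurable φ) (c : ℝ) {g : ℝ} (hg : 0 < g) :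
    ∫⁻ t, φ ((t - c) / g) = ENNReal.ofReal g * ∫⁻ t, φ t := by
  rw [lintegral_sub_right_eq_self (fun t => φ (t / g)) c]
  have h1 := Real.map_volume_mul_right (a := g⁻¹) (inv_ne_zero hg.ne')
  have h2 : ∫⁻ t, φ (t / g) = ∫⁻ t, φ t ∂(Measure.map (fun t => t * g⁻¹) volume) := by
    rw [lintegral_map hφ (by fun_prop)]
    simp [div_eq_mul_inv]
  rw [h2, h1, lintegral_smul_measure, inv_inv, abs_of_pos hg, smul_eq_mul]

/-- Integration over the last entry along affine fibres. -/
theorem lintegral_init_mul_affine {n : ℕ} (F : (Fin n → ℝ) → ENNReal) (hF : Measurable F)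
    (φ : ℝ → ENNReal) (hφ : Measurable φ) (c g : (Fin n → ℝ) → ℝ) (hc : Measurable c)
    (hg : Measurable g) (hpos : ∀ m, F m ≠ 0 → 0 < g m) :
    ∫⁻ m : Fin (n + 1) → ℝ, F (Fin.init m) * φ ((m (Fin.last n) - c (Fin.init m)) / g (Fin.init m)) =
      (∫⁻ m, F m * ENNReal.ofReal (g m)) * ∫⁻ t, φ t := by
  have hvp := volume_preserving_piFinSuccAbove (fun _ : Fin (n + 1) => ℝ) (Fin.last n)
  let Ψ : ℝ × (Fin n → ℝ) → ENNReal := fun p => F p.2 * φ ((p.1 - c p.2) / g p.2)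
  have hΨ : Measurable Ψ := by fun_prop
  have h1 : ∀ m : Fin (n + 1) → ℝ,
      F (Fin.init m) * φ ((m (Fin.last n) - c (Fin.init m)) / g (Fin.init m)) =
      Ψ (MeasurableEquiv.piFinSuccAbove (fun _ : Fin (n + 1) => ℝ) (Fin.last n) m) := by
    intro m
    simp [Ψ, MeasurableEquiv.piFinSuccAbove, Fin.insertNthEquiv]
  simp_rw [h1]
  rw [hvp.lintegral_comp hΨ, Measure.volume_eq_prod, lintegral_prod_symm _ hΨ.aemeasurable,
    ← lintegral_mul_const _ (by fun_prop)]
  congr 1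
  ext m
  simp only [Ψ]
  rw [lintegral_const_mul _ (by fun_prop)]
  by_cases h0 : F m = 0
  · simp [h0]
  · rw [lintegral_comp_sub_div φ hφ _ (hpos m h0), mul_assoc]

namespace TriangularCoordinates

variable {G : ∀ n, Set (Fin n → ℝ)} {y : ∀ n, (Fin n → ℝ) → ℕ → ℝ}
    {D : ℕ → Set ℝ} {h : ℕ → ℝ → ℝ}

/-- Substituting the coordinate for the last moment produces the Jacobian `C * ∏ h`, which depends
on the earlier moments only; this is the source of all powers of the weights. -/
theorem lintegral_succ (T : TriangularCoordinates G y D h) (n : ℕ) :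
    ∃ C : ℝ, 0 < C ∧ ∀ (F : (Fin n → ℝ) → ENNReal) (φ : ℝ → ENNReal),
      Measurable ((G n).indicator F) → Measurable ((D (n + 1)).indicator φ) →
      ∫⁻ m in G (n + 1), F (Fin.init m) * φ (y (n + 1) m (n + 1)) =
        (ENNReal.ofReal C * ∫⁻ t in D (n + 1), φ t) *
          ∫⁻ m in G n, F m * ENNReal.ofReal (∏ j ∈ Finset.Icc 1 n, h j (y n m j)) := by
  obtain ⟨c, C, hC, hc, hy⟩ := T.affine n
  refine ⟨C, hC, fun F φ hF hφ => ?_⟩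
  set p : (Fin n → ℝ) → ℝ := fun m => ∏ j ∈ Finset.Icc 1 n, h j (y n m j) with hp
  have hGm : ∀ n, MeasurableSet (G n) := fun n => (T.isOpen n).measurableSet
  -- Nothing is known about `c` and the weights off `G n`; cutting them off by indicators makes them
  -- measurable on the whole space without affecting the integrals.
  have hc' : Measurable ((G n).indicator c) :=
    (measurable_indicator_of_continuousOn hc (hGm n))
  have hp' : Measurable ((G n).indicator p) :=
    (measurable_indicator_of_continuousOn (T.continuousOn_weight n) (hGm n))
  have key := lintegral_init_mul_affine ((G n).indicator F) hF ((D (n + 1)).indicator φ) hφ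
    ((G n).indicator c) (fun m => C * (G n).indicator p m) hc' (by fun_prop) (fun m hm => by
      have hm' : m ∈ G n := by by_contra hm'; exact hm (indicator_of_notMem hm' _)
      simp only [indicator_of_mem hm']
      exact mul_pos hC (T.prod_weight_pos n hm'))
  rw [← lintegral_indicator (hGm _), ← lintegral_indicator (T.isOpen_range _).measurableSet,
    ← lintegral_indicator (hGm _)]
  have h1 : ∀ m, (G (n + 1)).indicator (fun m => F (Fin.init m) * φ (y (n + 1) m (n + 1))) m =
      (G n).indicator F (Fin.init m) * (D (n + 1)).indicator φ
        ((m (Fin.last n) - (G n).indicator c (Fin.init m)) /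
          (C * (G n).indicator p (Fin.init m))) := by
    intro m
    by_cases hm : Fin.init m ∈ G n
    · simp only [indicator_of_mem hm]
      rw [← hy m hm]
      by_cases hd : y (n + 1) m (n + 1) ∈ D (n + 1)
      · rw [indicator_of_mem hd, indicator_of_mem ((T.mem_succ_iff _ _).2 ⟨hm, hd⟩)]
      · rw [indicator_of_notMem hd, mul_zero,
          indicator_of_notMem fun h => hd ((T.mem_succ_iff _ _).1 h).2]
    · rw [indicator_of_notMem hm, zero_mul,
          indicator_of_notMem fun h => hm ((T.mem_succ_iff _ _).1 h).1]
  simp_rw [h1]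
  rw [key]
  have h2 : ∀ m, (G n).indicator F m * ENNReal.ofReal (C * (G n).indicator p m) =
      ENNReal.ofReal C * (G n).indicator (fun m => F m * ENNReal.ofReal (p m)) m := by
    intro m
    by_cases hm : m ∈ G n
    · simp only [indicator_of_mem hm]
      rw [ENNReal.ofReal_mul hC.le]; ring
    · simp [hm]
  simp_rw [h2]
  rw [lintegral_const_mul']
  · ring
  · simp

/-- The product of the weights `exp (-N V_j) h_j ^ r` of the coordinates. -/
noncomputable def density (y : ∀ n, (Fin n → ℝ) → ℕ → ℝ) (h V : ℕ → ℝ → ℝ) (N r n : ℕ)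
    (m : Fin n → ℝ) : ℝ :=
  ∏ j ∈ Finset.Icc 1 n, (Real.exp (-(N : ℝ) * V j (y n m j)) * h j (y n m j) ^ r)

theorem density_pos (T : TriangularCoordinates G y D h) (V : ℕ → ℝ → ℝ) (N r n : ℕ)
    {m : Fin n → ℝ} (hm : m ∈ G n) : 0 < density y h V N r n m :=
  Finset.prod_pos fun j hj =>
    mul_pos (Real.exp_pos _) (pow_pos (T.weight_pos j _ (T.coord_mem n hm hj)) _)

theorem continuousOn_factor (T : TriangularCoordinates G y D h) {V : ℕ → ℝ → ℝ}
    (hV : ∀ j, ContinuousOn (V j) (D j)) (N r j : ℕ) :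
    ContinuousOn (fun t => Real.exp (-(N : ℝ) * V j t) * h j t ^ r) (D j) :=
  (Real.continuous_exp.comp_continuousOn (continuousOn_const.mul (hV j))).mul
    ((T.weight_cont j).pow r)

theorem continuousOn_density (T : TriangularCoordinates G y D h) {V : ℕ → ℝ → ℝ}
    (hV : ∀ j, ContinuousOn (V j) (D j)) (N r n : ℕ) :
    ContinuousOn (density y h V N r n) (G n) :=
  continuousOn_finsetProd _ fun j hj =>
    T.continuousOn_comp_coord (T.continuousOn_coord n j hj) hj (T.continuousOn_factor hV N r j)

/-- Integrating out all coordinates but the first `k`. -/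
theorem lintegral_density (T : TriangularCoordinates G y D h) {V : ℕ → ℝ → ℝ}
    (hV : ∀ j, ContinuousOn (V j) (D j)) (hD : ∀ j, (D j).Nonempty) {N : ℕ}
    (hint : ∀ j, ∀ r < N,
      ∫⁻ t in D j, ENNReal.ofReal (Real.exp (-(N : ℝ) * V j t) * h j t ^ r) ≠ ⊤)
    (k d : ℕ) : ∀ r, r + d ≤ N → ∃ κ : ENNReal, κ ≠ 0 ∧ κ ≠ ⊤ ∧
      ∀ A : Set (Fin k → ℝ), MeasurableSet A →
      ∫⁻ m in G (k + d) ∩ {m | (fun i : Fin k => m (Fin.castLE (k.le_add_right d) i)) ∈ A},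
        ENNReal.ofReal (density y h V N r (k + d) m) =
      κ * ∫⁻ m in G k ∩ A, ENNReal.ofReal (density y h V N (r + d) k m) := by
  induction d with
  | zero => exact fun r _ => ⟨1, by simp, by simp, fun A _ => by rw [one_mul]; rfl⟩
  | succ d ih =>
    intro r hr
    -- The Jacobian of the integrated moment raises the exponent of every remaining weight from `r`
    -- to `r + 1`. The integrated coordinate itself carries `r < N`, which is the range covered by
    -- `hint`.
    obtain ⟨κ, hκ0, hκt, hκ⟩ := ih (r + 1) (by omega)
    obtain ⟨C, hC, hint'⟩ := T.lintegral_succ (k + d)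
    set φ : ℝ → ENNReal := fun t => ENNReal.ofReal (Real.exp (-(N : ℝ) * V (k + d + 1) t) *
      h (k + d + 1) t ^ r) with hφ
    have hφm : Measurable ((D (k + d + 1)).indicator φ) :=
      measurable_indicator_of_continuousOn
        (ENNReal.continuous_ofReal.comp_continuousOn (T.continuousOn_factor hV N r _))
        (T.isOpen_range _).measurableSet
    refine ⟨κ * (ENNReal.ofReal C * ∫⁻ t in D (k + d + 1), φ t), ?_, ?_, fun A hA => ?_⟩
    · refine mul_ne_zero hκ0 (mul_ne_zero (by simpa using hC) ?_)
      rw [← lintegral_indicator (T.isOpen_range _).measurableSet, Ne,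
        lintegral_eq_zero_iff hφm]
      intro h0
      have h1 : volume (D (k + d + 1)) = 0 := by
        refine measure_mono_null ?_ h0
        intro t ht
        simp only [mem_compl_iff, mem_ofPred_eq, indicator_of_mem ht, Pi.zero_apply, hφ]
        simpa using mul_pos (Real.exp_pos _) (pow_pos (T.weight_pos _ t ht) r)
      exact ((T.isOpen_range _).measure_pos volume (hD _)).ne' h1
    · exact ENNReal.mul_ne_top hκt (ENNReal.mul_ne_top (by simp) (hint _ _ (by omega)))
    · set B : Set (Fin (k + d) → ℝ) :=
        {m | (fun i : Fin k => m (Fin.castLE (k.le_add_right d) i)) ∈ A} with hB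
      have hBm : MeasurableSet B :=
        (measurable_pi_lambda _ fun i => measurable_pi_apply _ :
          Measurable fun (m : Fin (k + d) → ℝ) (i : Fin k) =>
            m (Fin.castLE (k.le_add_right d) i)) hA
      have hB'm : MeasurableSet {m : Fin (k + (d + 1)) → ℝ |
          (fun i : Fin k => m (Fin.castLE (k.le_add_right (d + 1)) i)) ∈ A} :=
        (measurable_pi_lambda _ fun i => measurable_pi_apply _ :
          Measurable fun (m : Fin (k + (d + 1)) → ℝ) (i : Fin k) =>
            m (Fin.castLE (k.le_add_right (d + 1)) i)) hA
      set F : (Fin (k + d) → ℝ) → ENNReal :=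
        B.indicator fun m => ENNReal.ofReal (density y h V N r (k + d) m) with hF
      have hFm : Measurable ((G (k + d)).indicator F) := by
        rw [hF, indicator_indicator, inter_comm, ← indicator_indicator]
        exact (measurable_indicator_of_continuousOn
          (ENNReal.continuous_ofReal.comp_continuousOn (T.continuousOn_density hV N r _))
          (T.isOpen _).measurableSet).indicator hBm
      rw [inter_comm, ← setLIntegral_indicator hB'm]
      have e1 : ∫⁻ m in G (k + (d + 1)), {m : Fin (k + (d + 1)) → ℝ |
          (fun i : Fin k => m (Fin.castLE (k.le_add_right (d + 1)) i)) ∈ A}.indicator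
            (fun m => ENNReal.ofReal (density y h V N r (k + (d + 1)) m)) m =
          ∫⁻ m in G (k + d + 1), F (Fin.init m) * φ (y (k + d + 1) m (k + d + 1)) := by
        refine setLIntegral_congr_fun (T.isOpen _).measurableSet fun m hm => ?_
        have hm1 : (Fin.init m : Fin (k + d) → ℝ) ∈ G (k + d) := ((T.mem_succ_iff _ _).1 hm).1
        have e2 : (Fin.init m ∈ B) ↔ (m ∈ {m : Fin (k + (d + 1)) → ℝ |
          (fun i : Fin k => m (Fin.castLE (k.le_add_right (d + 1)) i)) ∈ A}) := Iff.rfl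
        by_cases hmB : Fin.init m ∈ B
        · rw [hF, indicator_of_mem hmB]
          rw [indicator_of_mem (e2.1 hmB), hφ,
            ← ENNReal.ofReal_mul (T.density_pos V N r _ hm1).le]
          congr 1
          unfold density
          refine (prod_Icc_one_succ _ (k + d)).trans (congrArg₂ _ ?_ rfl)
          exact Finset.prod_congr rfl fun j hj =>
            congrArg (fun t => Real.exp (-(N : ℝ) * V j t) * h j t ^ r) (T.coord_init _ _ hm1 j hj)
        · rw [hF, indicator_of_notMem hmB]
          rw [indicator_of_notMem (fun hh => hmB (e2.2 hh)), zero_mul]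
      rw [e1, hint' F φ hFm hφm]
      have e3 : ∫⁻ m in G (k + d), F m *
          ENNReal.ofReal (∏ j ∈ Finset.Icc 1 (k + d), h j (y (k + d) m j)) =
          ∫⁻ m in G (k + d) ∩ B, ENNReal.ofReal (density y h V N (r + 1) (k + d) m) := by
        rw [inter_comm, ← setLIntegral_indicator hBm]
        refine setLIntegral_congr_fun (T.isOpen _).measurableSet fun m hm => ?_
        by_cases hmB : m ∈ B
        · rw [hF, indicator_of_mem hmB, indicator_of_mem hmB,
            ← ENNReal.ofReal_mul (T.density_pos V N r _ hm).le]
          congr 1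
          unfold density
          rw [← Finset.prod_mul_distrib]
          refine Finset.prod_congr rfl fun j hj => by ring
        · rw [hF, indicator_of_notMem hmB, indicator_of_notMem hmB, zero_mul]
      rw [e3, hκ A hA, show r + 1 + d = r + (d + 1) by ring]
      ring

/-- All coordinates are integrated out: with `k = 0` the remaining space is a point of mass one, so
the total mass is the constant `κ`. -/
theorem lintegral_density_ne_zero_ne_top (T : TriangularCoordinates G y D h) {V : ℕ → ℝ → ℝ}
    (hV : ∀ j, ContinuousOn (V j) (D j)) (hD : ∀ j, (D j).Nonempty) {N : ℕ}
    (hint : ∀ j, ∀ r < N,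
      ∫⁻ t in D j, ENNReal.ofReal (Real.exp (-(N : ℝ) * V j t) * h j t ^ r) ≠ ⊤) :
    ∫⁻ m in G N, ENNReal.ofReal (density y h V N 0 N m) ≠ 0 ∧
    ∫⁻ m in G N, ENNReal.ofReal (density y h V N 0 N m) ≠ ⊤ := by
  obtain ⟨κ, h0, ht, hκ⟩ := T.lintegral_density hV hD hint 0 N 0 (by omega)
  have := hκ univ MeasurableSet.univ
  have e : ∫⁻ m in G 0 ∩ univ, ENNReal.ofReal (density y h V N (0 + N) 0 m) = 1 := by
    simp [T.zero_eq, density, volume_pi]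
  rw [e, mul_one] at this
  simp only [mem_univ, ofPred_true, inter_univ] at this
  have e0 : ∀ n, n = N → ∫⁻ m in G n, ENNReal.ofReal (density y h V N 0 n m) =
      ∫⁻ m in G N, ENNReal.ofReal (density y h V N 0 N m) := by rintro n rfl; rfl
  rw [e0 (0 + N) (by omega)] at this
  rw [this]
  exact ⟨h0, ht⟩

end TriangularCoordinates

/-! ### Exponential rates at speed `n` and Laplace's method for Gibbs measures. -/

/-- Neither the constant `c` nor the shift from `n` to `n - k` is visible at speed `n`; the
truncation of the subtraction concerns finitely many `n` only. -/
theorem tendsto_inv_mul_log_ofReal_exp (k : ℕ) (c a : ℝ) :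
    Tendsto (fun n : ℕ => (((n : ℝ)⁻¹ : ℝ) : EReal) *
      ENNReal.log (ENNReal.ofReal (Real.exp (c - ((n - k : ℕ) : ℝ) * a)))) atTop
      (nhds ((-a : ℝ) : EReal)) := by
  have h1 : ∀ n : ℕ, (((n : ℝ)⁻¹ : ℝ) : EReal) *
      ENNReal.log (ENNReal.ofReal (Real.exp (c - ((n - k : ℕ) : ℝ) * a))) =
      (((n : ℝ)⁻¹ * (c - ((n - k : ℕ) : ℝ) * a) : ℝ) : EReal) := by
    intro n
    rw [ENNReal.log_ofReal_of_pos (Real.exp_pos _), Real.log_exp, EReal.coe_mul]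
  simp_rw [h1]
  refine (continuous_coe_real_ereal.tendsto _).comp ?_
  have h2 : Tendsto (fun n : ℕ => (n : ℝ)⁻¹ * (c + k * a) - a) atTop (nhds (0 * (c + k * a) - a)) :=
    (tendsto_natCast_atTop_atTop.inv_tendsto_atTop.mul_const _).sub_const _
  rw [zero_mul, zero_sub] at h2
  refine h2.congr' ?_
  filter_upwards [eventually_ge_atTop (max k 1)] with n hn
  have hk : k ≤ n := le_trans (le_max_left _ _) hn
  have h0 : (n : ℝ) ≠ 0 := by
    have : 1 ≤ n := le_trans (le_max_right _ _) hn
    positivity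
  rw [Nat.cast_sub hk]
  field_simp
  ring

theorem le_liminf_of_exp_le {u : ℕ → ENNReal} (k : ℕ) (c a : ℝ)
    (hu : ∀ᶠ n in atTop, ENNReal.ofReal (Real.exp (c - ((n - k : ℕ) : ℝ) * a)) ≤ u n) :
    ((-a : ℝ) : EReal) ≤
      liminf (fun n : ℕ => (((n : ℝ)⁻¹ : ℝ) : EReal) * ENNReal.log (u n)) atTop := by
  rw [← (tendsto_inv_mul_log_ofReal_exp k c a).liminf_eq]
  refine liminf_le_liminf ?_
  filter_upwards [hu] with n hn
  exact mul_le_mul_of_nonneg_left (ENNReal.log_monotone hn)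
    (EReal.coe_nonneg.2 (by positivity))

theorem limsup_le_of_le_exp {u : ℕ → ENNReal} (k : ℕ) (c a : ℝ)
    (hu : ∀ᶠ n in atTop, u n ≤ ENNReal.ofReal (Real.exp (c - ((n - k : ℕ) : ℝ) * a))) :
    limsup (fun n : ℕ => (((n : ℝ)⁻¹ : ℝ) : EReal) * ENNReal.log (u n)) atTop ≤
      ((-a : ℝ) : EReal) := by
  rw [← (tendsto_inv_mul_log_ofReal_exp k c a).limsup_eq]
  refine limsup_le_limsup ?_
  filter_upwards [hu] with n hn
  exact mul_le_mul_of_nonneg_left (ENNReal.log_monotone hn)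
    (EReal.coe_nonneg.2 (by positivity))

section Laplace

variable {S : Type*} [MeasurableSpace S]

/-- The unnormalized Gibbs mass `∫_{G ∩ A} exp (-d I) dν`. -/
noncomputable def gibbsMass (ν : Measure S) (G : Set S) (I : S → ℝ) (d : ℕ) (A : Set S) : ENNReal :=
  ∫⁻ x in G ∩ A, ENNReal.ofReal (Real.exp (-(d : ℝ) * I x)) ∂ν

variable {ν : Measure S} {G : Set S} {I : S → ℝ}

/-- Because the reference measure is finite, this crude bound holds on arbitrary sets, and the upper
bound for closed sets needs no separate exponential tightness. -/
theorem gibbsMass_le {A : Set S} {r : ℝ} (hG : MeasurableSet (G ∩ A)) (hr : ∀ x ∈ G ∩ A, r ≤ I x)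
    (d : ℕ) : gibbsMass ν G I d A ≤ ENNReal.ofReal (Real.exp (-(d : ℝ) * r)) * ν univ := by
  refine (setLIntegral_mono' (g := fun _ => ENNReal.ofReal (Real.exp (-(d : ℝ) * r))) hG
    fun x hx => ?_).trans ?_
  · refine ENNReal.ofReal_le_ofReal (Real.exp_le_exp.2 ?_)
    have := hr x hx
    have hd : (0 : ℝ) ≤ d := by positivity
    nlinarith
  · rw [setLIntegral_const]
    gcongr
    exact subset_univ _

variable [TopologicalSpace S] [BorelSpace S] [IsFiniteMeasure ν]

/-- The integral is restricted to the nonempty open set where `I < a`; the constant `c` is the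
logarithm of its `ν`-mass, independent of `d`. -/
theorem exists_le_gibbsMass (hGo : IsOpen G) (hI : ContinuousOn I G)
    (hν : ∀ U : Set S, IsOpen U → U ⊆ G → U.Nonempty → ν U ≠ 0) {O : Set S} (hO : IsOpen O)
    {x : S} (hx : x ∈ O) (hxG : x ∈ G) {a : ℝ} (ha : I x < a) :
    ∃ c : ℝ, ∀ d : ℕ, ENNReal.ofReal (Real.exp (c - d * a)) ≤ gibbsMass ν G I d O := by
  set B := (G ∩ I ⁻¹' Iio a) ∩ O with hB
  have hBo : IsOpen B := (hI.isOpen_inter_preimage hGo isOpen_Iio).inter hO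
  have h0 : ν B ≠ 0 := hν B hBo (fun z hz => hz.1.1) ⟨x, ⟨hxG, ha⟩, hx⟩
  have ht : ν B ≠ ⊤ := measure_ne_top _ _
  refine ⟨Real.log (ν B).toReal, fun d => ?_⟩
  have hpos := ENNReal.toReal_pos h0 ht
  rw [sub_eq_add_neg, Real.exp_add, Real.exp_log hpos, ENNReal.ofReal_mul hpos.le,
    ENNReal.ofReal_toReal ht, mul_comm, ← setLIntegral_const]
  refine (setLIntegral_mono' hBo.measurableSet fun z hz => ?_).trans
    (lintegral_mono_set fun z hz => ⟨hz.1.1, hz.2⟩)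
  refine ENNReal.ofReal_le_ofReal (Real.exp_le_exp.2 ?_)
  have := hz.1.2
  simp only [mem_preimage, mem_Iio] at this
  have hd : (0 : ℝ) ≤ d := by positivity
  nlinarith

theorem neg_le_liminf_gibbsMass (hGo : IsOpen G) (hI : ContinuousOn I G) (hI0 : ∀ x ∈ G, 0 ≤ I x)
    (hν : ∀ U : Set S, IsOpen U → U ⊆ G → U.Nonempty → ν U ≠ 0) (k : ℕ) {u : ℕ → ENNReal}
    {O : Set S} (hO : IsOpen O)
    (hu : ∀ n, k ≤ n → u n = (gibbsMass ν G I (n - k) univ)⁻¹ * gibbsMass ν G I (n - k) O)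
    {x : S} (hx : x ∈ O) (hxG : x ∈ G) :
    ((-(I x) : ℝ) : EReal) ≤
      liminf (fun n : ℕ => (((n : ℝ)⁻¹ : ℝ) : EReal) * ENNReal.log (u n)) atTop := by
  have hM0 : ν univ ≠ 0 := fun h0 =>
    hν G hGo subset_rfl ⟨x, hxG⟩ (measure_mono_null (subset_univ _) h0)
  have hMt : ν univ ≠ ⊤ := measure_ne_top _ _
  have hMpos := ENNReal.toReal_pos hM0 hMt
  suffices h : ∀ a, I x < a → ((-a : ℝ) : EReal) ≤
      liminf (fun n : ℕ => (((n : ℝ)⁻¹ : ℝ) : EReal) * ENNReal.log (u n)) atTop by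
    refine EReal.ge_of_forall_gt_iff_ge.1 fun z hz => ?_
    have hz' : z < -(I x) := EReal.coe_lt_coe_iff.1 hz
    simpa using h (-z) (by linarith)
  intro a ha
  obtain ⟨c, hc⟩ := exists_le_gibbsMass hGo hI hν hO hx hxG ha
  refine le_liminf_of_exp_le k (c - Real.log (ν univ).toReal) a ?_
  filter_upwards [eventually_ge_atTop k] with n hn
  rw [hu n hn, show c - Real.log (ν univ).toReal - ((n - k : ℕ) : ℝ) * a =
    -Real.log (ν univ).toReal + (c - ((n - k : ℕ) : ℝ) * a) by ring, Real.exp_add, Real.exp_neg,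
    Real.exp_log hMpos, ENNReal.ofReal_mul (by positivity), ENNReal.ofReal_inv_of_pos hMpos,
    ENNReal.ofReal_toReal hMt]
  gcongr
  -- The energy is nonnegative, so the normalizing mass is at most the mass of `ν`.
  · have := gibbsMass_le (ν := ν) (A := univ) (r := 0) (I := I) (G := G)
      (by simpa using hGo.measurableSet) (fun z hz => hI0 z hz.1) (n - k)
    simpa using this
  · exact hc _

/-- The numerator is at most `exp (-d r)` times the mass of `ν`. The zero `x₀` of the energy keeps
the normalizing mass above `exp (c - d a)` for every `a > 0`, so normalization costs nothing in the
limit. -/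
theorem limsup_gibbsMass_le (hGo : IsOpen G) (hI : ContinuousOn I G)
    (hν : ∀ U : Set S, IsOpen U → U ⊆ G → U.Nonempty → ν U ≠ 0) {x₀ : S} (hx₀ : x₀ ∈ G)
    (hIx₀ : I x₀ = 0) (k : ℕ) {u : ℕ → ENNReal} {A : Set S} (hA : MeasurableSet A)
    (hu : ∀ n, k ≤ n → u n = (gibbsMass ν G I (n - k) univ)⁻¹ * gibbsMass ν G I (n - k) A)
    {r : ℝ} (hr : ∀ x ∈ G ∩ A, r ≤ I x) :
    limsup (fun n : ℕ => (((n : ℝ)⁻¹ : ℝ) : EReal) * ENNReal.log (u n)) atTop ≤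
      ((-r : ℝ) : EReal) := by
  have hM0 : ν univ ≠ 0 := fun h0 =>
    hν G hGo subset_rfl ⟨x₀, hx₀⟩ (measure_mono_null (subset_univ _) h0)
  have hMt : ν univ ≠ ⊤ := measure_ne_top _ _
  have hMpos := ENNReal.toReal_pos hM0 hMt
  suffices h : ∀ a, 0 < a → limsup (fun n : ℕ => (((n : ℝ)⁻¹ : ℝ) : EReal) *
      ENNReal.log (u n)) atTop ≤ ((-(r - a) : ℝ) : EReal) by
    refine EReal.le_of_forall_lt_iff_le.1 fun z hz => ?_
    have hz' : -r < z := EReal.coe_lt_coe_iff.1 hz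
    have := h (z + r) (by linarith)
    rwa [show -(r - (z + r)) = z by ring] at this
  intro a ha
  obtain ⟨c, hc⟩ := exists_le_gibbsMass hGo hI hν isOpen_univ (mem_univ x₀) hx₀
    (show I x₀ < a by rwa [hIx₀])
  refine limsup_le_of_le_exp k (Real.log (ν univ).toReal - c) (r - a) ?_
  filter_upwards [eventually_ge_atTop k] with n hn
  rw [hu n hn, show Real.log (ν univ).toReal - c - ((n - k : ℕ) : ℝ) * (r - a) =
    -(c - ((n - k : ℕ) : ℝ) * a) + (-((n - k : ℕ) : ℝ) * r + Real.log (ν univ).toReal) by ring,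
    Real.exp_add, Real.exp_neg, ENNReal.ofReal_mul (by positivity),
    ENNReal.ofReal_inv_of_pos (Real.exp_pos _), Real.exp_add, Real.exp_log hMpos,
    ENNReal.ofReal_mul (Real.exp_pos _).le, ENNReal.ofReal_toReal hMt]
  gcongr
  · exact hc _
  · exact gibbsMass_le (hGo.measurableSet.inter hA) hr _

end Laplace

/-! ### From triangular coordinates on moment spaces to the large deviations principle. -/

/-- The sequence that equals `a` at odd and `b` at even indices. -/
def alternating {α : Type*} (a b : α) (j : ℕ) : α := if Odd j then a else b

theorem alternating_of_forall {α : Type*} {p : α → Prop} {a b : α} (ha : p a) (hb : p b) (j : ℕ) :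
    p (alternating a b j) := by
  unfold alternating; split_ifs <;> assumption

theorem alternatingSum_eq_sum (F₁ F₂ : ℝ → ℝ) (n : ℕ) (y : ℕ → ℝ) :
    alternatingSum F₁ F₂ n y = ∑ j ∈ Finset.Icc 1 n, alternating F₁ F₂ j (y j) := by
  unfold alternatingSum
  induction n with
  | zero => simp
  | succ n ih =>
    rw [sum_Icc_one_succ, ← ih]
    rcases Nat.even_or_odd' n with ⟨l, rfl | rfl⟩
    · rw [show (2 * l + 1 + 1) / 2 = l + 1 by omega, show (2 * l + 1) / 2 = l by omega,
        show 2 * l / 2 = l by omega, sum_Icc_one_succ, show 2 * (l + 1) - 1 = 2 * l + 1 by omega,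
        alternating, if_pos ⟨l, rfl⟩]
      ring
    · rw [show (2 * l + 1 + 1 + 1) / 2 = l + 1 by omega, show (2 * l + 1 + 1) / 2 = l + 1 by omega,
        show (2 * l + 1) / 2 = l by omega, sum_Icc_one_succ (fun j => F₂ (y (2 * j))),
        show 2 * (l + 1) = 2 * l + 1 + 1 by omega,
        alternating, if_neg (by rw [Nat.not_odd_iff_even]; exact ⟨l + 1, by ring⟩)]
      ring

/-- The moment space is only known to be null measurable, hence the detour through
`Measure.comap_apply₀`: images of measurable subsets of the subtype are null measurable. -/
theorem map_val_restrict_interior {n : ℕ} {M : Set (Fin n → ℝ)} (hM : NullMeasurableSet M) :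
    (((volume : Measure (Fin n → ℝ)).comap (Subtype.val : M → _)).restrict
      {m | (m : Fin n → ℝ) ∈ interior M}).map Subtype.val = volume.restrict (interior M) := by
  ext A hA
  have h1 : ∀ s : Set M, MeasurableSet s →
      NullMeasurableSet (Subtype.val '' s) (volume : Measure (Fin n → ℝ)) := by
    rintro s ⟨t, ht, rfl⟩
    rw [Subtype.image_preimage_coe]
    exact hM.inter ht.nullMeasurableSet
  have hG : MeasurableSet {m : M | (m : Fin n → ℝ) ∈ interior M} :=
    measurable_subtype_coe isOpen_interior.measurableSet
  rw [Measure.map_apply measurable_subtype_coe hA,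
    Measure.restrict_apply (measurable_subtype_coe hA), Measure.restrict_apply hA,
    Measure.comap_apply₀ _ _ Subtype.val_injective h1
      ((measurable_subtype_coe hA).inter hG).nullMeasurableSet]
  congr 1
  ext x
  constructor
  · rintro ⟨z, ⟨h, h'⟩, rfl⟩
    exact ⟨h, h'⟩
  · rintro ⟨h, h'⟩
    exact ⟨⟨x, interior_subset h'⟩, ⟨h, h'⟩, rfl⟩

section

variable {E : Set ℝ} {y : ∀ n, (Fin n → ℝ) → ℕ → ℝ} {D₁ D₂ : Set ℝ} {h₁ h₂ : ℝ → ℝ}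

theorem density_eq_exp_alternatingSum {V₁ V₂ : ℝ → ℝ} (h : ℕ → ℝ → ℝ) (n : ℕ) (m : Fin n → ℝ) :
    TriangularCoordinates.density y h (alternating V₁ V₂) n 0 n m =
      Real.exp (-(n : ℝ) * alternatingSum V₁ V₂ n (y n m)) := by
  rw [alternatingSum_eq_sum, Finset.mul_sum, Real.exp_sum]
  simp [TriangularCoordinates.density]

theorem weightedLaw_apply
    (T : TriangularCoordinates (fun n => interior (momentSpace E n)) y (alternating D₁ D₂)
      (alternating h₁ h₂)) {V₁ V₂ : ℝ → ℝ}
    (hV : ∀ j, ContinuousOn (alternating V₁ V₂ j) (alternating D₁ D₂ j)) {n : ℕ}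
    (hM : NullMeasurableSet (momentSpace E n)) {A : Set (Fin n → ℝ)} (hA : MeasurableSet A) :
    weightedLaw E y V₁ V₂ n (Subtype.val ⁻¹' A) =
      ∫⁻ m in interior (momentSpace E n) ∩ A,
        ENNReal.ofReal (TriangularCoordinates.density y (alternating h₁ h₂)
          (alternating V₁ V₂) n 0 n m) := by
  have hA' : MeasurableSet (Subtype.val ⁻¹' A : Set (momentSpace E n)) := measurable_subtype_coe hA
  have hmeas : Measurable ((interior (momentSpace E n)).indicator fun m =>
      ENNReal.ofReal (TriangularCoordinates.density y (alternating h₁ h₂)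
          (alternating V₁ V₂) n 0 n m)) :=
    measurable_indicator_of_continuousOn
      (ENNReal.continuous_ofReal.comp_continuousOn (T.continuousOn_density hV n 0 n))
      isOpen_interior.measurableSet
  have hG : MeasurableSet {m : momentSpace E n | (m : Fin n → ℝ) ∈ interior (momentSpace E n)} :=
    measurable_subtype_coe isOpen_interior.measurableSet
  -- Off the interior the coordinates need not be measurable, so the integrand is first multiplied
  -- by the indicator of the interior and only then moved between the subtype and `Fin n → ℝ`.
  rw [weightedLaw, withDensity_apply _ hA', ← lintegral_indicator hA', inter_comm,
    ← setLIntegral_indicator hA, ← setLIntegral_congr_fun isOpen_interior.measurableSet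
      (f := A.indicator ((interior (momentSpace E n)).indicator fun m =>
      ENNReal.ofReal (TriangularCoordinates.density y (alternating h₁ h₂)
          (alternating V₁ V₂) n 0 n m))), ← map_val_restrict_interior hM,
    lintegral_map (hmeas.indicator hA) measurable_subtype_coe]
  · refine setLIntegral_congr_fun hG fun m hm => ?_
    by_cases hmA : (m : Fin n → ℝ) ∈ A
    · rw [indicator_of_mem (show m ∈ Subtype.val ⁻¹' A from hmA), indicator_of_mem hmA,
        indicator_of_mem (show (m : Fin n → ℝ) ∈ interior (momentSpace E n) from hm),
        density_eq_exp_alternatingSum]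
    · rw [indicator_of_notMem (show m ∉ Subtype.val ⁻¹' A from hmA), indicator_of_notMem hmA]
  · intro m hm
    by_cases hmA : (m : Fin n → ℝ) ∈ A
    · rw [indicator_of_mem hmA, indicator_of_mem hmA, indicator_of_mem hm]
    · rw [indicator_of_notMem hmA, indicator_of_notMem hmA]

theorem isProbabilityMeasure_momentLaw
    (T : TriangularCoordinates (fun n => interior (momentSpace E n)) y (alternating D₁ D₂)
      (alternating h₁ h₂)) {V₁ V₂ : ℝ → ℝ}
    (hV : ∀ j, ContinuousOn (alternating V₁ V₂ j) (alternating D₁ D₂ j))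
    (hD : ∀ j, (alternating D₁ D₂ j).Nonempty) {n : ℕ}
    (hint : ∀ j, ∀ r < n, ∫⁻ t in alternating D₁ D₂ j, ENNReal.ofReal
      (Real.exp (-(n : ℝ) * alternating V₁ V₂ j t) * alternating h₁ h₂ j t ^ r) ≠ ⊤)
    (hM : NullMeasurableSet (momentSpace E n)) :
    IsProbabilityMeasure (momentLaw E y V₁ V₂ n) := by
  have h1 := weightedLaw_apply T hV hM MeasurableSet.univ
  obtain ⟨h0, ht⟩ := T.lintegral_density_ne_zero_ne_top hV hD hint
  rw [preimage_univ, inter_univ] at h1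
  refine ⟨?_⟩
  rw [momentLaw, Measure.smul_apply, smul_eq_mul, ENNReal.inv_mul_cancel]
  · rwa [h1]
  · rwa [h1]

/-- The finite rate of a vector in the interior of the moment space. -/
noncomputable def interiorRate (y : ∀ n, (Fin n → ℝ) → ℕ → ℝ) (W₁ W₂ : ℝ → ℝ) (w₁ w₂ : ℝ) (k : ℕ)
    (m : Fin k → ℝ) : ℝ :=
  alternatingSum (fun t => W₁ t - W₁ w₁) (fun t => W₂ t - W₂ w₂) k (y k m)

theorem interiorRate_eq_sum (W₁ W₂ : ℝ → ℝ) (w₁ w₂ : ℝ) (k : ℕ) (m : Fin k → ℝ) :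
    interiorRate y W₁ W₂ w₁ w₂ k m = ∑ j ∈ Finset.Icc 1 k,
      (alternating W₁ W₂ j (y k m j) - alternating W₁ W₂ j (alternating w₁ w₂ j)) := by
  rw [interiorRate, alternatingSum_eq_sum]
  refine Finset.sum_congr rfl fun j _ => ?_
  unfold alternating
  split_ifs <;> rfl

/-- Per coordinate, `exp (-(k + d) V) * h ^ d = exp (-k V) * exp (-d (V - log h))`. This is where `W
= V - log h` arises; subtracting the minimum of `W` gives the first factor, which is constant in
`m`. -/
theorem density_eq_exp_interiorRate_mul
    (T : TriangularCoordinates (fun n => interior (momentSpace E n)) y (alternating D₁ D₂)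
      (alternating h₁ h₂)) {V₁ V₂ W₁ W₂ : ℝ → ℝ}
    (hW : ∀ j, ∀ t ∈ alternating D₁ D₂ j, alternating W₁ W₂ j t =
      alternating V₁ V₂ j t - Real.log (alternating h₁ h₂ j t)) (w₁ w₂ : ℝ) (k d : ℕ)
    {m : Fin k → ℝ} (hm : m ∈ interior (momentSpace E k)) :
    TriangularCoordinates.density y (alternating h₁ h₂) (alternating V₁ V₂) (k + d) d k m =
      Real.exp (-(d : ℝ) * ∑ j ∈ Finset.Icc 1 k, alternating W₁ W₂ j (alternating w₁ w₂ j)) *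
      (TriangularCoordinates.density y (alternating h₁ h₂) (alternating V₁ V₂) k 0 k m *
        Real.exp (-(d : ℝ) * interiorRate y W₁ W₂ w₁ w₂ k m)) := by
  rw [interiorRate_eq_sum, Finset.mul_sum, Finset.mul_sum, Real.exp_sum, Real.exp_sum]
  unfold TriangularCoordinates.density
  rw [← Finset.prod_mul_distrib, ← Finset.prod_mul_distrib]
  refine Finset.prod_congr rfl fun j hj => ?_
  have hy := T.coord_mem k hm hj
  have hpos := T.weight_pos j _ hy
  have hexp : alternating h₁ h₂ j (y k m j) ^ d =
      Real.exp (d * Real.log (alternating h₁ h₂ j (y k m j))) := by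
    rw [Real.exp_nat_mul, Real.exp_log hpos]
  rw [hexp, hW j _ hy, pow_zero, mul_one, ← Real.exp_add, ← Real.exp_add, ← Real.exp_add]
  congr 1
  push_cast
  ring

theorem measurable_castLE {k n : ℕ} (h : k ≤ n) :
    Measurable fun (m : Fin n → ℝ) (i : Fin k) => m (Fin.castLE h i) :=
  measurable_pi_lambda _ fun _ => measurable_pi_apply _

/-- The law of the first `k` moments is a Gibbs measure whose energy is the rate function. -/
theorem exists_gibbs_representation
    (T : TriangularCoordinates (fun n => interior (momentSpace E n)) y (alternating D₁ D₂)
      (alternating h₁ h₂)) (hM : ∀ n, NullMeasurableSet (momentSpace E n)) {V₁ V₂ W₁ W₂ : ℝ → ℝ}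
    (hV : ∀ j, ContinuousOn (alternating V₁ V₂ j) (alternating D₁ D₂ j))
    (hD : ∀ j, (alternating D₁ D₂ j).Nonempty)
    (hint : ∀ N : ℕ, ∀ j, ∀ r < N, ∫⁻ t in alternating D₁ D₂ j, ENNReal.ofReal
      (Real.exp (-(N : ℝ) * alternating V₁ V₂ j t) * alternating h₁ h₂ j t ^ r) ≠ ⊤)
    (hW : ∀ j, ∀ t ∈ alternating D₁ D₂ j, alternating W₁ W₂ j t =
      alternating V₁ V₂ j t - Real.log (alternating h₁ h₂ j t)) (w₁ w₂ : ℝ) (k : ℕ) :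
    ∃ ν : Measure (Fin k → ℝ), IsFiniteMeasure ν ∧
      (∀ U : Set (Fin k → ℝ), IsOpen U → U ⊆ interior (momentSpace E k) → U.Nonempty → ν U ≠ 0) ∧
      ∀ n (hkn : k ≤ n), ∀ A : Set (Fin k → ℝ), MeasurableSet A →
        momentLaw E y V₁ V₂ n (firstMoments hkn ⁻¹' (Subtype.val ⁻¹' A)) =
          (gibbsMass ν (interior (momentSpace E k)) (interiorRate y W₁ W₂ w₁ w₂ k) (n - k) univ)⁻¹ *
            gibbsMass ν (interior (momentSpace E k)) (interiorRate y W₁ W₂ w₁ w₂ k) (n - k) A := by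
  set G := interior (momentSpace E k) with hG
  have hGm : MeasurableSet G := isOpen_interior.measurableSet
  -- The reference density is the unnormalized density of the case `n = k`, hence independent of `n`
  -- and of finite mass.
  set ρ : (Fin k → ℝ) → ENNReal := fun m => ENNReal.ofReal
    (TriangularCoordinates.density y (alternating h₁ h₂) (alternating V₁ V₂) k 0 k m) with hρ
  have hρm : Measurable (G.indicator ρ) := measurable_indicator_of_continuousOn
    (ENNReal.continuous_ofReal.comp_continuousOn (T.continuousOn_density hV k 0 k)) hGm
  refine ⟨volume.withDensity (G.indicator ρ), ?_, ?_, ?_⟩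
  · refine isFiniteMeasure_withDensity ?_
    rw [lintegral_indicator hGm]
    exact (T.lintegral_density_ne_zero_ne_top hV hD (hint k)).2
  · intro U hU hUG hUne
    rw [withDensity_apply _ hU.measurableSet, Ne, setLIntegral_eq_zero_iff hU.measurableSet hρm]
    intro h0
    have : volume U = 0 := by
      refine measure_mono_null ?_ h0
      intro m hm
      have hmG := hUG hm
      simp only [mem_compl_iff, mem_ofPred_eq, indicator_of_mem hmG, hρ]
      simpa [hm] using T.density_pos (alternating V₁ V₂) k 0 k hmG
    exact (hU.measure_pos volume hUne).ne' this
  · intro n hkn A hA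
    obtain ⟨d, rfl⟩ := Nat.exists_eq_add_of_le hkn
    obtain ⟨κ, hκ0, hκt, hκ⟩ := T.lintegral_density hV hD (hint (k + d)) k d 0 (by omega)
    set e : ENNReal := ENNReal.ofReal
      (Real.exp (-(d : ℝ) * ∑ j ∈ Finset.Icc 1 k, alternating W₁ W₂ j (alternating w₁ w₂ j))) with he
    have key : ∀ B : Set (Fin k → ℝ), MeasurableSet B →
        weightedLaw E y V₁ V₂ (k + d) (firstMoments hkn ⁻¹' (Subtype.val ⁻¹' B)) =
        (κ * e) * gibbsMass (volume.withDensity (G.indicator ρ)) G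
          (interiorRate y W₁ W₂ w₁ w₂ k) d B := by
      intro B hB
      have h1 : (firstMoments hkn ⁻¹' (Subtype.val ⁻¹' B) : Set (momentSpace E (k + d))) =
        Subtype.val ⁻¹' {m : Fin (k + d) → ℝ | (fun i : Fin k => m (Fin.castLE hkn i)) ∈ B} := rfl
      have h2 : MeasurableSet {m : Fin (k + d) → ℝ | (fun i : Fin k => m (Fin.castLE hkn i)) ∈ B} :=
        measurable_castLE hkn hB
      rw [h1, weightedLaw_apply T hV (hM _) h2, hκ B hB, gibbsMass,
        setLIntegral_withDensity_eq_setLIntegral_mul_non_measurable _ hρm _ (hGm.inter hB),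
        mul_assoc, ← lintegral_const_mul' _ _ ENNReal.ofReal_ne_top]
      · congr 1
        refine setLIntegral_congr_fun (hGm.inter hB) fun m hm => ?_
        rw [Pi.mul_apply, indicator_of_mem (show m ∈ G from hm.1)]
        rw [zero_add, density_eq_exp_interiorRate_mul T hW w₁ w₂ k d hm.1,
          ENNReal.ofReal_mul (Real.exp_pos _).le,
          ENNReal.ofReal_mul (T.density_pos _ _ _ _ hm.1).le]
      · refine Eventually.of_forall fun m => ?_
        by_cases hm : m ∈ G
        · rw [indicator_of_mem hm]; exact ENNReal.ofReal_lt_top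
        · rw [indicator_of_notMem hm]; exact ENNReal.zero_lt_top
    have hu := key univ MeasurableSet.univ
    rw [preimage_univ, preimage_univ] at hu
    have he0 : e ≠ 0 := by rw [he]; simpa using Real.exp_pos _
    have het : e ≠ ⊤ := ENNReal.ofReal_ne_top
    -- The factor `κ * e` depends on `d` but not on the set, so normalization removes it.
    rw [momentLaw, Measure.smul_apply, smul_eq_mul, key A hA, hu, Nat.add_sub_cancel_left,
      ENNReal.mul_inv (Or.inl (mul_ne_zero hκ0 he0)) (Or.inl (ENNReal.mul_ne_top hκt het))]
    rw [mul_mul_mul_comm, ENNReal.inv_mul_cancel (mul_ne_zero hκ0 he0)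
      (ENNReal.mul_ne_top hκt het), one_mul]


theorem continuousOn_interiorRate
    (T : TriangularCoordinates (fun n => interior (momentSpace E n)) y (alternating D₁ D₂)
      (alternating h₁ h₂)) {W₁ W₂ : ℝ → ℝ}
    (hW : ∀ j, ContinuousOn (alternating W₁ W₂ j) (alternating D₁ D₂ j)) (w₁ w₂ : ℝ) (k : ℕ) :
    ContinuousOn (interiorRate y W₁ W₂ w₁ w₂ k) (interior (momentSpace E k)) := by
  simp_rw [funext (interiorRate_eq_sum (y := y) W₁ W₂ w₁ w₂ k)]
  exact continuousOn_finsetSum _ fun j hj =>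
    (T.continuousOn_comp_coord (T.continuousOn_coord k j hj) hj (hW j)).sub continuousOn_const

/-- All summands of the rate are nonnegative, so a bound on the sum bounds each of them and confines
each coordinate to a compact subset of its range. The sublevel set is then closed in a compact box.
-/
theorem isCompact_interiorRate_le
    (T : TriangularCoordinates (fun n => interior (momentSpace E n)) y (alternating D₁ D₂)
      (alternating h₁ h₂)) {W₁ W₂ : ℝ → ℝ}
    (hW : ∀ j, ContinuousOn (alternating W₁ W₂ j) (alternating D₁ D₂ j)) {w₁ w₂ : ℝ}
    (hmin : ∀ j, ∀ t ∈ alternating D₁ D₂ j,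
      alternating W₁ W₂ j (alternating w₁ w₂ j) ≤ alternating W₁ W₂ j t)
    (hlev : ∀ (j : ℕ) (K : ℝ), ∃ C ⊆ alternating D₁ D₂ j, IsCompact C ∧
      ∀ t ∈ alternating D₁ D₂ j, alternating W₁ W₂ j t ≤ K → t ∈ C) (k : ℕ) (K : ℝ) :
    IsCompact {m ∈ interior (momentSpace E k) | interiorRate y W₁ W₂ w₁ w₂ k m ≤ K} := by
  choose C hCD hC hCK using fun j => hlev j (K + alternating W₁ W₂ j (alternating w₁ w₂ j))
  have hQ := T.isCompact_box hC hCD k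
  set Q := {m ∈ interior (momentSpace E k) | ∀ j ∈ Finset.Icc 1 k, y k m j ∈ C j} with hQd
  have hcl : IsClosed (Q ∩ interiorRate y W₁ W₂ w₁ w₂ k ⁻¹' Iic K) :=
    ((continuousOn_interiorRate T hW w₁ w₂ k).mono fun m hm => hm.1).preimage_isClosed_of_isClosed
      hQ.isClosed isClosed_Iic
  convert hQ.of_isClosed_subset hcl inter_subset_left using 1
  ext m
  constructor
  · rintro ⟨hm, hK⟩
    refine ⟨⟨hm, fun j hj => hCK j _ (T.coord_mem k hm hj) ?_⟩, hK⟩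
    rw [interiorRate_eq_sum] at hK
    have := Finset.single_le_sum (f := fun j => alternating W₁ W₂ j (y k m j) -
      alternating W₁ W₂ j (alternating w₁ w₂ j))
      (fun i hi => sub_nonneg.2 (hmin i _ (T.coord_mem k hm hi))) hj
    linarith
  · rintro ⟨hm, hK⟩
    exact ⟨hm.1, hK⟩

theorem satisfiesLDP_of_triangularCoordinates {Ω : Type*} [MeasurableSpace Ω] (P : Measure Ω)
    (T : TriangularCoordinates (fun n => interior (momentSpace E n)) y (alternating D₁ D₂)
      (alternating h₁ h₂)) (hM : ∀ n, NullMeasurableSet (momentSpace E n)) {V₁ V₂ W₁ W₂ : ℝ → ℝ}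
    (hV : ∀ j, ContinuousOn (alternating V₁ V₂ j) (alternating D₁ D₂ j))
    (hint : ∀ N : ℕ, ∀ j, ∀ r < N, ∫⁻ t in alternating D₁ D₂ j, ENNReal.ofReal
      (Real.exp (-(N : ℝ) * alternating V₁ V₂ j t) * alternating h₁ h₂ j t ^ r) ≠ ⊤)
    (hW : ∀ j, ∀ t ∈ alternating D₁ D₂ j, alternating W₁ W₂ j t =
      alternating V₁ V₂ j t - Real.log (alternating h₁ h₂ j t))
    (hlev : ∀ (j : ℕ) (K : ℝ), ∃ C ⊆ alternating D₁ D₂ j, IsCompact C ∧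
      ∀ t ∈ alternating D₁ D₂ j, alternating W₁ W₂ j t ≤ K → t ∈ C)
    {w₁ w₂ : ℝ} (hw₁ : IsUniqueMinimizerOn W₁ D₁ w₁) (hw₂ : IsUniqueMinimizerOn W₂ D₂ w₂)
    (k : ℕ) (m : ∀ n, Ω → momentSpace E n) (X : ℕ → Ω → momentSpace E k)
    (hm : ∀ n, 1 ≤ n → HasLaw (m n) (momentLaw E y V₁ V₂ n) P)
    (hX : ∀ n (h : k ≤ n) ω, X n ω = firstMoments h (m n ω)) (hk : 1 ≤ k) :
    SatisfiesLDP P X (fun n => (n : ℝ)) (momentRate E y W₁ W₂ w₁ w₂ k) := by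
  have hw : ∀ j, alternating w₁ w₂ j ∈ alternating D₁ D₂ j := by
    intro j
    unfold alternating
    split_ifs
    exacts [hw₁.1, hw₂.1]
  have hmin : ∀ j, ∀ t ∈ alternating D₁ D₂ j,
      alternating W₁ W₂ j (alternating w₁ w₂ j) ≤ alternating W₁ W₂ j t := by
    intro j
    have aux : ∀ {W : ℝ → ℝ} {D : Set ℝ} {w : ℝ}, IsUniqueMinimizerOn W D w →
        ∀ t ∈ D, W w ≤ W t := by
      intro W D w h t ht
      rcases eq_or_ne t w with rfl | hne
      · exact le_rfl
      · exact (h.2 t ht hne).le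
    unfold alternating
    split_ifs
    exacts [aux hw₁, aux hw₂]
  have hWc : ∀ j, ContinuousOn (alternating W₁ W₂ j) (alternating D₁ D₂ j) := fun j =>
    ((hV j).sub ((T.weight_cont j).log fun t ht => (T.weight_pos j t ht).ne')).congr (hW j)
  set G := interior (momentSpace E k) with hG
  have hGo : IsOpen G := isOpen_interior
  set I := interiorRate y W₁ W₂ w₁ w₂ k with hI
  have hIc : ContinuousOn I G := continuousOn_interiorRate T hWc w₁ w₂ k
  have hI0 : ∀ x ∈ G, 0 ≤ I x := by
    intro x hx
    rw [hI, interiorRate_eq_sum]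
    exact Finset.sum_nonneg fun j hj => sub_nonneg.2 (hmin j _ (T.coord_mem k hx hj))
  have hrate : ∀ x : momentSpace E k, (x : Fin k → ℝ) ∈ G →
      momentRate E y W₁ W₂ w₁ w₂ k x = ((I x : ℝ) : EReal) := fun x hx => if_pos hx
  have hrate' : ∀ x : momentSpace E k, (x : Fin k → ℝ) ∉ G →
      momentRate E y W₁ W₂ w₁ w₂ k x = ⊤ := fun x hx => if_neg hx
  have hnonneg : ∀ x, 0 ≤ momentRate E y W₁ W₂ w₁ w₂ k x := by
    intro x
    by_cases hx : (x : Fin k → ℝ) ∈ G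
    · rw [hrate x hx]; exact EReal.coe_nonneg.2 (hI0 x hx)
    · rw [hrate' x hx]; exact le_top
  have hcompact : ∀ K : ℝ, IsCompact {x | momentRate E y W₁ W₂ w₁ w₂ k x ≤ (K : EReal)} := by
    intro K
    -- Finite sublevel sets avoid the boundary, where the rate is `⊤`, so their compactness is that
    -- of the corresponding sets in the interior.
    rw [Subtype.isCompact_iff]
    convert isCompact_interiorRate_le T hWc hmin hlev k K using 1
    ext x
    constructor
    · rintro ⟨z, hz, rfl⟩
      by_cases hzG : (z : Fin k → ℝ) ∈ G
      · refine ⟨hzG, ?_⟩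
        rw [mem_ofPred_eq, hrate z hzG] at hz
        exact EReal.coe_le_coe_iff.1 hz
      · rw [mem_ofPred_eq, hrate' z hzG] at hz
        exact absurd (top_le_iff.1 hz) (EReal.coe_ne_top K)
    · rintro ⟨hx, hK⟩
      refine ⟨⟨x, interior_subset hx⟩, ?_, rfl⟩
      rw [mem_ofPred_eq, hrate _ hx]
      exact EReal.coe_le_coe_iff.2 hK
  obtain ⟨ν, hνf, hν, hlaw⟩ := exists_gibbs_representation T hM hV (fun j => ⟨_, hw j⟩) hint hW
    w₁ w₂ k
  obtain ⟨x₀, hx₀, hx₀w⟩ := T.exists_coord_eq hw k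
  have hIx₀ : I x₀ = 0 := by
    rw [hI, interiorRate_eq_sum]
    exact Finset.sum_eq_zero fun j hj => by rw [hx₀w j hj, sub_self]
  have hprob : ∀ A : Set (Fin k → ℝ), MeasurableSet A → ∀ n, k ≤ n →
      P (X n ⁻¹' (Subtype.val ⁻¹' A)) =
        (gibbsMass ν G I (n - k) univ)⁻¹ * gibbsMass ν G I (n - k) A := by
    intro A hA n hn
    have h1 : X n ⁻¹' (Subtype.val ⁻¹' A) = m n ⁻¹' (firstMoments hn ⁻¹' (Subtype.val ⁻¹' A)) := by
      ext ω
      simp only [mem_preimage, hX n hn ω]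
    have h2 : MeasurableSet (firstMoments hn ⁻¹' (Subtype.val ⁻¹' A) : Set (momentSpace E n)) :=
      ((measurable_castLE hn).comp measurable_subtype_coe) hA
    have hl := hm n (hk.trans hn)
    rw [h1, ← Measure.map_apply_of_aemeasurable hl.aemeasurable h2, hl.map_eq, hlaw n hn A hA]
  refine ⟨tendsto_natCast_atTop_atTop, hnonneg, ?_, fun K _ => hcompact K, ?_, ?_⟩
  · rw [lowerSemicontinuous_iff_isClosed_preimage]
    intro K
    induction K using EReal.rec with
    | bot =>
      convert isClosed_empty
      ext x
      simpa using (EReal.bot_lt_zero.trans_le (hnonneg x)).ne'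
    | coe K => exact (hcompact K).isClosed
    | top => convert isClosed_univ; ext x; simp
  · rintro _ ⟨O, hO, rfl⟩
    -- The lower bound is checked point by point; boundary points contribute `⊥`.
    rw [EReal.neg_le]
    refine le_iInf₂ fun x hx => ?_
    rw [EReal.neg_le]
    by_cases hxG : (x : Fin k → ℝ) ∈ G
    · rw [hrate x hxG, ← EReal.coe_neg]
      exact neg_le_liminf_gibbsMass hGo hIc hI0 hν k hO (hprob O hO.measurableSet) hx hxG
    · rw [hrate' x hxG]
      simp
  · intro U hU
    obtain ⟨A, hA, rfl⟩ := isClosed_induced_iff.1 hU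
    refine EReal.le_of_forall_lt_iff_le.1 fun z hz => ?_
    have hz' : ((-z : ℝ) : EReal) < ⨅ x ∈ (Subtype.val ⁻¹' A : Set (momentSpace E k)),
        momentRate E y W₁ W₂ w₁ w₂ k x := by
      rw [EReal.coe_neg]
      exact EReal.neg_lt_comm.1 hz
    have := limsup_gibbsMass_le hGo hIc hν hx₀ hIx₀ k hA.measurableSet (hprob A hA.measurableSet)
      (r := -z) fun x hx => ?_
    · rwa [neg_neg] at this
    · have h1 := hz'.le.trans (iInf₂_le (⟨x, interior_subset hx.1⟩ : momentSpace E k) hx.2)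
      rw [hrate _ hx.1] at h1
      exact EReal.coe_le_coe_iff.1 h1

end

/-! ### The moment functional, convexity of moment spaces and their interior. -/

theorem momentFunctional_add (s : ℕ → ℝ) (p q : ℝ[X]) :
    momentFunctional s (p + q) = momentFunctional s p + momentFunctional s q :=
  Polynomial.sum_add_index p q _ (by simp) (by intros; ring)

theorem momentFunctional_smul (s : ℕ → ℝ) (c : ℝ) (p : ℝ[X]) :
    momentFunctional s (c • p) = c * momentFunctional s p := by
  unfold momentFunctional
  rw [Polynomial.sum_smul_index p c _ (by simp), Polynomial.sum_def, Polynomial.sum_def,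
    Finset.mul_sum]
  exact Finset.sum_congr rfl fun i _ => by ring

/-- The moment functional as a linear map. -/
def momentLinear (s : ℕ → ℝ) : ℝ[X] →ₗ[ℝ] ℝ where
  toFun := momentFunctional s
  map_add' := momentFunctional_add s
  map_smul' := momentFunctional_smul s

theorem momentLinear_apply (s : ℕ → ℝ) (p : ℝ[X]) : momentLinear s p = momentFunctional s p := rfl

theorem momentFunctional_eq_sum {s : ℕ → ℝ} {p : ℝ[X]} {n : ℕ} (hp : p.natDegree ≤ n) :
    momentFunctional s p = ∑ i ∈ Finset.range (n + 1), p.coeff i * s i :=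
  Polynomial.sum_over_range' p (by simp) (n + 1) (by omega)

theorem momentFunctional_congr {s s' : ℕ → ℝ} {p : ℝ[X]} {n : ℕ} (hp : p.natDegree ≤ n)
    (h : ∀ i ≤ n, s i = s' i) : momentFunctional s p = momentFunctional s' p := by
  rw [momentFunctional_eq_sum hp, momentFunctional_eq_sum hp]
  refine Finset.sum_congr rfl fun i hi => ?_
  rw [h i (by simp at hi; omega)]

theorem IsMomentMeasure.integral_eval {E : Set ℝ} {μ : Measure ℝ} (hμ : IsMomentMeasure E μ)
    (p : ℝ[X]) : ∫ x, p.eval x ∂μ = momentFunctional (fun i => ∫ x, x ^ i ∂μ) p := by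
  rw [momentFunctional_eq_sum le_rfl]
  simp_rw [Polynomial.eval_eq_sum_range]
  rw [integral_finsetSum _ fun i _ => (hμ.integrable_pow i).const_mul _]
  exact Finset.sum_congr rfl fun i _ => integral_const_mul _ _

theorem IsMomentMeasure.momentFunctional_nonneg {E : Set ℝ} {μ : Measure ℝ}
    (hμ : IsMomentMeasure E μ) {s : ℕ → ℝ} {n : ℕ} (hs : ∀ i ≤ n, s i = ∫ x, x ^ i ∂μ) {p : ℝ[X]}
    (hp : p.natDegree ≤ n) (hpE : ∀ x ∈ E, 0 ≤ p.eval x) : 0 ≤ momentFunctional s p := by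
  rw [momentFunctional_congr hp hs, ← hμ.integral_eval]
  refine integral_nonneg_of_ae ?_
  filter_upwards [measure_eq_zero_iff_ae_notMem.1 hμ.carried] with x hx
  exact hpE x (not_not.1 hx)

theorem IsMomentMeasure.integral_pow_zero {E : Set ℝ} {μ : Measure ℝ} (hμ : IsMomentMeasure E μ) :
    ∫ x, x ^ 0 ∂μ = 1 := by
  have := hμ.isProbabilityMeasure
  simp

theorem isMomentMeasure_dirac {E : Set ℝ} (hE : MeasurableSet E) {x : ℝ} (hx : x ∈ E) :
    IsMomentMeasure E (Measure.dirac x) :=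
  ⟨inferInstance, by rw [Measure.dirac_apply' _ hE.compl]; simpa using hx,
    fun j => (integrable_dirac (by simp))⟩

theorem IsMomentMeasure.exists_convexCombo {E : Set ℝ} {μ ν : Measure ℝ} (hμ : IsMomentMeasure E μ)
    (hν : IsMomentMeasure E ν) {a b : ℝ} (ha : 0 ≤ a) (hb : 0 ≤ b) (hab : a + b = 1) :
    ∃ ρ, IsMomentMeasure E ρ ∧
      ∀ j : ℕ, ∫ x, x ^ j ∂ρ = a * ∫ x, x ^ j ∂μ + b * ∫ x, x ^ j ∂ν := by
  have := hμ.isProbabilityMeasure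
  have := hν.isProbabilityMeasure
  have h1 := fun j => (hμ.integrable_pow j).smul_measure (c := ENNReal.ofReal a) (by simp)
  have h2 := fun j => (hν.integrable_pow j).smul_measure (c := ENNReal.ofReal b) (by simp)
  refine ⟨ENNReal.ofReal a • μ + ENNReal.ofReal b • ν, ⟨⟨?_⟩, ?_, fun j => (h1 j).add_measure (h2 j)⟩,
    fun j => ?_⟩
  · simp [← ENNReal.ofReal_add ha hb, hab]
  · simp [hμ.carried, hν.carried]
  · rw [integral_add_measure (h1 j) (h2 j), integral_smul_measure, integral_smul_measure,
      ENNReal.toReal_ofReal ha, ENNReal.toReal_ofReal hb, smul_eq_mul, smul_eq_mul]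

theorem convex_momentSpace (E : Set ℝ) (n : ℕ) : Convex ℝ (momentSpace E n) := by
  rintro m ⟨μ, hμ, hm⟩ m' ⟨ν, hν, hm'⟩ a b ha hb hab
  obtain ⟨ρ, hρ, h⟩ := hμ.exists_convexCombo hν ha hb hab
  exact ⟨ρ, hρ, fun i => by simp [h, hm i, hm' i]⟩

/-- Convex sets in finite dimension have a Lebesgue-null frontier. -/
theorem nullMeasurableSet_momentSpace (E : Set ℝ) (n : ℕ) :
    NullMeasurableSet (momentSpace E n) :=
  (convex_momentSpace E n).nullMeasurableSet _

theorem momentAt_succ {n : ℕ} (m : Fin n → ℝ) (i : Fin n) : momentAt m (i + 1) = m i := by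
  simp [momentAt]

theorem momentAt_init {n : ℕ} (m : Fin (n + 1) → ℝ) {i : ℕ} (hi : i ≤ n) :
    momentAt (Fin.init m) i = momentAt m i := by
  cases i with
  | zero => rfl
  | succ i =>
    rw [momentAt, momentAt, dif_pos (by omega), dif_pos (by omega)]
    rfl

theorem momentAt_last {n : ℕ} (m : Fin (n + 1) → ℝ) : momentAt m (n + 1) = m (Fin.last n) := by
  rw [momentAt, dif_pos (by omega)]; rfl

theorem momentAt_eq_zero {n : ℕ} (m : Fin n → ℝ) : momentAt m (n + 1) = 0 := by
  rw [momentAt, dif_neg (by omega)]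

/-- The default value `0` of `momentAt` beyond the length matters: the functional of `Fin.init m`
ignores the coefficient of order `n + 1`, which makes the affine dependence on the last moment
explicit. -/
theorem momentFunctional_momentAt_succ {n : ℕ} (m : Fin (n + 1) → ℝ) {p : ℝ[X]}
    (hp : p.natDegree ≤ n + 1) : momentFunctional (momentAt m) p =
      momentFunctional (momentAt (Fin.init m)) p + p.coeff (n + 1) * m (Fin.last n) := by
  rw [momentFunctional_eq_sum hp, momentFunctional_eq_sum hp, Finset.sum_range_succ,
    Finset.sum_range_succ _ (n + 1), momentAt_last, momentAt_eq_zero, mul_zero, add_zero]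
  congr 1
  refine Finset.sum_congr rfl fun i hi => ?_
  rw [momentAt_init m (by simp at hi; omega)]

theorem momentFunctional_momentAt {n : ℕ} (m : Fin n → ℝ) {p : ℝ[X]} (hp : p.natDegree ≤ n) :
    momentFunctional (momentAt m) p = p.coeff 0 + ∑ i : Fin n, p.coeff (i + 1) * m i := by
  rw [momentFunctional_eq_sum hp, Finset.sum_range_succ', add_comm, Finset.sum_range]
  simp [momentAt]

theorem momentAt_eq_integral {E : Set ℝ} {n : ℕ} {m : Fin n → ℝ} {μ : Measure ℝ}
    (hμ : IsMomentMeasure E μ) (hm : ∀ i : Fin n, m i = ∫ x, x ^ ((i : ℕ) + 1) ∂μ) {i : ℕ}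
    (hi : i ≤ n) : momentAt m i = ∫ x, x ^ i ∂μ := by
  cases i with
  | zero => exact hμ.integral_pow_zero.symm
  | succ i => rw [momentAt, dif_pos (by omega), hm]

theorem momentFunctional_nonneg_of_mem {E : Set ℝ} {n : ℕ} {m : Fin n → ℝ}
    (hm : m ∈ momentSpace E n) {p : ℝ[X]} (hp : p.natDegree ≤ n) (hpE : ∀ x ∈ E, 0 ≤ p.eval x) :
    0 ≤ momentFunctional (momentAt m) p := by
  obtain ⟨μ, hμ, h⟩ := hm
  exact hμ.momentFunctional_nonneg (fun i hi => momentAt_eq_integral hμ h hi) hp hpE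

/-- The polynomial `c + ∑ aᵢ x ^ (i + 1)`. -/
noncomputable def affinePoly {n : ℕ} (c : ℝ) (a : Fin n → ℝ) : ℝ[X] :=
  C c + ∑ i : Fin n, C (a i) * X ^ ((i : ℕ) + 1)

theorem natDegree_affinePoly_le {n : ℕ} (c : ℝ) (a : Fin n → ℝ) :
    (affinePoly c a).natDegree ≤ n := by
  refine (natDegree_add_le _ _).trans (max_le (by simp) ?_)
  refine natDegree_sum_le_of_forall_le _ _ fun i _ => ?_
  exact (natDegree_C_mul_X_pow_le _ _).trans i.2

theorem coeff_zero_affinePoly {n : ℕ} (c : ℝ) (a : Fin n → ℝ) : (affinePoly c a).coeff 0 = c := by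
  simp [affinePoly, coeff_X_pow]

theorem coeff_succ_affinePoly {n : ℕ} (c : ℝ) (a : Fin n → ℝ) (i : Fin n) :
    (affinePoly c a).coeff (i + 1) = a i := by
  simp only [affinePoly, coeff_add, coeff_C_succ, finsetSum_coeff, coeff_C_mul, coeff_X_pow,
    zero_add]
  rw [Finset.sum_eq_single i]
  · simp
  · intro j _ hj
    rw [if_neg, mul_zero]
    intro h
    exact hj (Fin.ext (by omega))
  · simp

theorem eval_affinePoly {n : ℕ} (c : ℝ) (a : Fin n → ℝ) (x : ℝ) :
    (affinePoly c a).eval x = c + ∑ i : Fin n, a i * x ^ ((i : ℕ) + 1) := by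
  simp [affinePoly, eval_finsetSum]

theorem momentCurve_mem {E : Set ℝ} (hE : MeasurableSet E) (n : ℕ) {x : ℝ} (hx : x ∈ E) :
    (fun i : Fin n => x ^ ((i : ℕ) + 1)) ∈ momentSpace E n :=
  ⟨_, isMomentMeasure_dirac hE hx, fun i => by simp⟩

theorem apply_eq_sum_single {n : ℕ} (f : (Fin n → ℝ) →ₗ[ℝ] ℝ) (v : Fin n → ℝ) :
    f v = ∑ i, f (Pi.single i 1) * v i := by
  conv_lhs => rw [pi_eq_sum_univ' v]
  simp [mul_comm]

/-- Otherwise a nonzero linear functional would be constant on the moment curve over `E`, giving a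
polynomial with infinitely many roots but some nonzero coefficient. -/
theorem nonempty_interior_momentSpace {E : Set ℝ} (hE : MeasurableSet E) (hinf : E.Infinite)
    (n : ℕ) : (interior (momentSpace E n)).Nonempty := by
  rw [(convex_momentSpace E n).interior_nonempty_iff_affineSpan_eq_top]
  obtain ⟨x₀, hx₀⟩ := hinf.nonempty
  have h0 := momentCurve_mem hE n hx₀
  rw [AffineSubspace.affineSpan_eq_top_iff_vectorSpan_eq_top_of_nonempty ℝ _ _ ⟨_, h0⟩]
  by_contra hne
  obtain ⟨f, hf, hker⟩ := Submodule.exists_le_ker_of_lt_top _ (lt_top_iff_ne_top.2 hne)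
  have hq : affinePoly (-f fun i : Fin n => x₀ ^ ((i : ℕ) + 1)) (fun i => f (Pi.single i 1)) = 0 := by
    refine Polynomial.eq_zero_of_infinite_isRoot _ (hinf.mono fun x hx => ?_)
    have h1 := hker (vsub_mem_vectorSpan ℝ (momentCurve_mem hE n hx) h0)
    rw [LinearMap.mem_ker, vsub_eq_sub, map_sub, apply_eq_sum_single f
      (fun i : Fin n => x ^ ((i : ℕ) + 1))] at h1
    show eval x _ = 0
    rw [eval_affinePoly]
    linarith
  refine hf (LinearMap.ext fun v => ?_)
  rw [apply_eq_sum_single]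
  refine Finset.sum_eq_zero fun i _ => ?_
  rw [← coeff_succ_affinePoly (-f fun i : Fin n => x₀ ^ ((i : ℕ) + 1))
    (fun i => f (Pi.single i 1)) i, hq]
  simp

/-- The functional of `s` is strictly positive on the nonzero polynomials of degree at most `n`
that are nonnegative on `E`. -/
def IsMomentPositive (E : Set ℝ) (s : ℕ → ℝ) (n : ℕ) : Prop :=
  ∀ q : ℝ[X], q ≠ 0 → q.natDegree ≤ n → (∀ x ∈ E, 0 ≤ q.eval x) → 0 < momentFunctional s q

/-- An affine functional on `ℝⁿ`, restricted to the moment curve, is a polynomial of degree at most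
`n`. If a nonnegative nonconstant polynomial had nonpositive mean, moving `m` slightly against its
coefficients would give a moment vector of negative mean. Conversely, a supporting hyperplane at a
noninterior point is a nonzero nonnegative polynomial of mean zero. -/
theorem mem_interior_momentSpace_iff {E : Set ℝ} (hE : MeasurableSet E) (hinf : E.Infinite) {n : ℕ}
    {m : Fin n → ℝ} :
    m ∈ interior (momentSpace E n) ↔ IsMomentPositive E (momentAt m) n := by
  obtain ⟨x₀, hx₀⟩ := hinf.nonempty
  constructor
  · intro hm q hq0 hqn hqE
    -- A constant polynomial offers no direction to move in, but its mean is the constant itself.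
    rcases eq_or_ne (fun i : Fin n => q.coeff (i + 1)) 0 with ha | ha
    · have hc : ∀ i : Fin n, q.coeff (i + 1) = 0 := fun i => congrFun ha i
      have hq : q = C (q.coeff 0) := by
        ext i
        cases i with
        | zero => simp
        | succ i =>
          rw [coeff_C_succ]
          rcases lt_or_ge i n with h | h
          · exact hc ⟨i, h⟩
          · exact coeff_eq_zero_of_natDegree_lt (by omega)
      rw [momentFunctional_momentAt m hqn]
      simp only [hc, zero_mul, Finset.sum_const_zero, add_zero]
      have h1 := hqE x₀ hx₀
      rw [hq, eval_C] at h1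
      refine lt_of_le_of_ne h1 fun h => hq0 ?_
      rw [hq, ← h, C_0]
    · by_contra hle
      rw [not_lt] at hle
      set a : Fin n → ℝ := fun i => q.coeff (i + 1)
      have hcont : Tendsto (fun ε : ℝ => m - ε • a) (nhdsWithin 0 (Ioi 0)) (nhds m) := by
        have : Continuous fun ε : ℝ => m - ε • a := by fun_prop
        simpa using (this.tendsto 0).mono_left nhdsWithin_le_nhds
      have hev := hcont.eventually (mem_interior_iff_mem_nhds.1 hm)
      obtain ⟨ε, hε, hε0⟩ := (hev.and self_mem_nhdsWithin).exists
      have h1 := momentFunctional_nonneg_of_mem hε hqn hqE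
      rw [momentFunctional_momentAt _ hqn] at h1 hle
      have h2 : 0 < ∑ i, a i * a i := by
        obtain ⟨i, hi⟩ := Function.ne_iff.1 ha
        exact Finset.sum_pos' (fun i _ => mul_self_nonneg _)
          ⟨i, Finset.mem_univ i, mul_self_pos.2 hi⟩
      have h3 : ∑ i : Fin n, q.coeff (i + 1) * (m - ε • a) i =
          ∑ i : Fin n, q.coeff (i + 1) * m i - ε * ∑ i, a i * a i := by
        rw [Finset.mul_sum, ← Finset.sum_sub_distrib]
        refine Finset.sum_congr rfl fun i _ => ?_
        simp only [Pi.sub_apply, Pi.smul_apply, smul_eq_mul, a]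
        ring
      rw [h3] at h1
      have := mul_pos hε0 h2
      linarith
  · intro hpos
    by_contra hm
    have hconv := convex_momentSpace E n
    have hne := nonempty_interior_momentSpace hE hinf n
    obtain ⟨f, hf⟩ := geometric_hahn_banach_open_point hconv.interior isOpen_interior hm
    -- Separation holds on the interior only; convexity puts the whole moment space in the closure
    -- of its interior.
    have hf' : ∀ v ∈ momentSpace E n, f v ≤ f m := by
      intro v hv
      have hcl : v ∈ closure (interior (momentSpace E n)) := by
        rw [hconv.closure_interior_eq_closure_of_nonempty_interior hne]
        exact subset_closure hv
      exact closure_minimal (fun z hz => (hf z hz).le) (isClosed_le f.continuous continuous_const) hcl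
    have happ : ∀ v, f v = ∑ i, f (Pi.single i 1) * v i := apply_eq_sum_single f.toLinearMap
    set q := affinePoly (f m) (fun i : Fin n => -f (Pi.single i 1)) with hq
    have h0 : momentFunctional (momentAt m) q = 0 := by
      rw [momentFunctional_momentAt _ (natDegree_affinePoly_le _ _), coeff_zero_affinePoly, happ]
      simp [coeff_succ_affinePoly]
    have hqE : ∀ x ∈ E, 0 ≤ q.eval x := by
      intro x hx
      have := hf' _ (momentCurve_mem hE n hx)
      rw [happ] at this
      rw [eval_affinePoly]
      simp only [neg_mul, Finset.sum_neg_distrib]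
      linarith
    have hq0 : q ≠ 0 := by
      intro h
      obtain ⟨z, hz⟩ := hne
      have hlt := hf z hz
      have hz0 : ∀ i : Fin n, f (Pi.single i 1) = 0 := by
        intro i
        have := coeff_succ_affinePoly (f m) (fun i : Fin n => -f (Pi.single i 1)) i
        rw [← hq, h, coeff_zero] at this
        linarith
      rw [happ z, happ m] at hlt
      simp [hz0] at hlt
    exact (hpos q hq0 (natDegree_affinePoly_le _ _) hqE).ne' h0

/-! ### Moment sections: truncation, interior and convexity of the lower end point. -/

theorem IsMomentPositive.mono {E : Set ℝ} {s s' : ℕ → ℝ} {n n' : ℕ}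
    (h : IsMomentPositive E s n) (hn : n' ≤ n) (hs : ∀ i ≤ n', s' i = s i) :
    IsMomentPositive E s' n' := by
  intro q hq0 hqn hqE
  rw [momentFunctional_congr hqn hs]
  exact h q hq0 (hqn.trans hn) hqE

theorem momentSection_congr {E : Set ℝ} {n n' : ℕ} {m : Fin n → ℝ} {m' : Fin n' → ℝ} {j : ℕ}
    (h : ∀ i < j, momentAt m i = momentAt m' i) : momentSection E m j = momentSection E m' j := by
  ext t
  constructor
  · rintro ⟨μ, hμ, h1, h2⟩
    exact ⟨μ, hμ, fun i hi => (h1 i hi).trans (h i hi), h2⟩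
  · rintro ⟨μ, hμ, h1, h2⟩
    exact ⟨μ, hμ, fun i hi => (h1 i hi).trans (h i hi).symm, h2⟩

theorem momentSection_init (E : Set ℝ) {n : ℕ} (m : Fin (n + 1) → ℝ) {j : ℕ} (hj : j ≤ n + 1) :
    momentSection E (Fin.init m) j = momentSection E m j :=
  momentSection_congr fun _ hi => momentAt_init m (by omega)

theorem lowerMoment_init (E : Set ℝ) {n : ℕ} (m : Fin (n + 1) → ℝ) {j : ℕ} (hj : j ≤ n + 1) :
    lowerMoment E (Fin.init m) j = lowerMoment E m j :=
  congrArg sInf (momentSection_init E m hj)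

theorem upperMoment_init (E : Set ℝ) {n : ℕ} (m : Fin (n + 1) → ℝ) {j : ℕ} (hj : j ≤ n + 1) :
    upperMoment E (Fin.init m) j = upperMoment E m j :=
  congrArg sSup (momentSection_init E m hj)

theorem mem_momentSection_iff {E : Set ℝ} {n : ℕ} {m : Fin n → ℝ} {t : ℝ} :
    t ∈ momentSection E m (n + 1) ↔
      (Fin.snoc (α := fun _ => ℝ) m t : Fin (n + 1) → ℝ) ∈ momentSpace E (n + 1) := by
  have hinit : Fin.init (Fin.snoc (α := fun _ => ℝ) m t : Fin (n + 1) → ℝ) = m := Fin.init_snoc ..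
  have hlast : (Fin.snoc (α := fun _ => ℝ) m t : Fin (n + 1) → ℝ) (Fin.last n) = t :=
    Fin.snoc_last ..
  constructor
  · rintro ⟨μ, hμ, h1, h2⟩
    refine ⟨μ, hμ, fun i => ?_⟩
    rw [← momentAt_succ (Fin.snoc (α := fun _ => ℝ) m t : Fin (n + 1) → ℝ) i]
    induction i using Fin.lastCases with
    | last => rw [Fin.val_last, momentAt_last, hlast, h2]
    | cast i =>
      rw [← momentAt_init _ (by simp), hinit, h1]
      simp
  · rintro ⟨μ, hμ, h⟩
    refine ⟨μ, hμ, fun i hi => ?_, ?_⟩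
    · rw [← momentAt_eq_integral hμ h hi.le, ← momentAt_init _ (by omega), hinit]
    · rw [← momentAt_eq_integral hμ h le_rfl, momentAt_last, hlast]

theorem nonempty_momentSection {E : Set ℝ} {n : ℕ} {m : Fin n → ℝ} (hm : m ∈ momentSpace E n) :
    (momentSection E m (n + 1)).Nonempty := by
  obtain ⟨μ, hμ, h⟩ := hm
  exact ⟨_, μ, hμ, fun i hi => (momentAt_eq_integral hμ h (by omega)).symm, rfl⟩

theorem convex_momentSection (E : Set ℝ) {n : ℕ} (m : Fin n → ℝ) (j : ℕ) :
    Convex ℝ (momentSection E m j) := by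
  rintro t ⟨μ, hμ, h1, h2⟩ t' ⟨ν, hν, h1', h2'⟩ a b ha hb hab
  obtain ⟨ρ, hρ, h⟩ := hμ.exists_convexCombo hν ha hb hab
  refine ⟨ρ, hρ, fun i hi => ?_, ?_⟩
  · rw [h, h1 i hi, h1' i hi, ← add_mul, hab, one_mul]
  · rw [h, h2, h2']; rfl

theorem momentFunctional_add_mul_nonneg {E : Set ℝ} {n : ℕ} {m : Fin n → ℝ} {t : ℝ}
    (ht : t ∈ momentSection E m (n + 1)) {q : ℝ[X]} (hq : q.natDegree ≤ n + 1)
    (hqE : ∀ x ∈ E, 0 ≤ q.eval x) :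
    0 ≤ momentFunctional (momentAt m) q + q.coeff (n + 1) * t := by
  have := momentFunctional_nonneg_of_mem (mem_momentSection_iff.1 ht) hq hqE
  rwa [momentFunctional_momentAt_succ _ hq, Fin.init_snoc, Fin.snoc_last] at this

theorem interior_momentSpace_init {E : Set ℝ} (hE : MeasurableSet E) (hinf : E.Infinite) {n : ℕ}
    {m : Fin (n + 1) → ℝ} (hm : m ∈ interior (momentSpace E (n + 1))) :
    Fin.init m ∈ interior (momentSpace E n) := by
  rw [mem_interior_momentSpace_iff hE hinf] at hm ⊢
  exact hm.mono n.le_succ fun i hi => momentAt_init m hi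

/-- Over the interior, strict positivity in the next degree only concerns polynomials of exactly
that degree. -/
theorem mem_interior_succ_of_forall {E : Set ℝ} (hE : MeasurableSet E) (hinf : E.Infinite) {n : ℕ}
    {m : Fin (n + 1) → ℝ} (hm : Fin.init m ∈ interior (momentSpace E n))
    (h : ∀ q : ℝ[X], q.natDegree = n + 1 → (∀ x ∈ E, 0 ≤ q.eval x) →
      0 < momentFunctional (momentAt (Fin.init m)) q + q.coeff (n + 1) * m (Fin.last n)) :
    m ∈ interior (momentSpace E (n + 1)) := by
  rw [mem_interior_momentSpace_iff hE hinf] at hm ⊢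
  intro q hq0 hqn hqE
  rw [momentFunctional_momentAt_succ m hqn]
  rcases Nat.lt_or_ge n q.natDegree with hlt | hle
  · exact h q (by omega) hqE
  · rw [coeff_eq_zero_of_natDegree_lt (by omega), zero_mul, add_zero]
    exact hm q hq0 hle hqE

/-- For the converse: the mean of a nonnegative polynomial of degree `n + 1` is affine with nonzero
slope in the last moment and nonnegative on both sides of the given value, hence strictly positive
at it. -/
theorem mem_interior_succ_iff {E : Set ℝ} (hE : MeasurableSet E) (hinf : E.Infinite) {n : ℕ}
    {m : Fin (n + 1) → ℝ} : m ∈ interior (momentSpace E (n + 1)) ↔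
      Fin.init m ∈ interior (momentSpace E n) ∧
        m (Fin.last n) ∈ interior (momentSection E (Fin.init m) (n + 1)) := by
  constructor
  · intro hm
    refine ⟨interior_momentSpace_init hE hinf hm, ?_⟩
    have hcont : Continuous fun t : ℝ =>
        (Fin.snoc (α := fun _ => ℝ) (Fin.init m) t : Fin (n + 1) → ℝ) :=
      Continuous.finSnoc (A := fun _ => ℝ) continuous_const continuous_id
    refine mem_interior.2 ⟨_, fun t ht => ?_,
      (isOpen_interior (s := momentSpace E (n + 1))).preimage hcont, ?_⟩
    · exact mem_momentSection_iff.2 (interior_subset ht)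
    · rw [mem_preimage, Fin.snoc_init_self]; exact hm
  · rintro ⟨h1, h2⟩
    refine mem_interior_succ_of_forall hE hinf h1 fun q hq hqE => ?_
    obtain ⟨δ, hδ, hball⟩ := Metric.isOpen_iff.1 isOpen_interior _ h2
    have hc : q.coeff (n + 1) ≠ 0 := by
      rw [← hq]
      exact leadingCoeff_ne_zero.2 (by rintro rfl; simp at hq)
    have key : ∀ ε, |ε| < δ → 0 ≤ momentFunctional (momentAt (Fin.init m)) q +
        q.coeff (n + 1) * (m (Fin.last n) + ε) := fun ε hε =>
      momentFunctional_add_mul_nonneg (interior_subset (hball (by simpa [Real.dist_eq] using hε)))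
        hq.le hqE
    have h3 := key (δ / 2) (by rw [abs_of_pos (by linarith)]; linarith)
    have h4 := key (-(δ / 2)) (by rw [abs_neg, abs_of_pos (by linarith)]; linarith)
    rcases lt_or_gt_of_ne hc with hlt | hgt
    · nlinarith
    · nlinarith

/-- Take an interior point `z` one level up and push `m` slightly away from its projection. The
pushed point lifts to some moment vector, and a convex combination of that lift with `z` is an
interior point lying over `m`. -/
theorem nonempty_interior_momentSection {E : Set ℝ} (hE : MeasurableSet E) (hinf : E.Infinite)
    {n : ℕ} {m : Fin n → ℝ} (hm : m ∈ interior (momentSpace E n)) :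
    (interior (momentSection E m (n + 1))).Nonempty := by
  obtain ⟨z, hz⟩ := nonempty_interior_momentSpace hE hinf (n + 1)
  have hcont : Tendsto (fun ε : ℝ => m + ε • (m - Fin.init z)) (nhdsWithin 0 (Ioi 0)) (nhds m) := by
    have : Continuous fun ε : ℝ => m + ε • (m - Fin.init z) := by fun_prop
    simpa using (this.tendsto 0).mono_left nhdsWithin_le_nhds
  obtain ⟨ε, hε, hε0⟩ := ((hcont.eventually (mem_interior_iff_mem_nhds.1 hm)).and
    self_mem_nhdsWithin).exists
  have hε0 : (0 : ℝ) < ε := hε0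
  obtain ⟨t, ht⟩ := nonempty_momentSection (show _ ∈ momentSpace E n from hε)
  -- These weights are the ones for which the first `n` entries of the combination are exactly `m`.
  have h1 := (convex_momentSpace E (n + 1)).combo_interior_self_mem_interior hz
    (mem_momentSection_iff.1 ht) (a := ε / (1 + ε)) (b := 1 / (1 + ε)) (by positivity)
    (by positivity) (by field_simp; ring)
  have h2 := ((mem_interior_succ_iff hE hinf).1 h1).2
  have hinit : Fin.init ((ε / (1 + ε)) • z + (1 / (1 + ε)) •
      (Fin.snoc (α := fun _ => ℝ) (m + ε • (m - Fin.init z)) t : Fin (n + 1) → ℝ)) = m := by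
    ext i
    simp only [Fin.init, Pi.add_apply, Pi.smul_apply, smul_eq_mul, Fin.snoc_castSucc, Pi.sub_apply]
    field_simp
    ring
  rw [hinit] at h2
  exact ⟨_, h2⟩

/-- This is the lower boundary of a convex set over its projection. Convexity is wanted for
continuity on the interior, needed for the offset `c` in the triangular structure. -/
theorem convexOn_lowerMoment {E : Set ℝ} (n : ℕ)
    (hbdd : ∀ m ∈ momentSpace E n, BddBelow (momentSection E m (n + 1))) :
    ConvexOn ℝ (momentSpace E n) fun m => lowerMoment E m (n + 1) := by
  refine ⟨convex_momentSpace E n, fun m hm m' hm' a b ha hb hab => ?_⟩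
  refine le_of_forall_pos_le_add fun δ hδ => ?_
  obtain ⟨t, ht, htl⟩ := Real.lt_sInf_add_pos (nonempty_momentSection hm) hδ
  obtain ⟨t', ht', htl'⟩ := Real.lt_sInf_add_pos (nonempty_momentSection hm') hδ
  have h1 := convex_momentSpace E (n + 1) (mem_momentSection_iff.1 ht) (mem_momentSection_iff.1 ht')
    ha hb hab
  have h2 : a • t + b • t' ∈ momentSection E (a • m + b • m') (n + 1) := by
    rw [mem_momentSection_iff]
    convert h1 using 1
    ext i
    induction i using Fin.lastCases <;> simp
  have h3 := csInf_le (hbdd _ (convex_momentSpace E n hm hm' ha hb hab)) h2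
  refine h3.trans ?_
  have h4 := mul_le_mul_of_nonneg_left htl.le ha
  have h5 := mul_le_mul_of_nonneg_left htl'.le hb
  simp only [smul_eq_mul, lowerMoment]
  nlinarith

theorem continuousOn_lowerMoment {E : Set ℝ} (n : ℕ)
    (hbdd : ∀ m ∈ momentSpace E n, BddBelow (momentSection E m (n + 1))) :
    ContinuousOn (fun m => lowerMoment E m (n + 1)) (interior (momentSpace E n)) :=
  (convexOn_lowerMoment n hbdd).continuousOn_interior

theorem momentSpace_zero {E : Set ℝ} (hE : MeasurableSet E) (hne : E.Nonempty) :
    momentSpace E 0 = univ := by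
  obtain ⟨x, hx⟩ := hne
  exact eq_univ_of_forall fun m => ⟨_, isMomentMeasure_dirac hE hx, fun i => i.elim0⟩

theorem alternating_self {α : Type*} (a : α) (j : ℕ) : alternating a a j = a := by
  simp [alternating]

/-! ### The half line. -/

theorem coeff_pos_of_nonneg_Ici {q : ℝ[X]} {n : ℕ} (hq : q.natDegree = n + 1)
    (hqE : ∀ x ∈ Ici (0 : ℝ), 0 ≤ q.eval x) : 0 < q.coeff (n + 1) := by
  by_contra hle
  have hdeg : 0 < q.degree := by
    rw [← natDegree_pos_iff_degree_pos]; omega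
  have hlim := q.tendsto_atBot_of_leadingCoeff_nonpos hdeg
    (by rw [leadingCoeff, hq]; exact not_lt.1 hle)
  obtain ⟨x, hx, hx0⟩ := ((hlim.eventually (eventually_lt_atBot 0)).and
    (eventually_ge_atTop (0 : ℝ))).exists
  exact absurd (hqE x hx0) (not_le.2 hx)

theorem bddBelow_momentSection_Ici {n : ℕ} (m : Fin n → ℝ) (j : ℕ) :
    BddBelow (momentSection (Ici 0) m j) := by
  refine ⟨0, ?_⟩
  rintro t ⟨μ, hμ, -, rfl⟩
  refine integral_nonneg_of_ae ?_
  filter_upwards [measure_eq_zero_iff_ae_notMem.1 hμ.carried] with x hx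
  exact pow_nonneg (not_not.1 hx : x ∈ Ici 0) j

/-- Nonnegative polynomials on the half line have positive leading coefficient, so raising the last
moment only increases their means: the section has no upper constraint. -/
theorem mem_interior_Ici_succ_iff {n : ℕ} {m : Fin (n + 1) → ℝ} :
    m ∈ interior (momentSpace (Ici 0) (n + 1)) ↔ Fin.init m ∈ interior (momentSpace (Ici 0) n) ∧
      lowerMoment (Ici 0) (Fin.init m) (n + 1) < m (Fin.last n) := by
  constructor
  · intro hm
    obtain ⟨h1, h2⟩ := (mem_interior_succ_iff measurableSet_Ici (Ici_infinite 0)).1 hm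
    refine ⟨h1, ?_⟩
    obtain ⟨δ, hδ, hball⟩ := Metric.isOpen_iff.1 isOpen_interior _ h2
    have h3 : m (Fin.last n) - δ / 2 ∈ momentSection (Ici 0) (Fin.init m) (n + 1) :=
      interior_subset (hball (by simp [abs_of_pos hδ, hδ]))
    have := csInf_le (bddBelow_momentSection_Ici _ _) h3
    rw [lowerMoment]
    linarith
  · rintro ⟨h1, h2⟩
    obtain ⟨t, ht, htl⟩ := exists_lt_of_csInf_lt (nonempty_momentSection (interior_subset h1)) h2
    refine mem_interior_succ_of_forall measurableSet_Ici (Ici_infinite 0) h1 fun q hq hqE => ?_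
    have h3 := momentFunctional_add_mul_nonneg ht hq.le hqE
    have h4 := mul_lt_mul_of_pos_left htl (coeff_pos_of_nonneg_Ici hq hqE)
    linarith

theorem halfLineGap_init {n : ℕ} (m : Fin (n + 1) → ℝ) {j : ℕ} (hj : j ≤ n) :
    halfLineGap (Fin.init m) j = halfLineGap m j := by
  cases j with
  | zero => rfl
  | succ j => rw [halfLineGap, halfLineGap, momentAt_init m hj, lowerMoment_init _ m (by omega)]

theorem halfLineGap_last {n : ℕ} (m : Fin (n + 1) → ℝ) :
    halfLineGap m (n + 1) = m (Fin.last n) - lowerMoment (Ici 0) (Fin.init m) (n + 1) := by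
  rw [halfLineGap, momentAt_last, lowerMoment_init _ m le_rfl]

theorem halfLineGap_pos {n : ℕ} {m : Fin n → ℝ} (hm : m ∈ interior (momentSpace (Ici 0) n)) {j : ℕ}
    (hj : j ≤ n) : 0 < halfLineGap m j := by
  induction n with
  | zero =>
    obtain rfl : j = 0 := by omega
    exact one_pos
  | succ n ih =>
    obtain ⟨h1, h2⟩ := mem_interior_Ici_succ_iff.1 hm
    rcases Nat.lt_or_ge n j with h | h
    · obtain rfl : j = n + 1 := by omega
      rw [halfLineGap_last]
      exact sub_pos.2 h2
    · rw [← halfLineGap_init m h]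
      exact ih h1 h

/-- The quotients telescope. For `l = n` this is the denominator of the next coordinate, so the
weight is the identity. -/
theorem prod_halfLineCoord {n : ℕ} {m : Fin n → ℝ} (hm : m ∈ interior (momentSpace (Ici 0) n))
    {l : ℕ} (hl : l ≤ n) : ∏ j ∈ Finset.Icc 1 l, halfLineCoord n m j = halfLineGap m l := by
  induction l with
  | zero => simp [halfLineGap]
  | succ l ih =>
    rw [prod_Icc_one_succ, ih (by omega), halfLineCoord, Nat.add_sub_cancel]
    exact mul_div_cancel₀ _ (halfLineGap_pos hm (by omega)).ne'

theorem triangularCoordinates_halfLine :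
    TriangularCoordinates (fun n => interior (momentSpace (Ici 0) n)) halfLineCoord
      (alternating (Ioi 0) (Ioi 0)) (alternating (fun z => z) fun z => z) where
  isOpen _ := isOpen_interior
  zero_eq := by rw [momentSpace_zero measurableSet_Ici nonempty_Ici, interior_univ]
  coord_init n m _ j hj := by
    have hj := Finset.mem_Icc.1 hj
    rw [halfLineCoord, halfLineCoord, halfLineGap_init m hj.2, halfLineGap_init m (by omega)]
  mem_succ_iff n m := by
    rw [mem_interior_Ici_succ_iff, alternating_self]
    refine and_congr_right fun hm => ?_
    rw [halfLineCoord, Nat.add_sub_cancel, ← halfLineGap_init m le_rfl, halfLineGap_last, mem_Ioi,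
      div_pos_iff_of_pos_right (halfLineGap_pos hm le_rfl), sub_pos]
  isOpen_range j := by rw [alternating_self]; exact isOpen_Ioi
  weight_pos j t ht := by rw [alternating_self] at ht ⊢; exact ht
  weight_cont j := by rw [alternating_self]; exact continuousOn_id
  affine n := by
    refine ⟨fun m => lowerMoment (Ici 0) m (n + 1), 1, one_pos,
      continuousOn_lowerMoment n fun m _ => bddBelow_momentSection_Ici m _, fun m hm => ?_⟩
    simp only [alternating_self]
    rw [one_mul, prod_halfLineCoord hm le_rfl, halfLineCoord, Nat.add_sub_cancel,
      ← halfLineGap_init m le_rfl, halfLineGap_last]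

/-! ### Nonnegative polynomials on an interval as sums of weighted squares. -/

theorem eval_nonneg_of_segment (f : ℝ[X]) {ξ z : ℝ}
    (h : ∀ t ∈ Ioc (0 : ℝ) 1, 0 ≤ f.eval (ξ + t * (z - ξ))) : 0 ≤ f.eval ξ := by
  have hc : Continuous fun t : ℝ => f.eval (ξ + t * (z - ξ)) :=
    f.continuous.comp (by fun_prop)
  have hlim : Tendsto (fun t : ℝ => f.eval (ξ + t * (z - ξ))) (nhdsWithin 0 (Ioi 0))
      (nhds (f.eval ξ)) := by
    simpa using (hc.tendsto 0).mono_left nhdsWithin_le_nhds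
  refine ge_of_tendsto hlim ?_
  filter_upwards [Ioc_mem_nhdsGT (zero_lt_one' ℝ)] with t ht
  exact h t ht

theorem segment_mem_of_ordConnected {E : Set ℝ} (hE : E.OrdConnected) {ξ z : ℝ} (hξ : ξ ∈ E)
    (hz : z ∈ E) {t : ℝ} (ht : t ∈ Ioc (0 : ℝ) 1) : ξ + t * (z - ξ) ∈ E := by
  refine hE.uIcc_subset hξ hz ?_
  rw [mem_uIcc]
  obtain ⟨h0, h1⟩ := ht
  rcases le_total ξ z with h | h
  · left; constructor <;> nlinarith
  · right; constructor <;> nlinarith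

/-- Nonnegativity on an interval extends to a punctured point. -/
theorem eval_nonneg_of_ne {E : Set ℝ} (hE : E.OrdConnected) (hinf : E.Infinite) (f : ℝ[X]) {ξ : ℝ}
    (h : ∀ x ∈ E, x ≠ ξ → 0 ≤ f.eval x) : ∀ x ∈ E, 0 ≤ f.eval x := by
  intro x hx
  by_cases hxξ : x = ξ
  · subst hxξ
    obtain ⟨z, hz, hzx⟩ := hinf.exists_notMem_finite (finite_singleton x)
    refine eval_nonneg_of_segment f (z := z) fun t ht =>
      h _ (segment_mem_of_ordConnected hE hx hz ht) ?_
    intro heq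
    have : t * (z - x) = 0 := by linarith
    rcases mul_eq_zero.1 this with h0 | h0
    · exact ht.1.ne' h0
    · exact hzx (by simpa using sub_eq_zero.1 h0)
  · exact h x hx hxξ

/-- Polynomials that are nonnegative on an interval `E` are products of positive constants and of
elementary factors that are nonnegative on `E`. -/
theorem nonneg_polynomial_induction {E : Set ℝ} (hE : E.OrdConnected) (hinf : E.Infinite)
    {p : ℝ[X] → Prop} (const : ∀ c > 0, p (C c))
    (real : ∀ ξ q, q ≠ 0 → p q → p ((X - C ξ) ^ 2 * q))
    (complex : ∀ u v q, v ≠ 0 → q ≠ 0 → p q → p (((X - C u) ^ 2 + C (v ^ 2)) * q))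
    (left : ∀ ξ q, (∀ x ∈ E, ξ ≤ x) → q ≠ 0 → p q → p ((X - C ξ) * q))
    (right : ∀ ξ q, (∀ x ∈ E, x ≤ ξ) → q ≠ 0 → p q → p ((C ξ - X) * q)) :
    ∀ q : ℝ[X], q ≠ 0 → (∀ x ∈ E, 0 ≤ q.eval x) → p q := by
  intro q
  induction hn : q.natDegree using Nat.strong_induction_on generalizing q with
  | _ n ih =>
  intro hq0 hqE
  rcases Nat.eq_zero_or_pos n with rfl | hpos
  · obtain ⟨x, hx⟩ := hinf.nonempty
    have h1 := hqE x hx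
    rw [eq_C_of_natDegree_eq_zero hn] at h1 hq0 ⊢
    rw [eval_C] at h1
    exact const _ (lt_of_le_of_ne h1 fun h => hq0 (by rw [← h, C_0]))
  obtain ⟨z, hz⟩ := IsAlgClosed.exists_aeval_eq_zero ℂ q
    (by rw [ne_eq, ← ne_eq]; exact (natDegree_pos_iff_degree_pos.1 (hn ▸ hpos)).ne')
  by_cases hzim : z.im = 0
  · have hroot : q.IsRoot z.re := by
      have hzr : z = ((z.re : ℝ) : ℂ) := Complex.ext rfl (by simp [hzim])
      rw [hzr] at hz
      have : aeval (algebraMap ℝ ℂ z.re) q = 0 := hz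
      rw [aeval_algebraMap_apply] at this
      simpa using this
    set ξ := z.re
    obtain ⟨r, hr⟩ := dvd_iff_isRoot.2 hroot
    have hr0 : r ≠ 0 := by rintro rfl; simp at hr; exact hq0 hr
    have hrdeg : r.natDegree + 1 = n := by
      rw [← hn, hr, natDegree_mul (X_sub_C_ne_zero ξ) hr0, natDegree_X_sub_C, add_comm]
    have hev : ∀ x, q.eval x = (x - ξ) * r.eval x := fun x => by rw [hr]; simp
    by_cases hl : ∀ x ∈ E, ξ ≤ x
    · rw [hr]
      refine left ξ r hl hr0 (ih _ (by omega) r rfl hr0 (eval_nonneg_of_ne hE hinf r (ξ := ξ) ?_))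
      intro x hx hne
      have h1 := hqE x hx
      rw [hev] at h1
      exact nonneg_of_mul_nonneg_right h1 (sub_pos.2 (lt_of_le_of_ne (hl x hx) (Ne.symm hne)))
    by_cases hu : ∀ x ∈ E, x ≤ ξ
    · rw [hr, show (X - C ξ) * r = (C ξ - X) * (-r) by ring]
      refine right ξ (-r) hu (neg_ne_zero.2 hr0) (ih _ (by omega) (-r) (natDegree_neg r)
        (neg_ne_zero.2 hr0) (eval_nonneg_of_ne hE hinf (-r) (ξ := ξ) ?_))
      intro x hx hne
      have h1 := hqE x hx
      rw [hev, ← neg_mul_neg] at h1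
      rw [eval_neg]
      exact nonneg_of_mul_nonneg_right h1 (by
        have := lt_of_le_of_ne (hu x hx) hne
        linarith)
    -- The root lies strictly between points of `E`. The quotient `r` is nonnegative to its right
    -- and nonpositive to its left, so it vanishes at `ξ` and the root is at least double.
    push Not at hl hu
    obtain ⟨x₁, hx₁, hx₁ξ⟩ := hl
    obtain ⟨x₂, hx₂, hx₂ξ⟩ := hu
    have hξE : ξ ∈ E := hE.out hx₁ hx₂ ⟨hx₁ξ.le, hx₂ξ.le⟩
    have hr1 : 0 ≤ r.eval ξ := by
      refine eval_nonneg_of_segment r (z := x₂) fun t ht => ?_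
      have h1 := hqE _ (segment_mem_of_ordConnected hE hξE hx₂ ht)
      rw [hev] at h1
      refine nonneg_of_mul_nonneg_right h1 ?_
      have := mul_pos ht.1 (sub_pos.2 hx₂ξ)
      linarith
    have hr2 : 0 ≤ (-r).eval ξ := by
      refine eval_nonneg_of_segment (-r) (z := x₁) fun t ht => ?_
      have h1 := hqE _ (segment_mem_of_ordConnected hE hξE hx₁ ht)
      rw [hev, ← neg_mul_neg] at h1
      rw [eval_neg]
      refine nonneg_of_mul_nonneg_right h1 ?_
      have := mul_pos ht.1 (sub_pos.2 hx₁ξ)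
      linarith
    rw [eval_neg] at hr2
    have hrroot : r.IsRoot ξ := le_antisymm (by linarith) hr1
    obtain ⟨r', hr'⟩ := dvd_iff_isRoot.2 hrroot
    have hr'0 : r' ≠ 0 := by rintro rfl; simp at hr'; exact hr0 hr'
    have hr'deg : r'.natDegree + 1 = r.natDegree := by
      rw [hr', natDegree_mul (X_sub_C_ne_zero ξ) hr'0, natDegree_X_sub_C, add_comm]
    have hq' : q = (X - C ξ) ^ 2 * r' := by rw [hr, hr']; ring
    rw [hq']
    refine real ξ r' hr'0 (ih _ (by omega) r' rfl hr'0 (eval_nonneg_of_ne hE hinf r' (ξ := ξ) ?_))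
    intro x hx hne
    have h1 := hqE x hx
    rw [hq', eval_mul] at h1
    refine nonneg_of_mul_nonneg_right h1 ?_
    have := sub_ne_zero.2 hne
    simp only [eval_pow, eval_sub, eval_X, eval_C]
    positivity
  · obtain ⟨r, hr⟩ := quadratic_dvd_of_aeval_eq_zero_im_ne_zero q hz hzim
    -- A nonreal root brings its conjugate; the resulting quadratic is a sum of two squares and
    -- positive everywhere.
    have hfac : (X ^ 2 - C (2 * z.re) * X + C (‖z‖ ^ 2) : ℝ[X]) =
        (X - C z.re) ^ 2 + C (z.im ^ 2) := by
      rw [Complex.sq_norm, Complex.normSq_apply]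
      simp only [C_add, C_mul, C_pow, map_ofNat]
      ring
    rw [hfac] at hr
    have hr0 : r ≠ 0 := by rintro rfl; simp at hr; exact hq0 hr
    have hmonic : ((X - C z.re) ^ 2 + C (z.im ^ 2) : ℝ[X]).natDegree = 2 := by
      rw [natDegree_add_C, natDegree_pow, natDegree_X_sub_C]
    have hfac0 : ((X - C z.re) ^ 2 + C (z.im ^ 2) : ℝ[X]) ≠ 0 := by
      intro h; rw [h] at hmonic; simp at hmonic
    have hrdeg : r.natDegree + 2 = n := by
      rw [← hn, hr, natDegree_mul hfac0 hr0, hmonic, add_comm]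
    rw [hr]
    refine complex _ _ r hzim hr0 (ih _ (by omega) r rfl hr0 fun x hx => ?_)
    have h1 := hqE x hx
    rw [hr, eval_mul] at h1
    refine nonneg_of_mul_nonneg_right h1 ?_
    simp only [eval_add, eval_pow, eval_sub, eval_X, eval_C]
    positivity

/-- The cone of sums of terms `w g²`, `w ∈ 𝒲`, of degree at most `n`. -/
noncomputable def weightedSquares (𝒲 : Set ℝ[X]) (n : ℕ) : AddSubmonoid ℝ[X] :=
  AddSubmonoid.closure {p | ∃ w ∈ 𝒲, ∃ g : ℝ[X], p = w * g ^ 2 ∧ p.natDegree ≤ n}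

theorem mem_weightedSquares {𝒲 : Set ℝ[X]} {n : ℕ} {p w g : ℝ[X]} (hw : w ∈ 𝒲)
    (hp : p = w * g ^ 2) (hn : p.natDegree ≤ n) : p ∈ weightedSquares 𝒲 n :=
  AddSubmonoid.subset_closure ⟨w, hw, g, hp, hn⟩

theorem mul_mem_weightedSquares {𝒲 : Set ℝ[X]} {n n' : ℕ} {f : ℝ[X]}
    (hf : ∀ w ∈ 𝒲, ∀ g : ℝ[X], (w * g ^ 2).natDegree ≤ n → f * (w * g ^ 2) ∈ weightedSquares 𝒲 n')
    {q : ℝ[X]} (hq : q ∈ weightedSquares 𝒲 n) : f * q ∈ weightedSquares 𝒲 n' := by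
  induction hq using AddSubmonoid.closure_induction with
  | mem x hx =>
    obtain ⟨w, hw, g, rfl, hn⟩ := hx
    exact hf w hw g hn
  | zero => rw [mul_zero]; exact zero_mem _
  | add x y _ _ hx hy => rw [mul_add]; exact add_mem hx hy

theorem C_mul_mem_weightedSquares {𝒲 : Set ℝ[X]} {n n' : ℕ} (hn : n ≤ n') {c : ℝ} (hc : 0 ≤ c)
    {q : ℝ[X]} (hq : q ∈ weightedSquares 𝒲 n) : C c * q ∈ weightedSquares 𝒲 n' := by
  refine mul_mem_weightedSquares (fun w hw g hg => ?_) hq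
  refine mem_weightedSquares (g := C (Real.sqrt c) * g) hw ?_ ?_
  · rw [mul_pow, ← C_pow, Real.sq_sqrt hc]; ring
  · exact ((natDegree_C_mul_le _ _).trans hg).trans hn

theorem sq_mul_mem_weightedSquares {𝒲 : Set ℝ[X]} {n n' : ℕ} {f : ℝ[X]}
    (hn : 2 * f.natDegree + n ≤ n') {q : ℝ[X]} (hq : q ∈ weightedSquares 𝒲 n) :
    f ^ 2 * q ∈ weightedSquares 𝒲 n' := by
  refine mul_mem_weightedSquares (fun w hw g hg => ?_) hq
  refine mem_weightedSquares (g := f * g) hw (by ring) ?_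
  exact natDegree_mul_le.trans ((add_le_add natDegree_pow_le hg).trans hn)

/-- No term exceeds the degree of `q`. This control is essential, since only finitely many moments
are prescribed and the functional must be evaluated termwise. -/
theorem mem_weightedSquares_of_nonneg {E : Set ℝ} (hE : E.OrdConnected) (hinf : E.Infinite)
    {𝒲 : Set ℝ[X]} (h1 : 1 ∈ 𝒲)
    (left : ∀ ξ, (∀ x ∈ E, ξ ≤ x) → ∀ n, ∀ q ∈ weightedSquares 𝒲 n,
      (X - C ξ) * q ∈ weightedSquares 𝒲 (n + 1))
    (right : ∀ ξ, (∀ x ∈ E, x ≤ ξ) → ∀ n, ∀ q ∈ weightedSquares 𝒲 n,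
      (C ξ - X) * q ∈ weightedSquares 𝒲 (n + 1)) {q : ℝ[X]} (hq : q ≠ 0)
    (hqE : ∀ x ∈ E, 0 ≤ q.eval x) : q ∈ weightedSquares 𝒲 q.natDegree := by
  refine nonneg_polynomial_induction hE hinf
    (p := fun q => q ∈ weightedSquares 𝒲 q.natDegree) ?_ ?_ ?_ ?_ ?_ q hq hqE
  · intro c hc
    have := C_mul_mem_weightedSquares (𝒲 := 𝒲) (n := 0) le_rfl hc.le
      (mem_weightedSquares (g := 1) h1 (by ring) (natDegree_one).le)
    simpa using this
  · intro ξ q hq0 hq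
    refine sq_mul_mem_weightedSquares ?_ hq
    rw [natDegree_mul (pow_ne_zero _ (X_sub_C_ne_zero ξ)) hq0, natDegree_pow, natDegree_X_sub_C]
  · intro u v q hv hq0 hq
    have hmonic : ((X - C u) ^ 2 + C (v ^ 2) : ℝ[X]).natDegree = 2 := by
      rw [natDegree_add_C, natDegree_pow, natDegree_X_sub_C]
    have hfac0 : ((X - C u) ^ 2 + C (v ^ 2) : ℝ[X]) ≠ 0 := by
      intro h; rw [h] at hmonic; simp at hmonic
    rw [natDegree_mul hfac0 hq0, hmonic, add_mul]
    exact add_mem (sq_mul_mem_weightedSquares (by rw [natDegree_X_sub_C]) hq)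
      (C_mul_mem_weightedSquares (by omega) (sq_nonneg v) hq)
  · intro ξ q hξ hq0 hq
    rw [natDegree_mul (X_sub_C_ne_zero ξ) hq0, natDegree_X_sub_C, add_comm]
    exact left ξ hξ _ q hq
  · intro ξ q hξ hq0 hq
    have h2 : (C ξ - X : ℝ[X]) = -(X - C ξ) := by ring
    have h3 : (C ξ - X : ℝ[X]) ≠ 0 := by rw [h2]; exact neg_ne_zero.2 (X_sub_C_ne_zero ξ)
    rw [natDegree_mul h3 hq0, h2, natDegree_neg, natDegree_X_sub_C, add_comm, ← h2]
    exact right ξ hξ _ q hq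

theorem isMomentPositive_of_weightedSquares {E : Set ℝ} {𝒲 : Set ℝ[X]} {s : ℕ → ℝ} {n : ℕ}
    (hmem : ∀ q : ℝ[X], q ≠ 0 → (∀ x ∈ E, 0 ≤ q.eval x) → q ∈ weightedSquares 𝒲 q.natDegree)
    (hpos : ∀ w ∈ 𝒲, ∀ g : ℝ[X], w * g ^ 2 ≠ 0 → (w * g ^ 2).natDegree ≤ n →
      0 < momentFunctional s (w * g ^ 2)) : IsMomentPositive E s n := by
  intro q hq0 hqn hqE
  -- The alternative "zero or of positive mean" is stable under sums, and `q` itself is nonzero.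
  have key : ∀ p ∈ weightedSquares 𝒲 q.natDegree, p = 0 ∨ 0 < momentFunctional s p := by
    intro p hp
    induction hp using AddSubmonoid.closure_induction with
    | mem x hx =>
      obtain ⟨w, hw, g, rfl, hn⟩ := hx
      by_cases h0 : w * g ^ 2 = 0
      · exact Or.inl h0
      · exact Or.inr (hpos w hw g h0 (hn.trans hqn))
    | zero => exact Or.inl rfl
    | add x y _ _ hx hy =>
      rw [momentFunctional_add]
      rcases hx with rfl | hx
      · rcases hy with rfl | hy
        · simp
        · simpa [momentFunctional] using Or.inr hy
      · rcases hy with rfl | hy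
        · simpa [momentFunctional] using Or.inr hx
        · exact Or.inr (add_pos hx hy)
  exact (key q (hmem q hq0 hqE)).resolve_left hq0

theorem mem_weightedSquares_of_nonneg_univ {q : ℝ[X]} (hq : q ≠ 0)
    (hqE : ∀ x ∈ (univ : Set ℝ), 0 ≤ q.eval x) : q ∈ weightedSquares {1} q.natDegree := by
  refine mem_weightedSquares_of_nonneg ordConnected_univ infinite_univ (mem_singleton _) ?_ ?_ hq hqE
  · intro ξ hξ
    have := hξ (ξ - 1) trivial
    linarith
  · intro ξ hξ
    have := hξ (ξ + 1) trivial
    linarith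

/-- The weights `1`, `x - a`, `b - x` and `(x - a) (b - x)`. -/
noncomputable def intervalWeights (a b : ℝ) : Set ℝ[X] :=
  {1, X - C a, C b - X, (X - C a) * (C b - X)}

theorem mem_intervalWeights_iff {a b : ℝ} {w : ℝ[X]} : w ∈ intervalWeights a b ↔
    w = 1 ∨ w = X - C a ∨ w = C b - X ∨ w = (X - C a) * (C b - X) := by
  simp only [intervalWeights, mem_insert_iff, mem_singleton_iff]

theorem natDegree_C_sub_X (b : ℝ) : (C b - X : ℝ[X]).natDegree = 1 := by
  rw [← neg_sub X (C b), natDegree_neg]; exact natDegree_X_sub_C b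

/-- Multiplying a weight by `f` either gives another weight or, if `f` already divides it, a square
of `f` that is absorbed in `g`. -/
theorem mul_mem_weightedSquares_of_natDegree_le_one {𝒲 : Set ℝ[X]} {n : ℕ} {f : ℝ[X]}
    (hf : f.natDegree ≤ 1)
    (h : ∀ w ∈ 𝒲, (f * w ∈ 𝒲) ∨ ∃ w' ∈ 𝒲, w = f * w') {q : ℝ[X]}
    (hq : q ∈ weightedSquares 𝒲 n) : f * q ∈ weightedSquares 𝒲 (n + 1) := by
  refine mul_mem_weightedSquares (fun w hw g hg => ?_) hq
  have hdeg : (f * (w * g ^ 2)).natDegree ≤ n + 1 :=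
    natDegree_mul_le.trans ((add_le_add hf hg).trans (add_comm _ _).le)
  rcases h w hw with hw' | ⟨w', hw', rfl⟩
  · exact mem_weightedSquares hw' (mul_assoc _ _ _).symm hdeg
  · exact mem_weightedSquares hw' (g := f * g) (by ring) hdeg

theorem mem_weightedSquares_of_nonneg_Icc {a b : ℝ} (hab : a < b) {q : ℝ[X]} (hq : q ≠ 0)
    (hqE : ∀ x ∈ Icc a b, 0 ≤ q.eval x) :
    q ∈ weightedSquares (intervalWeights a b) q.natDegree := by
  have m1 : (1 : ℝ[X]) ∈ intervalWeights a b := mem_intervalWeights_iff.2 (Or.inl rfl)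
  have m2 : X - C a ∈ intervalWeights a b := mem_intervalWeights_iff.2 (Or.inr (Or.inl rfl))
  have m3 : C b - X ∈ intervalWeights a b :=
    mem_intervalWeights_iff.2 (Or.inr (Or.inr (Or.inl rfl)))
  have m4 : (X - C a) * (C b - X) ∈ intervalWeights a b :=
    mem_intervalWeights_iff.2 (Or.inr (Or.inr (Or.inr rfl)))
  refine mem_weightedSquares_of_nonneg ordConnected_Icc (Icc_infinite hab) m1 ?_ ?_ hq hqE
  · intro ξ hξ n q hq
    have h := hξ a (left_mem_Icc.2 hab.le)
    -- A root to the left of the interval is moved to the end point at the cost of a nonnegative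
    -- constant.
    have e : (X - C ξ) * q = (X - C a) * q + C (a - ξ) * q := by rw [C_sub]; ring
    rw [e]
    refine add_mem (mul_mem_weightedSquares_of_natDegree_le_one (natDegree_X_sub_C a).le
      (fun w hw => ?_) hq) (C_mul_mem_weightedSquares n.le_succ (sub_nonneg.2 h) hq)
    rcases mem_intervalWeights_iff.1 hw with rfl | rfl | rfl | rfl
    · exact Or.inl (by rwa [mul_one])
    · exact Or.inr ⟨1, m1, (mul_one _).symm⟩
    · exact Or.inl m4
    · exact Or.inr ⟨_, m3, rfl⟩
  · intro ξ hξ n q hq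
    have h := hξ b (right_mem_Icc.2 hab.le)
    have e : (C ξ - X) * q = (C b - X) * q + C (ξ - b) * q := by rw [C_sub]; ring
    rw [e]
    refine add_mem (mul_mem_weightedSquares_of_natDegree_le_one (natDegree_C_sub_X b).le
      (fun w hw => ?_) hq) (C_mul_mem_weightedSquares n.le_succ (sub_nonneg.2 h) hq)
    rcases mem_intervalWeights_iff.1 hw with rfl | rfl | rfl | rfl
    · exact Or.inl (by rwa [mul_one])
    · exact Or.inl (by rwa [mul_comm])
    · exact Or.inr ⟨1, m1, (mul_one _).symm⟩
    · exact Or.inr ⟨_, m2, mul_comm _ _⟩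

/-! ### The compact interval: extremal polynomials and the length of the moment sections. -/

section Algebra

variable {L : ℝ[X] →ₗ[ℝ] ℝ}

/-- Up to its leading part, `q` is orthogonal to `H`: subtracting `q.coeff d` times the monic `H`
leaves a polynomial of smaller degree. -/
theorem eq_coeff_mul_of_orthogonal {w H q : ℝ[X]} (hH : H.Monic)
    (orth : ∀ r : ℝ[X], r.degree < H.degree → L (w * H * r) = 0) {d : ℕ} (hd : H.natDegree = d)
    (hq : q.natDegree ≤ d) : L (w * H * q) = q.coeff d * L (w * H ^ 2) := by
  have hlt : (q - C (q.coeff d) * H).degree < H.degree := by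
    rw [degree_eq_natDegree hH.ne_zero, hd, degree_lt_iff_coeff_zero]
    intro i hi
    rcases hi.lt_or_eq with h | rfl
    · rw [coeff_sub, coeff_C_mul, coeff_eq_zero_of_natDegree_lt (by omega),
        coeff_eq_zero_of_natDegree_lt (p := H) (by omega)]
      simp
    · have : H.coeff d = 1 := by rw [← hd]; exact hH
      rw [coeff_sub, coeff_C_mul, this, mul_one, sub_self]
  have h1 := orth _ hlt
  have h2 : w * H * q = w * H * (q - C (q.coeff d) * H) + q.coeff d • (w * H ^ 2) := by
    rw [smul_eq_C_mul]; ring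
  rw [h2, map_add, h1, zero_add, map_smul, smul_eq_mul]

theorem natDegree_X_sub_C_mul {H : ℝ[X]} (hH : H.Monic) (a : ℝ) :
    ((X - C a) * H).natDegree = H.natDegree + 1 := by
  rw [(monic_X_sub_C a).natDegree_mul hH, natDegree_X_sub_C, add_comm]

theorem natDegree_C_sub_X_mul {H : ℝ[X]} (hH : H.Monic) (b : ℝ) :
    ((C b - X) * H).natDegree = H.natDegree + 1 := by
  rw [← neg_sub X (C b), neg_mul, natDegree_neg, natDegree_X_sub_C_mul hH]

theorem coeff_C_sub_X_mul {H : ℝ[X]} (b : ℝ) (i : ℕ) :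
    ((C b - X) * H).coeff (i + 1) = b * H.coeff (i + 1) - H.coeff i := by
  rw [sub_mul, coeff_sub, coeff_X_mul, coeff_C_mul]

theorem natDegree_le_of_coeff_eq_zero {p : ℝ[X]} {n : ℕ} (h : p.natDegree ≤ n + 1)
    (h0 : p.coeff (n + 1) = 0) : p.natDegree ≤ n := by
  rw [natDegree_le_iff_coeff_eq_zero] at h ⊢
  intro i hi
  rcases Nat.lt_or_ge (n + 1) i with h1 | h1
  · exact h i h1
  · rwa [show i = n + 1 by omega]

/-- The relation between the extremal polynomials of two consecutive levels, the first of which is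
even. -/
theorem extremal_relation_even {a b : ℝ} {P S A B : ℝ[X]} {d : ℕ} (hP : P.Monic) (hS : S.Monic)
    (hA : A.Monic) (hB : B.Monic) (dP : P.natDegree = d + 1) (dS : S.natDegree = d)
    (dA : A.natDegree = d + 1) (dB : B.natDegree = d + 1)
    (oP : ∀ q : ℝ[X], q.degree < P.degree → L (1 * P * q) = 0)
    (oS : ∀ q : ℝ[X], q.degree < S.degree → L ((X - C a) * (C b - X) * S * q) = 0)
    (oA : ∀ q : ℝ[X], q.degree < A.degree → L ((X - C a) * A * q) = 0)
    (oB : ∀ q : ℝ[X], q.degree < B.degree → L ((C b - X) * B * q) = 0) :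
    (L ((C b - X) * B ^ 2) + L ((X - C a) * A ^ 2)) *
        (L (1 * P ^ 2) + L ((X - C a) * (C b - X) * S ^ 2)) =
      (b - a) * L (1 * P ^ 2) * L ((X - C a) * (C b - X) * S ^ 2) := by
  have cP : P.coeff (d + 1) = 1 := by rw [← dP]; exact hP
  have cS : S.coeff d = 1 := by rw [← dS]; exact hS
  have cA : A.coeff (d + 1) = 1 := by rw [← dA]; exact hA
  have cB : B.coeff (d + 1) = 1 := by rw [← dB]; exact hB
  have cS' : S.coeff (d + 1) = 0 := coeff_eq_zero_of_natDegree_lt (by omega)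
  have cA' : A.coeff (d + 1 + 1) = 0 := coeff_eq_zero_of_natDegree_lt (by omega)
  have cB' : B.coeff (d + 1 + 1) = 0 := coeff_eq_zero_of_natDegree_lt (by omega)
  -- The top coefficients cancel, so `T` has degree at most that of `P` and can be tested against
  -- `P`.
  set T := (X - C a) * A + (C b - X) * B with hT
  have dT : T.natDegree ≤ d + 1 := by
    refine natDegree_le_of_coeff_eq_zero ?_ ?_
    · refine natDegree_add_le_of_degree_le ?_ ?_
      · rw [natDegree_X_sub_C_mul hA, dA]
      · rw [natDegree_C_sub_X_mul hB, dB]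
    · rw [hT, coeff_add, coeff_X_sub_C_mul, coeff_C_sub_X_mul, cA, cB, cA', cB']
      ring
  have dAB : (A - B).natDegree ≤ d := by
    refine natDegree_le_of_coeff_eq_zero ((natDegree_sub_le_of_le dA.le dB.le).trans (max_self _).le) ?_
    rw [coeff_sub, cA, cB, sub_self]
  have fA := eq_coeff_mul_of_orthogonal hA oA dA dP.le
  have fB := eq_coeff_mul_of_orthogonal hB oB dB dP.le
  have fT := eq_coeff_mul_of_orthogonal hP oP dP dT
  have dXS : ((X - C a) * S).natDegree = d + 1 := by rw [natDegree_X_sub_C_mul hS, dS]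
  have cXS : ((X - C a) * S).coeff (d + 1) = 1 := by rw [coeff_X_sub_C_mul, cS, cS']; ring
  have gA := eq_coeff_mul_of_orthogonal hA oA dA dXS.le
  have gB := eq_coeff_mul_of_orthogonal hB oB dB dXS.le
  have eS := eq_coeff_mul_of_orthogonal hS oS dS dAB
  have hAS : L ((X - C a) * A * S) = 0 :=
    oA S (by
      rw [degree_eq_natDegree hS.ne_zero, degree_eq_natDegree hA.ne_zero, dS, dA]
      exact_mod_cast d.lt_succ_self)
  have e1 : (C b - X) * (A - B) = (b - a) • A - T := by
    rw [smul_eq_C_mul, hT, C_sub]; ring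
  have cAB : (A - B).coeff d = T.coeff (d + 1) - (b - a) := by
    have h1 := congrArg (fun p => coeff p (d + 1)) e1
    simp only [coeff_C_sub_X_mul, coeff_sub, coeff_smul, smul_eq_mul] at h1
    rw [cA, cB] at h1
    rw [coeff_sub]
    linarith
  rw [cP, one_mul] at fA fB
  rw [cXS, one_mul] at gA gB
  rw [cAB] at eS
  have e2 : 1 * P * T = (X - C a) * A * P + (C b - X) * B * P := by rw [hT]; ring
  have e3 : (X - C a) * (C b - X) * S * (A - B) = (b - a) • ((X - C a) * A * S) -
      ((X - C a) * A * ((X - C a) * S) + (C b - X) * B * ((X - C a) * S)) := by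
    have : (X - C a) * (C b - X) * S * (A - B) = (X - C a) * S * ((C b - X) * (A - B)) := by ring
    rw [this, e1, smul_eq_C_mul, smul_eq_C_mul, hT]; ring
  rw [e2, map_add, fA, fB] at fT
  rw [e3, map_sub, map_smul, hAS, smul_zero, map_add, gA, gB] at eS
  generalize L ((C b - X) * B ^ 2) = g at *
  generalize L ((X - C a) * A ^ 2) = f at *
  generalize L (1 * P ^ 2) = h at *
  generalize L ((X - C a) * (C b - X) * S ^ 2) = e at *
  -- With `τ` the coefficient of order `d + 1` of `T`, testing `T` against `P` gives `f + g = τ h`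
  -- and testing `A - B` against `S` gives `f + g = (b - a - τ) e`. Eliminating `τ` gives the claim.
  linear_combination (h + e) * fT - h * (fT + eS)

/-- The relation between the extremal polynomials of two consecutive levels, the first of which is
odd. -/
theorem extremal_relation_odd {a b : ℝ} {P S A B : ℝ[X]} {d : ℕ} (hP : P.Monic) (hS : S.Monic)
    (hA : A.Monic) (hB : B.Monic) (dP : P.natDegree = d + 1) (dS : S.natDegree = d)
    (dA : A.natDegree = d) (dB : B.natDegree = d)
    (oP : ∀ q : ℝ[X], q.degree < P.degree → L (1 * P * q) = 0)
    (oS : ∀ q : ℝ[X], q.degree < S.degree → L ((X - C a) * (C b - X) * S * q) = 0)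
    (oA : ∀ q : ℝ[X], q.degree < A.degree → L ((X - C a) * A * q) = 0)
    (oB : ∀ q : ℝ[X], q.degree < B.degree → L ((C b - X) * B * q) = 0) :
    (L ((X - C a) * (C b - X) * S ^ 2) + L (1 * P ^ 2)) *
        (L ((X - C a) * A ^ 2) + L ((C b - X) * B ^ 2)) =
      (b - a) * L ((X - C a) * A ^ 2) * L ((C b - X) * B ^ 2) := by
  have cP : P.coeff (d + 1) = 1 := by rw [← dP]; exact hP
  have cS : S.coeff d = 1 := by rw [← dS]; exact hS
  have cA : A.coeff d = 1 := by rw [← dA]; exact hA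
  have cB : B.coeff d = 1 := by rw [← dB]; exact hB
  have cS' : S.coeff (d + 1) = 0 := coeff_eq_zero_of_natDegree_lt (by omega)
  have cA' : A.coeff (d + 1) = 0 := coeff_eq_zero_of_natDegree_lt (by omega)
  have cB' : B.coeff (d + 1) = 0 := coeff_eq_zero_of_natDegree_lt (by omega)
  -- Leading terms cancel in `U` and in `U'`, and the two add up to `(b - a) S`.
  set U := P + (C b - X) * S with hU
  set U' := (X - C a) * S - P with hU'
  have dU : U.natDegree ≤ d := by
    refine natDegree_le_of_coeff_eq_zero (natDegree_add_le_of_degree_le dP.le ?_) ?_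
    · rw [natDegree_C_sub_X_mul hS, dS]
    · rw [hU, coeff_add, coeff_C_sub_X_mul, cP, cS, cS']; ring
  have dU' : U'.natDegree ≤ d := by
    refine natDegree_le_of_coeff_eq_zero ((natDegree_sub_le_of_le (m := d + 1) ?_ dP.le).trans (max_self _).le) ?_
    · rw [natDegree_X_sub_C_mul hS, dS]
    · rw [hU', coeff_sub, coeff_X_sub_C_mul, cP, cS, cS']; ring
  have hsum : U.coeff d + U'.coeff d = b - a := by
    have : U + U' = (b - a) • S := by rw [hU, hU', smul_eq_C_mul, C_sub]; ring
    rw [← coeff_add, this, coeff_smul, cS, smul_eq_mul, mul_one]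
  have f1 := eq_coeff_mul_of_orthogonal hP oP dP (q := (X - C a) * A)
    (by rw [natDegree_X_sub_C_mul hA, dA])
  have f2 := eq_coeff_mul_of_orthogonal hS oS dS dA.le
  have f3 := eq_coeff_mul_of_orthogonal hA oA dA dU
  have g1 := eq_coeff_mul_of_orthogonal hP oP dP (q := (C b - X) * B)
    (by rw [natDegree_C_sub_X_mul hB, dB])
  have g2 := eq_coeff_mul_of_orthogonal hS oS dS dB.le
  have g3 := eq_coeff_mul_of_orthogonal hB oB dB dU'
  rw [coeff_X_sub_C_mul, cA, cA', mul_zero, sub_zero, one_mul (L _)] at f1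
  rw [cA, one_mul] at f2
  rw [coeff_C_sub_X_mul, cB, cB', mul_zero, zero_sub, neg_one_mul] at g1
  rw [cB, one_mul] at g2
  have e1 : (X - C a) * A * U =
      1 * P * ((X - C a) * A) + (X - C a) * (C b - X) * S * A := by rw [hU]; ring
  have e2 : (C b - X) * B * U' =
      (X - C a) * (C b - X) * S * B - 1 * P * ((C b - X) * B) := by rw [hU']; ring
  rw [e1, map_add, f1, f2] at f3
  rw [e2, map_sub, g1, g2] at g3
  generalize L ((C b - X) * B ^ 2) = e at *
  generalize L ((X - C a) * A ^ 2) = h at *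
  generalize L (1 * P ^ 2) = f at *
  generalize L ((X - C a) * (C b - X) * S ^ 2) = g at *
  -- Testing `U` against `A` and `U'` against `B` gives `f + g = u h = u' e` for their coefficients
  -- of order `d`, where `u + u' = b - a`.
  linear_combination h * g3 + e * f3 + h * e * hsum

end Algebra

theorem nonneg_of_mem_intervalWeights {a b : ℝ} {w : ℝ[X]} (hw : w ∈ intervalWeights a b) (g : ℝ[X]) :
    ∀ x ∈ Icc a b, 0 ≤ (w * g ^ 2).eval x := by
  intro x hx
  have h1 := sub_nonneg.2 hx.1
  have h2 := sub_nonneg.2 hx.2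
  rcases mem_intervalWeights_iff.1 hw with rfl | rfl | rfl | rfl <;>
    simp only [eval_mul, eval_pow, eval_sub, eval_X, eval_C, eval_one] <;> positivity

theorem intervalWeights_cases {a b : ℝ} {w : ℝ[X]} (hw : w ∈ intervalWeights a b) :
    (w = 1 ∧ w.natDegree = 0 ∧ w.leadingCoeff = 1) ∨
    (w = X - C a ∧ w.natDegree = 1 ∧ w.leadingCoeff = 1) ∨
    (w = C b - X ∧ w.natDegree = 1 ∧ w.leadingCoeff = -1) ∨
    (w = (X - C a) * (C b - X) ∧ w.natDegree = 2 ∧ w.leadingCoeff = -1) := by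
  have hb : (C b - X : ℝ[X]).leadingCoeff = -1 := by
    rw [← neg_sub X (C b), leadingCoeff_neg, leadingCoeff_X_sub_C]
  have hb0 : (C b - X : ℝ[X]) ≠ 0 := by
    intro h; rw [h] at hb; simp at hb
  rcases mem_intervalWeights_iff.1 hw with rfl | rfl | rfl | rfl
  · exact Or.inl ⟨rfl, natDegree_one, leadingCoeff_one⟩
  · exact Or.inr (Or.inl ⟨rfl, natDegree_X_sub_C a, leadingCoeff_X_sub_C a⟩)
  · exact Or.inr (Or.inr (Or.inl ⟨rfl, natDegree_C_sub_X b, hb⟩))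
  · refine Or.inr (Or.inr (Or.inr ⟨rfl, ?_, ?_⟩))
    · rw [natDegree_mul (X_sub_C_ne_zero a) hb0, natDegree_X_sub_C, natDegree_C_sub_X]
    · rw [leadingCoeff_mul, leadingCoeff_X_sub_C, hb, one_mul]

/-- At an end point of a moment section there is an extremal polynomial. -/
theorem exists_extremal_polynomial {a b : ℝ} (hab : a < b) {n : ℕ} {m : Fin n → ℝ}
    (hm : m ∈ interior (momentSpace (Icc a b) n)) {t₀ σ : ℝ} (hσ : σ = 1 ∨ σ = -1)
    (hcl : t₀ ∈ closure (momentSection (Icc a b) m (n + 1)))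
    (hside : ∀ t ∈ momentSection (Icc a b) m (n + 1), 0 ≤ σ * (t - t₀)) :
    ∃ w ∈ intervalWeights a b, ∃ H : ℝ[X], H.Monic ∧ w.natDegree + 2 * H.natDegree = n + 1 ∧
      w.leadingCoeff = σ ∧
      (∀ q : ℝ[X], q.degree < H.degree → momentFunctional (momentAt m) (w * H * q) = 0) ∧
      momentFunctional (momentAt m) (w * H ^ 2) + σ * t₀ = 0 := by
  set S := momentSection (Icc a b) m (n + 1) with hS
  have hinf := Icc_infinite hab
  have hposm := (mem_interior_momentSpace_iff measurableSet_Icc hinf).1 hm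
  have hclosure : ∀ A c : ℝ, (∀ t ∈ S, 0 ≤ A + c * t) → 0 ≤ A + c * t₀ := fun A c h =>
    closure_minimal (s := S) (t := {t | 0 ≤ A + c * t}) h
      (isClosed_le continuous_const (by fun_prop)) hcl
  have hnot : t₀ ∉ interior S := by
    intro hint
    obtain ⟨δ, hδ, hball⟩ := Metric.isOpen_iff.1 isOpen_interior _ hint
    have h1 := hside (t₀ - σ * (δ / 2)) (interior_subset (hball (by
      rcases hσ with rfl | rfl <;> simp [abs_of_pos hδ, hδ])))
    rcases hσ with rfl | rfl <;> linarith
  have hinit : Fin.init (Fin.snoc (α := fun _ => ℝ) m t₀ : Fin (n + 1) → ℝ) = m := Fin.init_snoc ..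
  have hlast : (Fin.snoc (α := fun _ => ℝ) m t₀ : Fin (n + 1) → ℝ) (Fin.last n) = t₀ :=
    Fin.snoc_last ..
  -- An end point of the section is not interior, so strict positivity fails there; by the
  -- weighted-squares representation it already fails for a single term `w * g ^ 2`.
  have hnpos : ¬ IsMomentPositive (Icc a b)
      (momentAt (Fin.snoc (α := fun _ => ℝ) m t₀ : Fin (n + 1) → ℝ)) (n + 1) := by
    rw [← mem_interior_momentSpace_iff measurableSet_Icc hinf,
      mem_interior_succ_iff measurableSet_Icc hinf, hinit, hlast]
    exact fun h => hnot h.2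
  have hex : ∃ w ∈ intervalWeights a b, ∃ g : ℝ[X], w * g ^ 2 ≠ 0 ∧
      (w * g ^ 2).natDegree ≤ n + 1 ∧ momentFunctional
        (momentAt (Fin.snoc (α := fun _ => ℝ) m t₀ : Fin (n + 1) → ℝ)) (w * g ^ 2) ≤ 0 := by
    by_contra hcon
    push Not at hcon
    exact hnpos (isMomentPositive_of_weightedSquares
      (fun q hq hqE => mem_weightedSquares_of_nonneg_Icc hab hq hqE) hcon)
  obtain ⟨w, hw, g, hg0, hgn, hle⟩ := hex
  rw [momentFunctional_momentAt_succ _ hgn, hinit, hlast] at hle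
  have hgE := nonneg_of_mem_intervalWeights hw g
  have hdeg : (w * g ^ 2).natDegree = n + 1 := by
    by_contra hne
    rw [coeff_eq_zero_of_natDegree_lt (by omega), zero_mul, add_zero] at hle
    exact absurd (hposm _ hg0 (by omega) hgE) (not_lt.2 hle)
  have hw0 : w ≠ 0 := left_ne_zero_of_mul hg0
  have hgne : g ≠ 0 := by rintro rfl; simp at hg0
  have hlg : g.leadingCoeff ≠ 0 := leadingCoeff_ne_zero.2 hgne
  have hcoeff : (w * g ^ 2).coeff (n + 1) = w.leadingCoeff * g.leadingCoeff ^ 2 := by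
    rw [← hdeg, coeff_natDegree, leadingCoeff_mul, leadingCoeff_pow]
  rw [hcoeff] at hle
  have hSnn : ∀ t ∈ S, 0 ≤ momentFunctional (momentAt m) (w * g ^ 2) +
      w.leadingCoeff * g.leadingCoeff ^ 2 * t := by
    intro t ht
    rw [← hcoeff]
    exact momentFunctional_add_mul_nonneg ht hgn hgE
  have hlg2 : 0 < g.leadingCoeff ^ 2 := by positivity
  -- The mean is nonnegative over the section and nonpositive at `t₀`, so the sign of its slope
  -- tells on which side of `t₀` the section lies.
  have hlead : w.leadingCoeff = σ := by
    obtain ⟨t, ht⟩ := nonempty_interior_momentSection measurableSet_Icc hinf hm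
    have hne : t ≠ t₀ := by rintro rfl; exact hnot ht
    have h1 := hside t (interior_subset ht)
    have h2 := hSnn t (interior_subset ht)
    have h3 : 0 ≤ w.leadingCoeff * (t - t₀) := by
      refine nonneg_of_mul_nonneg_right (?_ : 0 ≤ g.leadingCoeff ^ 2 * _) hlg2
      linarith
    have hs : 0 < |t - t₀| := abs_pos.2 (sub_ne_zero.2 hne)
    have hw1 : w.leadingCoeff = 1 ∨ w.leadingCoeff = -1 := by
      rcases intervalWeights_cases hw with h | h | h | h <;> simp [h.2.2]
    rcases abs_cases (t - t₀) with ⟨h4, -⟩ | ⟨h4, -⟩ <;> rw [h4] at hs <;>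
      rcases hσ with rfl | rfl <;> rcases hw1 with h5 | h5 <;> rw [h5] at h3 ⊢ <;> linarith
  rw [hlead] at hle hSnn
  have hzero : momentFunctional (momentAt m) (w * g ^ 2) + σ * g.leadingCoeff ^ 2 * t₀ = 0 :=
    le_antisymm hle (hclosure _ _ hSnn)
  set H : ℝ[X] := C g.leadingCoeff⁻¹ * g with hHdef
  have hH : H.Monic := by
    rw [hHdef, mul_comm]; exact monic_mul_leadingCoeff_inv hgne
  have hdH : H.natDegree = g.natDegree := natDegree_C_mul (inv_ne_zero hlg)
  have hdegs : w.natDegree + 2 * H.natDegree = n + 1 := by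
    rw [← hdeg, natDegree_mul hw0 (pow_ne_zero _ hgne), natDegree_pow, hdH]
  have hHg : w * H ^ 2 = (g.leadingCoeff ^ 2)⁻¹ • (w * g ^ 2) := by
    rw [smul_eq_C_mul, hHdef, ← inv_pow, C_pow]; ring
  have hHzero : momentFunctional (momentAt m) (w * H ^ 2) + σ * t₀ = 0 := by
    rw [hHg, momentFunctional_smul]
    have : momentFunctional (momentAt m) (w * g ^ 2) = -(σ * g.leadingCoeff ^ 2 * t₀) := by linarith
    rw [this]
    field_simp
    ring
  refine ⟨w, hw, H, hH, hdegs, hlead, fun q hq => ?_, hHzero⟩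
  rcases eq_or_ne q 0 with rfl | hq0
  · simp [momentFunctional]
  have hqd : q.natDegree < H.natDegree := natDegree_lt_natDegree hq0 hq
  have hd1 : (w * H * q).natDegree ≤ n := by
    have h1 := natDegree_mul_le (p := w * H) (q := q)
    have h2 := natDegree_mul_le (p := w) (q := H)
    omega
  have hd2 : (w * q ^ 2).natDegree ≤ n := by
    have h1 := natDegree_mul_le (p := w) (q := q ^ 2)
    have h2 := natDegree_pow_le (p := q) (n := 2)
    omega
  have hQ : 0 ≤ momentFunctional (momentAt m) (w * q ^ 2) :=
    (hposm _ (mul_ne_zero hw0 (pow_ne_zero _ hq0)) hd2 (nonneg_of_mem_intervalWeights hw q)).le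
  -- Replacing `H` by `H + ε q` keeps the leading coefficient, so at `t₀` the mean stays
  -- nonnegative, while it is zero for `ε = 0`. Minimality in `ε` forces the linear term to vanish,
  -- which is orthogonality.
  have hquad : ∀ ε : ℝ, 0 ≤ 2 * ε * momentFunctional (momentAt m) (w * H * q) +
      ε ^ 2 * momentFunctional (momentAt m) (w * q ^ 2) := by
    intro ε
    have hexp : w * (H + ε • q) ^ 2 =
        w * H ^ 2 + ((2 * ε) • (w * H * q) + ε ^ 2 • (w * q ^ 2)) := by
      simp only [smul_eq_C_mul, C_mul, C_pow, map_ofNat]; ring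
    have hcH : (w * H ^ 2).coeff (n + 1) = σ := by
      rw [← hlead, show n + 1 = w.natDegree + (H ^ 2).natDegree by rw [hH.natDegree_pow]; omega,
        coeff_mul_degree_add_degree, (hH.pow 2).leadingCoeff, mul_one]
    have hc : (w * (H + ε • q) ^ 2).coeff (n + 1) = σ := by
      rw [hexp, coeff_add, hcH, coeff_add, coeff_smul, coeff_smul,
        coeff_eq_zero_of_natDegree_lt (p := w * H * q) (by omega),
        coeff_eq_zero_of_natDegree_lt (p := w * q ^ 2) (by omega)]
      simp
    have hdH2 : (w * (H + ε • q) ^ 2).natDegree ≤ n + 1 := by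
      have h1 := natDegree_mul_le (p := w) (q := (H + ε • q) ^ 2)
      have h2 := natDegree_pow_le (p := H + ε • q) (n := 2)
      have h3 := natDegree_add_le_of_degree_le (le_refl H.natDegree)
        ((natDegree_smul_le ε q).trans hqd.le)
      omega
    have h1 := hclosure _ _ fun t ht => by
      have := momentFunctional_add_mul_nonneg ht hdH2 (nonneg_of_mem_intervalWeights hw (H + ε • q))
      rwa [hc] at this
    rw [hexp, momentFunctional_add, momentFunctional_add, momentFunctional_smul,
      momentFunctional_smul] at h1
    linarith
  set Bq := momentFunctional (momentAt m) (w * H * q)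
  set Q := momentFunctional (momentAt m) (w * q ^ 2)
  -- Nearly the minimizer `-Bq / Q`; adding one avoids a division by a possibly zero `Q`.
  have h1 := hquad (-Bq / (Q + 1))
  have hQ1 : 0 < Q + 1 := by linarith
  have h2 : 2 * (-Bq / (Q + 1)) * Bq + (-Bq / (Q + 1)) ^ 2 * Q =
      -(Bq ^ 2 * ((Q + 2) / (Q + 1) ^ 2)) := by field_simp; ring
  rw [h2] at h1
  have h3 : 0 < (Q + 2) / (Q + 1) ^ 2 := by positivity
  have h4 : Bq ^ 2 ≤ 0 := by
    by_contra hcon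
    have := mul_pos (not_le.1 hcon) h3
    linarith
  exact pow_eq_zero_iff two_ne_zero |>.1 (le_antisymm h4 (sq_nonneg _))

theorem isBounded_momentSection_Icc {a b : ℝ} {n : ℕ} (m : Fin n → ℝ) (j : ℕ) :
    BddBelow (momentSection (Icc a b) m j) ∧ BddAbove (momentSection (Icc a b) m j) := by
  have key : ∀ t ∈ momentSection (Icc a b) m j, |t| ≤ max |a| |b| ^ j := by
    rintro t ⟨μ, hμ, -, rfl⟩
    have := hμ.isProbabilityMeasure
    have h := norm_integral_le_of_norm_le_const (μ := μ) (f := fun x : ℝ => x ^ j)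
      (C := max |a| |b| ^ j) (by
        filter_upwards [measure_eq_zero_iff_ae_notMem.1 hμ.carried] with x hx
        have hx' : x ∈ Icc a b := not_not.1 hx
        rw [norm_pow, Real.norm_eq_abs]
        exact pow_le_pow_left₀ (abs_nonneg x) (abs_le_max_abs_abs hx'.1 hx'.2) j)
    simpa using h
  exact ⟨⟨_, fun t ht => (abs_le.1 (key t ht)).1⟩, ⟨_, fun t ht => (abs_le.1 (key t ht)).2⟩⟩

theorem mem_interior_Icc_succ_iff {a b : ℝ} (hab : a < b) {n : ℕ} {m : Fin (n + 1) → ℝ} :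
    m ∈ interior (momentSpace (Icc a b) (n + 1)) ↔
      Fin.init m ∈ interior (momentSpace (Icc a b) n) ∧
      lowerMoment (Icc a b) (Fin.init m) (n + 1) < m (Fin.last n) ∧
      m (Fin.last n) < upperMoment (Icc a b) (Fin.init m) (n + 1) := by
  rw [mem_interior_succ_iff measurableSet_Icc (Icc_infinite hab)]
  refine and_congr_right fun hm => ?_
  obtain ⟨hbelow, habove⟩ := isBounded_momentSection_Icc (a := a) (b := b) (Fin.init m) (n + 1)
  constructor
  · intro h2
    obtain ⟨δ, hδ, hball⟩ := Metric.isOpen_iff.1 isOpen_interior _ h2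
    have h3 : m (Fin.last n) - δ / 2 ∈ momentSection (Icc a b) (Fin.init m) (n + 1) :=
      interior_subset (hball (by simp [abs_of_pos hδ, hδ]))
    have h4 : m (Fin.last n) + δ / 2 ∈ momentSection (Icc a b) (Fin.init m) (n + 1) :=
      interior_subset (hball (by simp [abs_of_pos hδ, hδ]))
    have h5 := csInf_le hbelow h3
    have h6 := le_csSup habove h4
    rw [lowerMoment, upperMoment]
    constructor <;> linarith
  · rintro ⟨h1, h2⟩
    have hne := nonempty_momentSection (interior_subset hm)
    obtain ⟨t, ht, htl⟩ := exists_lt_of_csInf_lt hne h1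
    obtain ⟨u, hu, hul⟩ := exists_lt_of_lt_csSup hne h2
    exact mem_interior_iff_mem_nhds.2 (mem_of_superset (Icc_mem_nhds htl hul)
      ((convex_momentSection _ _ _).ordConnected.out ht hu))

theorem lowerMoment_lt_upperMoment {a b : ℝ} (hab : a < b) {n : ℕ} {m : Fin n → ℝ}
    (hm : m ∈ interior (momentSpace (Icc a b) n)) :
    lowerMoment (Icc a b) m (n + 1) < upperMoment (Icc a b) m (n + 1) := by
  obtain ⟨t, ht⟩ := nonempty_interior_momentSection measurableSet_Icc (Icc_infinite hab) hm
  have h := (mem_interior_Icc_succ_iff hab (m := Fin.snoc (α := fun _ => ℝ) m t)).1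
    ((mem_interior_succ_iff measurableSet_Icc (Icc_infinite hab)).2 (by
      rw [Fin.init_snoc, Fin.snoc_last]; exact ⟨hm, ht⟩))
  rw [Fin.init_snoc] at h
  exact h.2.1.trans h.2.2

section Extremal

variable {a b : ℝ} {n : ℕ} {m : Fin n → ℝ}

theorem exists_lower_extremal (hab : a < b) (hm : m ∈ interior (momentSpace (Icc a b) n)) :
    ∃ w ∈ intervalWeights a b, ∃ H : ℝ[X], H.Monic ∧ w.natDegree + 2 * H.natDegree = n + 1 ∧
      w.leadingCoeff = 1 ∧
      (∀ q : ℝ[X], q.degree < H.degree → momentFunctional (momentAt m) (w * H * q) = 0) ∧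
      momentFunctional (momentAt m) (w * H ^ 2) + lowerMoment (Icc a b) m (n + 1) = 0 := by
  obtain ⟨hbelow, -⟩ := isBounded_momentSection_Icc (a := a) (b := b) m (n + 1)
  have := exists_extremal_polynomial hab hm (t₀ := lowerMoment (Icc a b) m (n + 1))
    (σ := 1) (Or.inl rfl)
    (csInf_mem_closure (nonempty_momentSection (interior_subset hm)) hbelow)
    fun t ht => by
      have : lowerMoment (Icc a b) m (n + 1) ≤ t := csInf_le hbelow ht
      linarith
  simpa only [one_mul] using this

theorem exists_upper_extremal (hab : a < b) (hm : m ∈ interior (momentSpace (Icc a b) n)) :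
    ∃ w ∈ intervalWeights a b, ∃ H : ℝ[X], H.Monic ∧ w.natDegree + 2 * H.natDegree = n + 1 ∧
      w.leadingCoeff = -1 ∧
      (∀ q : ℝ[X], q.degree < H.degree → momentFunctional (momentAt m) (w * H * q) = 0) ∧
      momentFunctional (momentAt m) (w * H ^ 2) - upperMoment (Icc a b) m (n + 1) = 0 := by
  obtain ⟨-, habove⟩ := isBounded_momentSection_Icc (a := a) (b := b) m (n + 1)
  have := exists_extremal_polynomial hab hm (t₀ := upperMoment (Icc a b) m (n + 1))
    (σ := -1) (Or.inr rfl)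
    (csSup_mem_closure (nonempty_momentSection (interior_subset hm)) habove)
    fun t ht => by
      have : t ≤ upperMoment (Icc a b) m (n + 1) := le_csSup habove ht
      linarith
  simpa only [neg_one_mul, ← sub_eq_add_neg] using this

/-- The parity of `n + 1` and the sign of the leading coefficient single out one of the four
weights: `1` at the lower and `(x - a) (b - x)` at the upper end point. For odd `n + 1` they are `x
- a` and `b - x`. -/
theorem exists_extremal_even (hab : a < b) (hm : m ∈ interior (momentSpace (Icc a b) n)) {d : ℕ}
    (hn : n + 1 = 2 * (d + 1)) : ∃ P S : ℝ[X], P.Monic ∧ S.Monic ∧ P.natDegree = d + 1 ∧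
      S.natDegree = d ∧
      (∀ q : ℝ[X], q.degree < P.degree → momentFunctional (momentAt m) (1 * P * q) = 0) ∧
      (∀ q : ℝ[X], q.degree < S.degree →
        momentFunctional (momentAt m) ((X - C a) * (C b - X) * S * q) = 0) ∧
      momentFunctional (momentAt m) (1 * P ^ 2) = -lowerMoment (Icc a b) m (n + 1) ∧
      momentFunctional (momentAt m) ((X - C a) * (C b - X) * S ^ 2) =
        upperMoment (Icc a b) m (n + 1) := by
  obtain ⟨w, hw, P, hP, dP, lw, oP, eP⟩ := exists_lower_extremal hab hm
  obtain ⟨w', hw', S, hS, dS, lw', oS, eS⟩ := exists_upper_extremal hab hm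
  obtain rfl : w = 1 := by
    rcases intervalWeights_cases hw with h | h | h | h
    · exact h.1
    · omega
    · rw [h.2.2] at lw; norm_num at lw
    · rw [h.2.2] at lw; norm_num at lw
  have h2 : w' = (X - C a) * (C b - X) ∧ w'.natDegree = 2 := by
    rcases intervalWeights_cases hw' with h | h | h | h
    · rw [h.2.2] at lw'; norm_num at lw'
    · rw [h.2.2] at lw'; norm_num at lw'
    · omega
    · exact ⟨h.1, h.2.1⟩
  obtain ⟨rfl, hd⟩ := h2
  rw [natDegree_one] at dP
  exact ⟨P, S, hP, hS, by omega, by omega, oP, oS, by linarith, by linarith⟩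

theorem exists_extremal_odd (hab : a < b) (hm : m ∈ interior (momentSpace (Icc a b) n)) {d : ℕ}
    (hn : n + 1 = 2 * d + 1) : ∃ A B : ℝ[X], A.Monic ∧ B.Monic ∧ A.natDegree = d ∧
      B.natDegree = d ∧
      (∀ q : ℝ[X], q.degree < A.degree → momentFunctional (momentAt m) ((X - C a) * A * q) = 0) ∧
      (∀ q : ℝ[X], q.degree < B.degree → momentFunctional (momentAt m) ((C b - X) * B * q) = 0) ∧
      momentFunctional (momentAt m) ((X - C a) * A ^ 2) = -lowerMoment (Icc a b) m (n + 1) ∧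
      momentFunctional (momentAt m) ((C b - X) * B ^ 2) = upperMoment (Icc a b) m (n + 1) := by
  obtain ⟨w, hw, A, hA, dA, lw, oA, eA⟩ := exists_lower_extremal hab hm
  obtain ⟨w', hw', B, hB, dB, lw', oB, eB⟩ := exists_upper_extremal hab hm
  have h1 : w = X - C a ∧ w.natDegree = 1 := by
    rcases intervalWeights_cases hw with h | h | h | h
    · omega
    · exact ⟨h.1, h.2.1⟩
    · rw [h.2.2] at lw; norm_num at lw
    · rw [h.2.2] at lw; norm_num at lw
  have h2 : w' = C b - X ∧ w'.natDegree = 1 := by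
    rcases intervalWeights_cases hw' with h | h | h | h
    · rw [h.2.2] at lw'; norm_num at lw'
    · rw [h.2.2] at lw'; norm_num at lw'
    · exact ⟨h.1, h.2.1⟩
    · omega
  obtain ⟨rfl, hd⟩ := h1
  obtain ⟨rfl, hd'⟩ := h2
  exact ⟨A, B, hA, hB, by omega, by omega, oA, oB, by linarith, by linarith⟩

end Extremal

/-- Passing to one more moment in the relations of an extremal polynomial. -/
theorem momentFunctional_extremal_init {n : ℕ} (m : Fin (n + 1) → ℝ) {w H : ℝ[X]}
    (hw : w ≠ 0) (hH : H.Monic) (hd : w.natDegree + 2 * H.natDegree = n + 1)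
    (orth : ∀ q : ℝ[X], q.degree < H.degree →
      momentFunctional (momentAt (Fin.init m)) (w * H * q) = 0) :
    (∀ q : ℝ[X], q.degree < H.degree → momentFunctional (momentAt m) (w * H * q) = 0) ∧
    momentFunctional (momentAt m) (w * H ^ 2) =
      momentFunctional (momentAt (Fin.init m)) (w * H ^ 2) + w.leadingCoeff * m (Fin.last n) := by
  constructor
  · intro q hq
    rcases eq_or_ne q 0 with rfl | hq0
    · simp [momentFunctional]
    have hqd : q.natDegree < H.natDegree := natDegree_lt_natDegree hq0 hq
    have hd1 : (w * H * q).natDegree ≤ n := by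
      have h1 := natDegree_mul_le (p := w * H) (q := q)
      have h2 := natDegree_mul_le (p := w) (q := H)
      omega
    rw [← orth q hq]
    exact momentFunctional_congr hd1 fun i hi => (momentAt_init m hi).symm
  · have hd2 : (w * H ^ 2).natDegree = n + 1 := by
      rw [natDegree_mul hw (hH.pow 2).ne_zero, hH.natDegree_pow, hd]
    have hc : (w * H ^ 2).coeff (n + 1) = w.leadingCoeff := by
      rw [← hd2, coeff_natDegree, leadingCoeff_mul, (hH.pow 2).leadingCoeff, mul_one]
    rw [momentFunctional_momentAt_succ m hd2.le, hc]

/-- Divided by the square of the previous range, this reads: consecutive ranges have quotient `(b -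
a) p (1 - p)`. With one more moment prescribed, the extremal means at the earlier level become the
distances of that moment to its two end points, while those at the new level are again the end
points; the two algebraic relations connect them. -/
theorem moment_range_relation {a b : ℝ} (hab : a < b) {n : ℕ} {m : Fin (n + 1) → ℝ}
    (hm : m ∈ interior (momentSpace (Icc a b) (n + 1))) :
    (upperMoment (Icc a b) m (n + 2) - lowerMoment (Icc a b) m (n + 2)) *
        (upperMoment (Icc a b) (Fin.init m) (n + 1) - lowerMoment (Icc a b) (Fin.init m) (n + 1)) =
      (b - a) * (m (Fin.last n) - lowerMoment (Icc a b) (Fin.init m) (n + 1)) *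
        (upperMoment (Icc a b) (Fin.init m) (n + 1) - m (Fin.last n)) := by
  have hm' := interior_momentSpace_init measurableSet_Icc (Icc_infinite hab) hm
  obtain ⟨c1, c2, c3, c4⟩ : (1 : ℝ[X]).leadingCoeff = 1 ∧ (X - C a : ℝ[X]).leadingCoeff = 1 ∧
      (C b - X : ℝ[X]).leadingCoeff = -1 ∧ ((X - C a) * (C b - X) : ℝ[X]).leadingCoeff = -1 := by
    have hb : (C b - X : ℝ[X]).leadingCoeff = -1 := by
      rw [← neg_sub X (C b), leadingCoeff_neg, leadingCoeff_X_sub_C]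
    exact ⟨leadingCoeff_one, leadingCoeff_X_sub_C a, hb,
      by rw [leadingCoeff_mul, leadingCoeff_X_sub_C, hb, one_mul]⟩
  have n3 : (C b - X : ℝ[X]) ≠ 0 := by intro h; rw [h] at c3; simp at c3
  have n4 : ((X - C a) * (C b - X) : ℝ[X]) ≠ 0 := mul_ne_zero (X_sub_C_ne_zero a) n3
  have d4 : ((X - C a) * (C b - X) : ℝ[X]).natDegree = 2 := by
    rw [natDegree_mul (X_sub_C_ne_zero a) n3, natDegree_X_sub_C, natDegree_C_sub_X]
  rcases Nat.even_or_odd' n with ⟨d, hd | hd⟩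
  · obtain ⟨A, B, hA, hB, dA, dB, oA, oB, eA, eB⟩ := exists_extremal_odd hab hm' (d := d) (by omega)
    obtain ⟨P, S, hP, hS, dP, dS, oP, oS, eP, eS⟩ := exists_extremal_even hab hm (d := d) (by omega)
    obtain ⟨oA, fA⟩ := momentFunctional_extremal_init m (X_sub_C_ne_zero a) hA
      (by rw [natDegree_X_sub_C]; omega) oA
    obtain ⟨oB, fB⟩ := momentFunctional_extremal_init m n3 hB
      (by rw [natDegree_C_sub_X]; omega) oB
    have key := extremal_relation_odd (L := momentLinear (momentAt m)) hP hS hA hB dP dS dA dB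
      oP oS oA oB
    simp only [momentLinear_apply] at key
    rw [eP, eS, fA, fB, eA, eB, c2, c3] at key
    linear_combination key
  · obtain ⟨d, rfl⟩ : ∃ e, d = e := ⟨d, rfl⟩
    obtain ⟨P, S, hP, hS, dP, dS, oP, oS, eP, eS⟩ :=
      exists_extremal_even hab hm' (d := d) (by omega)
    obtain ⟨A, B, hA, hB, dA, dB, oA, oB, eA, eB⟩ :=
      exists_extremal_odd hab hm (d := d + 1) (by omega)
    obtain ⟨oP, fP⟩ := momentFunctional_extremal_init m one_ne_zero hP
      (by rw [natDegree_one]; omega) oP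
    obtain ⟨oS, fS⟩ := momentFunctional_extremal_init m n4 hS (by rw [d4]; omega) oS
    have key := extremal_relation_even (L := momentLinear (momentAt m)) hP hS hA hB dP dS dA dB
      oP oS oA oB
    simp only [momentLinear_apply] at key
    rw [eA, eB, fP, fS, eP, eS, c1, c4] at key
    linear_combination key

theorem moment_range_one {a b : ℝ} (hab : a < b) {m : Fin 0 → ℝ}
    (hm : m ∈ interior (momentSpace (Icc a b) 0)) :
    upperMoment (Icc a b) m 1 - lowerMoment (Icc a b) m 1 = b - a := by
  obtain ⟨A, B, hA, hB, dA, dB, -, -, eA, eB⟩ := exists_extremal_odd hab hm (d := 0) rfl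
  have h1 : (X - C a : ℝ[X]).natDegree ≤ 1 := (natDegree_X_sub_C a).le
  have h2 : (C b - X : ℝ[X]).natDegree ≤ 1 := (natDegree_C_sub_X b).le
  rw [hA.natDegree_eq_zero.1 dA, one_pow, mul_one, momentFunctional_eq_sum h1] at eA
  rw [hB.natDegree_eq_zero.1 dB, one_pow, mul_one, momentFunctional_eq_sum h2] at eB
  -- Here `momentAt m 1` is the default `0`, so the two means are `-a` and `b`.
  simp [Finset.sum_range_succ, momentAt] at eA eB
  linarith

theorem compactCoord_init {a b : ℝ} {n : ℕ} (m : Fin (n + 1) → ℝ) {j : ℕ} (hj : j ≤ n) :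
    compactCoord a b n (Fin.init m) j = compactCoord a b (n + 1) m j := by
  rw [compactCoord, compactCoord, momentAt_init m hj, lowerMoment_init _ m (by omega),
    upperMoment_init _ m (by omega)]

theorem compactCoord_last {a b : ℝ} {n : ℕ} (m : Fin (n + 1) → ℝ) :
    compactCoord a b (n + 1) m (n + 1) =
      (m (Fin.last n) - lowerMoment (Icc a b) (Fin.init m) (n + 1)) /
        (upperMoment (Icc a b) (Fin.init m) (n + 1) -
          lowerMoment (Icc a b) (Fin.init m) (n + 1)) := by
  rw [compactCoord, momentAt_last, lowerMoment_init _ m le_rfl, upperMoment_init _ m le_rfl]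

theorem moment_range_eq_prod {a b : ℝ} (hab : a < b) {n : ℕ} {m : Fin n → ℝ}
    (hm : m ∈ interior (momentSpace (Icc a b) n)) :
    upperMoment (Icc a b) m (n + 1) - lowerMoment (Icc a b) m (n + 1) =
      (b - a) ^ (n + 1) * ∏ j ∈ Finset.Icc 1 n,
        (compactCoord a b n m j * (1 - compactCoord a b n m j)) := by
  induction n with
  | zero => simpa using moment_range_one hab hm
  | succ n ih =>
    have hm' := interior_momentSpace_init measurableSet_Icc (Icc_infinite hab) hm
    have h1 := moment_range_relation hab hm
    have hpos := sub_pos.2 (lowerMoment_lt_upperMoment hab hm')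
    have h2 : ∏ j ∈ Finset.Icc 1 n,
        (compactCoord a b (n + 1) m j * (1 - compactCoord a b (n + 1) m j)) =
        ∏ j ∈ Finset.Icc 1 n,
        (compactCoord a b n (Fin.init m) j * (1 - compactCoord a b n (Fin.init m) j)) :=
      Finset.prod_congr rfl fun j hj => by rw [compactCoord_init m (Finset.mem_Icc.1 hj).2]
    rw [prod_Icc_one_succ, h2, pow_succ, mul_mul_mul_comm, ← ih hm', compactCoord_last]
    refine mul_right_cancel₀ hpos.ne' (h1.trans ?_)
    field_simp
    ring

theorem triangularCoordinates_Icc {a b : ℝ} (hab : a < b) :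
    TriangularCoordinates (fun n => interior (momentSpace (Icc a b) n)) (compactCoord a b)
      (alternating (Ioo 0 1) (Ioo 0 1))
      (alternating (fun p => p * (1 - p)) fun p => p * (1 - p)) where
  isOpen _ := isOpen_interior
  zero_eq := by rw [momentSpace_zero measurableSet_Icc (nonempty_Icc.2 hab.le), interior_univ]
  coord_init n m _ j hj := (compactCoord_init m (Finset.mem_Icc.1 hj).2).symm
  mem_succ_iff n m := by
    rw [mem_interior_Icc_succ_iff hab, alternating_self]
    refine and_congr_right fun hm => ?_
    have hpos := sub_pos.2 (lowerMoment_lt_upperMoment hab hm)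
    rw [compactCoord_last, mem_Ioo, div_pos_iff_of_pos_right hpos, div_lt_one hpos, sub_pos,
      sub_lt_sub_iff_right]
  isOpen_range j := by rw [alternating_self]; exact isOpen_Ioo
  weight_pos j t ht := by
    rw [alternating_self] at ht ⊢
    exact mul_pos ht.1 (sub_pos.2 ht.2)
  weight_cont j := by rw [alternating_self]; fun_prop
  affine n := by
    refine ⟨fun m => lowerMoment (Icc a b) m (n + 1), (b - a) ^ (n + 1),
      pow_pos (sub_pos.2 hab) _,
      continuousOn_lowerMoment n fun m _ => (isBounded_momentSection_Icc m _).1, fun m hm => ?_⟩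
    simp only [alternating_self]
    rw [← moment_range_eq_prod hab hm, compactCoord_last]

/-! ### The real line: orthogonal polynomials and recurrence coefficients. -/

theorem orthoPoly_zero (s : ℕ → ℝ) : orthoPoly s 0 = 1 := by rw [orthoPoly]

theorem orthoPoly_one (s : ℕ → ℝ) :
    orthoPoly s 1 = X - C (momentFunctional s X / momentFunctional s 1) := by rw [orthoPoly]

theorem orthoPoly_succ_succ (s : ℕ → ℝ) (j : ℕ) : orthoPoly s (j + 2) =
    (X - C (momentFunctional s (X * orthoPoly s (j + 1) ^ 2) /
        momentFunctional s (orthoPoly s (j + 1) ^ 2))) * orthoPoly s (j + 1) -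
      C (momentFunctional s (orthoPoly s (j + 1) ^ 2) /
        momentFunctional s (orthoPoly s j ^ 2)) * orthoPoly s j := by rw [orthoPoly]

theorem orthoPoly_monic_natDegree (s : ℕ → ℝ) (l : ℕ) :
    (orthoPoly s l).Monic ∧ (orthoPoly s l).natDegree = l := by
  induction l using Nat.twoStepInduction with
  | zero => rw [orthoPoly_zero]; exact ⟨monic_one, natDegree_one⟩
  | one => rw [orthoPoly_one]; exact ⟨monic_X_sub_C _, natDegree_X_sub_C _⟩
  | more j h0 h1 =>
    rw [orthoPoly_succ_succ]
    set α := momentFunctional s (X * orthoPoly s (j + 1) ^ 2) /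
        momentFunctional s (orthoPoly s (j + 1) ^ 2)
    set β := momentFunctional s (orthoPoly s (j + 1) ^ 2) / momentFunctional s (orthoPoly s j ^ 2)
    have hm : ((X - C α) * orthoPoly s (j + 1)).Monic := (monic_X_sub_C α).mul h1.1
    have hd : ((X - C α) * orthoPoly s (j + 1)).natDegree = j + 2 := by
      rw [natDegree_X_sub_C_mul h1.1, h1.2]
    have hlt : (C β * orthoPoly s j).natDegree < ((X - C α) * orthoPoly s (j + 1)).natDegree := by
      have := natDegree_C_mul_le β (orthoPoly s j)
      omega
    refine ⟨hm.sub_of_left (degree_lt_degree hlt), ?_⟩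
    rw [natDegree_sub_eq_left_of_natDegree_lt hlt, hd]

theorem orthoPoly_monic (s : ℕ → ℝ) (l : ℕ) : (orthoPoly s l).Monic :=
  (orthoPoly_monic_natDegree s l).1

theorem natDegree_orthoPoly (s : ℕ → ℝ) (l : ℕ) : (orthoPoly s l).natDegree = l :=
  (orthoPoly_monic_natDegree s l).2

theorem natDegree_orthoPoly_sq (s : ℕ → ℝ) (l : ℕ) : (orthoPoly s l ^ 2).natDegree = 2 * l := by
  rw [(orthoPoly_monic s l).natDegree_pow, natDegree_orthoPoly]

theorem natDegree_X_mul_orthoPoly_sq (s : ℕ → ℝ) (l : ℕ) :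
    (X * orthoPoly s l ^ 2).natDegree = 2 * l + 1 := by
  rw [natDegree_X_mul ((orthoPoly_monic s l).pow 2).ne_zero, natDegree_orthoPoly_sq]

/-- This is the triangularity of the recurrence coefficients. For `l = 0` the bound `2 * l - 1`
truncates to `0`, which is harmless as the polynomial is constant. -/
theorem orthoPoly_congr {s s' : ℕ → ℝ} (l : ℕ) (h : ∀ i ≤ 2 * l - 1, s i = s' i) :
    orthoPoly s l = orthoPoly s' l := by
  induction l using Nat.twoStepInduction with
  | zero => rw [orthoPoly_zero, orthoPoly_zero]
  | one =>
    rw [orthoPoly_one, orthoPoly_one, momentFunctional_congr natDegree_X_le (n := 1) h,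
      momentFunctional_congr (natDegree_one.le) (n := 0) fun i hi => h i (by omega)]
  | more j h0 h1 =>
    rw [orthoPoly_succ_succ, orthoPoly_succ_succ, h0 fun i hi => h i (by omega),
      h1 fun i hi => h i (by omega),
      momentFunctional_congr (natDegree_X_mul_orthoPoly_sq s' (j + 1)).le fun i hi => h i (by omega),
      momentFunctional_congr (natDegree_orthoPoly_sq s' (j + 1)).le fun i hi => h i (by omega),
      momentFunctional_congr (natDegree_orthoPoly_sq s' j).le fun i hi => h i (by omega)]

theorem recurrenceAlpha_congr {s s' : ℕ → ℝ} {l : ℕ} (h : ∀ i ≤ 2 * l + 1, s i = s' i) :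
    recurrenceAlpha s (l + 1) = recurrenceAlpha s' (l + 1) := by
  rw [recurrenceAlpha, recurrenceAlpha, Nat.add_sub_cancel,
    orthoPoly_congr l fun i hi => h i (by omega),
    momentFunctional_congr (natDegree_X_mul_orthoPoly_sq s' l).le h,
    momentFunctional_congr (natDegree_orthoPoly_sq s' l).le fun i hi => h i (by omega)]

theorem recurrenceBeta_congr {s s' : ℕ → ℝ} {l : ℕ} (h : ∀ i ≤ 2 * l, s i = s' i) :
    recurrenceBeta s l = recurrenceBeta s' l := by
  rw [recurrenceBeta, recurrenceBeta, orthoPoly_congr l fun i hi => h i (by omega),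
    orthoPoly_congr (l - 1) fun i hi => h i (by omega),
    momentFunctional_congr (natDegree_orthoPoly_sq s' l).le h,
    momentFunctional_congr (natDegree_orthoPoly_sq s' (l - 1)).le fun i hi => h i (by omega)]

theorem degree_orthoPoly (s : ℕ → ℝ) (l : ℕ) : (orthoPoly s l).degree = l := by
  rw [degree_eq_natDegree (orthoPoly_monic s l).ne_zero, natDegree_orthoPoly]

theorem degree_sub_C_mul_orthoPoly_lt (s : ℕ → ℝ) {l : ℕ} {q : ℝ[X]} (hq : q.degree < (l + 1 : ℕ)) :
    (q - C (q.coeff l) * orthoPoly s l).degree < l := by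
  rw [degree_lt_iff_coeff_zero] at hq ⊢
  intro i hi
  have hP : (orthoPoly s l).coeff l = 1 := by
    have := (orthoPoly_monic s l).coeff_natDegree
    rwa [natDegree_orthoPoly] at this
  rcases hi.lt_or_eq with h | rfl
  · rw [coeff_sub, coeff_C_mul, hq i (by omega),
      coeff_eq_zero_of_natDegree_lt (p := orthoPoly s l) (by rw [natDegree_orthoPoly]; exact h)]
    simp
  · rw [coeff_sub, coeff_C_mul, hP, mul_one, sub_self]

/-- Only squared norms of index below `l` have to be nonzero, so orthogonality is available before
anything is known about the norm of the polynomial of index `l` itself. The two recurrence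
coefficients are exactly those that kill the products with the two preceding polynomials. -/
theorem orthoPoly_orthogonal (s : ℕ → ℝ) (l : ℕ)
    (h : ∀ i < l, momentFunctional s (orthoPoly s i ^ 2) ≠ 0) :
    ∀ q : ℝ[X], q.degree < l → momentFunctional s (orthoPoly s l * q) = 0 := by
  induction l using Nat.twoStepInduction with
  | zero =>
    intro q hq
    have : q = 0 := by rw [← degree_eq_bot]; exact Nat.WithBot.lt_zero_iff.1 hq
    simp [this, momentFunctional]
  | one =>
    intro q hq
    have h0 := h 0 (by omega)
    rw [orthoPoly_zero, one_pow] at h0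
    have hq' : q = C (q.coeff 0) := eq_C_of_natDegree_le_zero (natDegree_le_iff_coeff_eq_zero.2
      fun i hi => (degree_lt_iff_coeff_zero q 1).1 hq i hi)
    rw [hq', orthoPoly_one]
    have e : (X - C (momentFunctional s X / momentFunctional s 1)) * C (q.coeff 0) =
        q.coeff 0 • X + (-(q.coeff 0 * (momentFunctional s X / momentFunctional s 1))) • 1 := by
      rw [smul_eq_C_mul, smul_eq_C_mul, C_neg, C_mul]; ring
    rw [e, momentFunctional_add, momentFunctional_smul, momentFunctional_smul]
    field_simp
    ring
  | more j ih0 ih1 =>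
    intro q hq
    have o0 := ih0 fun i hi => h i (by omega)
    have o1 := ih1 fun i hi => h i (by omega)
    have n0 := h j (by omega)
    have n1 := h (j + 1) (by omega)
    set L := momentLinear s with hL
    have hLa : ∀ p, momentFunctional s p = L p := fun p => rfl
    set P₀ := orthoPoly s j with hP₀
    set P₁ := orthoPoly s (j + 1) with hP₁
    simp only [hLa] at o0 o1 n0 n1 ⊢
    rw [orthoPoly_succ_succ, ← hP₀, ← hP₁, hLa, hLa, hLa]
    set α := L (X * P₁ ^ 2) / L (P₁ ^ 2) with hα
    set β := L (P₁ ^ 2) / L (P₀ ^ 2) with hβ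
    have hα' : α * L (P₁ ^ 2) = L (X * P₁ ^ 2) := div_mul_cancel₀ _ n1
    have hβ' : β * L (P₀ ^ 2) = L (P₁ ^ 2) := div_mul_cancel₀ _ n0
    set u := q.coeff (j + 1) with hu
    set q₁ := q - C u * P₁ with hq₁
    have dq₁ : q₁.degree < (j + 1 : ℕ) := degree_sub_C_mul_orthoPoly_lt s hq
    set v := q₁.coeff j with hv
    set r := q₁ - C v * P₀ with hr
    have dr : r.degree < (j : ℕ) := degree_sub_C_mul_orthoPoly_lt s dq₁
    have d0 : P₀.degree < (j + 1 : ℕ) := by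
      rw [hP₀, degree_orthoPoly]; exact_mod_cast j.lt_succ_self
    have dXr : (X * r).degree < ((j + 1 : ℕ) : WithBot ℕ) := by
      rcases eq_or_ne r 0 with h0 | h0
      · rw [h0, mul_zero, degree_zero]; exact WithBot.bot_lt_coe _
      · rw [degree_eq_natDegree h0] at dr
        rw [degree_eq_natDegree (mul_ne_zero X_ne_zero h0), natDegree_X_mul h0]
        exact_mod_cast Nat.succ_lt_succ (by exact_mod_cast dr)
    have dXP : (X * P₀ - P₁).degree < ((j + 1 : ℕ) : WithBot ℕ) := by
      have hm : (X * P₀).Monic := monic_X.mul (orthoPoly_monic s j)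
      have hd : (X * P₀).degree = ((j + 1 : ℕ) : WithBot ℕ) := by
        rw [degree_eq_natDegree hm.ne_zero, natDegree_X_mul (orthoPoly_monic s j).ne_zero,
          natDegree_orthoPoly]
      have := degree_sub_lt_left (p := X * P₀) (q := P₁) (by rw [hd, hP₁, degree_orthoPoly]) hm.ne_zero
        (by rw [hm, (orthoPoly_monic s (j + 1))])
      rwa [hd] at this
    have z1 : L (P₁ * r) = 0 := o1 r (dr.trans (by exact_mod_cast j.lt_succ_self))
    have z2 : L (P₁ * (X * r)) = 0 := o1 _ dXr
    have z3 : L (P₀ * r) = 0 := o0 r dr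
    have z4 : L (P₁ * P₀) = 0 := o1 _ d0
    have z5 : L (P₁ * (X * P₀ - P₁)) = 0 := o1 _ dXP
    -- After splitting off the components along `P₁` and `P₀`, the remainder has degree below `j`;
    -- also `X * P₀ - P₁` has degree at most `j`, so `P₁` tested against `X * P₀` gives the squared
    -- norm of `P₁`.
    have hq2 : q = u • P₁ + v • P₀ + r := by
      rw [hr, hq₁, smul_eq_C_mul, smul_eq_C_mul]; ring
    have e : ((X - C α) * P₁ - C β * P₀) * q =
        u • (X * P₁ ^ 2) - (u * α) • P₁ ^ 2 - (u * β) • (P₁ * P₀)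
        + v • (P₁ * (X * P₀ - P₁)) + v • P₁ ^ 2 - (v * α) • (P₁ * P₀) - (v * β) • P₀ ^ 2
        + P₁ * (X * r) - α • (P₁ * r) - β • (P₀ * r) := by
      conv_lhs => rw [hq2]
      simp only [smul_eq_C_mul, C_mul]
      ring
    rw [e]
    simp only [map_add, map_sub, map_smul, smul_eq_mul, z1, z2, z3, z4, z5]
    linear_combination (-u) * hα' - v * hβ'

theorem momentFunctional_one {n : ℕ} (m : Fin n → ℝ) : momentFunctional (momentAt m) 1 = 1 := by
  rw [momentFunctional_eq_sum (n := 0) natDegree_one.le]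
  simp [momentAt]

theorem momentFunctional_orthoPoly_sq_pos {n : ℕ} {m : Fin n → ℝ}
    (hm : m ∈ interior (momentSpace univ n)) {l : ℕ} (hl : 2 * l ≤ n) :
    0 < momentFunctional (momentAt m) (orthoPoly (momentAt m) l ^ 2) :=
  (mem_interior_momentSpace_iff MeasurableSet.univ infinite_univ).1 hm _
    ((orthoPoly_monic _ l).pow 2).ne_zero (by rw [natDegree_orthoPoly_sq]; exact hl)
    fun x _ => by rw [eval_pow]; positivity

theorem prod_recurrenceBeta {n : ℕ} {m : Fin n → ℝ} (hm : m ∈ interior (momentSpace univ n)) {l : ℕ}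
    (hl : 2 * l ≤ n) : ∏ i ∈ Finset.Icc 1 l, recurrenceBeta (momentAt m) i =
      momentFunctional (momentAt m) (orthoPoly (momentAt m) l ^ 2) := by
  induction l with
  | zero => simp [orthoPoly_zero, momentFunctional_one]
  | succ l ih =>
    rw [prod_Icc_one_succ, ih (by omega), recurrenceBeta, Nat.add_sub_cancel]
    exact mul_div_cancel₀ _ (momentFunctional_orthoPoly_sq_pos hm (by omega)).ne'

theorem prod_alternating_one (f : ℕ → ℝ) (y : ℕ → ℝ) (hy : ∀ i, y (2 * i) = f i) (n : ℕ) :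
    ∏ j ∈ Finset.Icc 1 n, alternating (fun _ => (1 : ℝ)) (fun t => t) j (y j) =
      ∏ i ∈ Finset.Icc 1 (n / 2), f i := by
  induction n with
  | zero => simp
  | succ n ih =>
    rw [prod_Icc_one_succ, ih]
    rcases Nat.even_or_odd' n with ⟨l, rfl | rfl⟩
    · rw [show (2 * l + 1) / 2 = 2 * l / 2 by omega, alternating, if_pos ⟨l, rfl⟩, mul_one]
    · rw [show (2 * l + 1 + 1) / 2 = (2 * l + 1) / 2 + 1 by omega, prod_Icc_one_succ, alternating,
        if_neg (by rw [Nat.not_odd_iff_even]; exact ⟨l + 1, by ring⟩),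
        show 2 * l + 1 + 1 = 2 * ((2 * l + 1) / 2 + 1) by omega, hy]

theorem realLineCoord_odd {n : ℕ} (m : Fin n → ℝ) (l : ℕ) :
    realLineCoord n m (2 * l + 1) = recurrenceAlpha (momentAt m) (l + 1) := by
  rw [realLineCoord, if_pos ⟨l, rfl⟩, show (2 * l + 1 + 1) / 2 = l + 1 by omega]

theorem realLineCoord_even {n : ℕ} (m : Fin n → ℝ) (l : ℕ) :
    realLineCoord n m (2 * l) = recurrenceBeta (momentAt m) l := by
  rw [realLineCoord, if_neg (by rw [Nat.not_odd_iff_even]; exact ⟨l, by ring⟩),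
    show (2 * l) / 2 = l by omega]

theorem realLineCoord_init {n : ℕ} (m : Fin (n + 1) → ℝ) {j : ℕ} (hj : j ≤ n) :
    realLineCoord (n + 1) m j = realLineCoord n (Fin.init m) j := by
  rcases Nat.even_or_odd' j with ⟨l, rfl | rfl⟩
  · rw [realLineCoord_even, realLineCoord_even]
    exact recurrenceBeta_congr fun i hi => (momentAt_init m (hi.trans hj)).symm
  · rw [realLineCoord_odd, realLineCoord_odd]
    exact recurrenceAlpha_congr fun i hi => (momentAt_init m (hi.trans hj)).symm

theorem even_of_nonneg_univ {q : ℝ[X]} {n : ℕ} (hq : q.natDegree = n + 1)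
    (hqE : ∀ x ∈ (univ : Set ℝ), 0 ≤ q.eval x) : Even (n + 1) := by
  have h1 := coeff_pos_of_nonneg_Ici hq fun x _ => hqE x trivial
  have hd : (q.comp (-X)).natDegree = n + 1 := by
    rw [natDegree_comp, natDegree_neg, natDegree_X, hq, mul_one]
  have h2 := coeff_pos_of_nonneg_Ici hd fun x _ => by
    rw [eval_comp]; exact hqE _ trivial
  by_contra hodd
  rw [Nat.not_even_iff_odd] at hodd
  have h3 : (q.comp (-X)).leadingCoeff = -q.leadingCoeff := by
    rw [leadingCoeff_comp (by rw [natDegree_neg, natDegree_X]; exact one_ne_zero), hq,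
      leadingCoeff_neg, leadingCoeff_X, hodd.neg_one_pow, mul_neg_one]
  rw [leadingCoeff, leadingCoeff, hd, hq] at h3
  linarith

/-- A polynomial that is nonnegative on the whole line has even degree, so a moment of odd order is
unconstrained. -/
theorem mem_interior_univ_succ_odd {l : ℕ} {m : Fin (2 * l + 1) → ℝ} :
    m ∈ interior (momentSpace univ (2 * l + 1)) ↔
      Fin.init m ∈ interior (momentSpace univ (2 * l)) := by
  refine ⟨interior_momentSpace_init MeasurableSet.univ infinite_univ, fun h => ?_⟩
  refine mem_interior_succ_of_forall MeasurableSet.univ infinite_univ h fun q hq hqE => ?_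
  have := even_of_nonneg_univ hq hqE
  exact absurd this (by rw [Nat.not_even_iff_odd]; exact ⟨l, rfl⟩)

/-- A polynomial `g` of degree `l + 1` splits as `c P + r` with `P` orthogonal to `r`, so the mean
of `g ^ 2` is `c ^ 2` times that of `P ^ 2` plus that of `r ^ 2`; the latter only involves lower
moments. -/
theorem mem_interior_univ_succ_even {l : ℕ} {m : Fin (2 * l + 1 + 1) → ℝ} :
    m ∈ interior (momentSpace univ (2 * l + 1 + 1)) ↔
      Fin.init m ∈ interior (momentSpace univ (2 * l + 1)) ∧
      0 < momentFunctional (momentAt m) (orthoPoly (momentAt m) (l + 1) ^ 2) := by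
  refine ⟨fun h => ⟨interior_momentSpace_init MeasurableSet.univ infinite_univ h,
    momentFunctional_orthoPoly_sq_pos h (by omega)⟩, fun ⟨h, hpos⟩ => ?_⟩
  rw [mem_interior_momentSpace_iff MeasurableSet.univ infinite_univ]
  have hinit := (mem_interior_momentSpace_iff MeasurableSet.univ infinite_univ).1 h
  have hm : IsMomentPositive univ (momentAt m) (2 * l + 1) :=
    hinit.mono le_rfl fun i hi => (momentAt_init m hi).symm
  have hsq : ∀ r : ℝ[X], r ≠ 0 → r.natDegree ≤ l → 0 < momentFunctional (momentAt m) (r ^ 2) :=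
    fun r hr0 hr => hm _ (pow_ne_zero 2 hr0)
      (natDegree_pow_le.trans (by omega)) fun x _ => by rw [eval_pow]; positivity
  have horth := orthoPoly_orthogonal (momentAt m) (l + 1) fun i hi =>
    (hsq _ (orthoPoly_monic _ i).ne_zero (by rw [natDegree_orthoPoly]; omega)).ne'
  refine isMomentPositive_of_weightedSquares (𝒲 := {1})
    (fun q hq hqE => mem_weightedSquares_of_nonneg_univ hq hqE) fun w hw g hg0 hgn => ?_
  obtain rfl : w = 1 := hw
  rw [one_mul] at hg0 hgn ⊢
  have hg : g ≠ 0 := by rintro rfl; simp at hg0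
  rw [natDegree_pow] at hgn
  rcases Nat.lt_or_ge l g.natDegree with hlt | hle
  · have hgd : g.natDegree = l + 1 := by omega
    set P := orthoPoly (momentAt m) (l + 1) with hP
    set c := g.coeff (l + 1) with hc
    have hc0 : c ≠ 0 := by rw [hc, ← hgd]; exact leadingCoeff_ne_zero.2 hg
    set r := g - C c * P with hr
    have dr : r.degree < (l + 1 : ℕ) := degree_sub_C_mul_orthoPoly_lt _ (by
      rw [degree_eq_natDegree hg, hgd]; exact_mod_cast Nat.lt_succ_self _)
    have hgr : g ^ 2 = c ^ 2 • P ^ 2 + ((2 * c) • (P * r) + r ^ 2) := by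
      have : g = C c * P + r := by rw [hr]; ring
      rw [this]
      simp only [smul_eq_C_mul, C_mul, C_pow, map_ofNat]
      ring
    rw [hgr, momentFunctional_add, momentFunctional_add, momentFunctional_smul,
      momentFunctional_smul, horth r dr, mul_zero, zero_add]
    have h1 : 0 < c ^ 2 * momentFunctional (momentAt m) (P ^ 2) := mul_pos (by positivity) hpos
    rcases eq_or_ne r 0 with h0 | h0
    · rw [h0]; simpa [momentFunctional] using h1
    · have := hsq r h0 (by
        rw [degree_eq_natDegree h0] at dr
        have : r.natDegree < l + 1 := by exact_mod_cast dr
        omega)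
      linarith
  · exact hsq g hg hle

section Continuity

variable {n : ℕ} {G : Set (Fin n → ℝ)}

theorem continuous_momentAt (i : ℕ) : Continuous fun m : Fin n → ℝ => momentAt m i := by
  cases i with
  | zero => exact continuous_const
  | succ i =>
    by_cases h : i < n
    · simp only [momentAt, dif_pos h]; exact continuous_apply _
    · simp only [momentAt, dif_neg h]; exact continuous_const

theorem continuousOn_coeff_mul {f g : (Fin n → ℝ) → ℝ[X]}
    (hf : ∀ i, ContinuousOn (fun m => (f m).coeff i) G)
    (hg : ∀ i, ContinuousOn (fun m => (g m).coeff i) G) (i : ℕ) :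
    ContinuousOn (fun m => (f m * g m).coeff i) G := by
  simp_rw [coeff_mul]
  exact continuousOn_finsetSum _ fun p _ => (hf p.1).mul (hg p.2)

theorem continuousOn_coeff_C {f : (Fin n → ℝ) → ℝ} (hf : ContinuousOn f G) (i : ℕ) :
    ContinuousOn (fun m => (C (f m)).coeff i) G := by
  simp_rw [coeff_C]
  split_ifs
  exacts [hf, continuousOn_const]

theorem continuousOn_momentFunctional {f : (Fin n → ℝ) → ℝ[X]}
    (hf : ∀ i, ContinuousOn (fun m => (f m).coeff i) G) {N : ℕ} (hN : ∀ m, (f m).natDegree ≤ N) :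
    ContinuousOn (fun m => momentFunctional (momentAt m) (f m)) G := by
  simp_rw [fun m => momentFunctional_eq_sum (s := momentAt m) (hN m)]
  exact continuousOn_finsetSum _ fun i _ => (hf i).mul (continuous_momentAt i).continuousOn

theorem continuousOn_momentFunctional_orthoPoly_sq {l : ℕ}
    (h : ∀ i, ContinuousOn (fun m : Fin n → ℝ => (orthoPoly (momentAt m) l).coeff i) G) :
    ContinuousOn (fun m => momentFunctional (momentAt m) (orthoPoly (momentAt m) l ^ 2)) G ∧
    ContinuousOn (fun m => momentFunctional (momentAt m) (X * orthoPoly (momentAt m) l ^ 2)) G := by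
  have h2 : ∀ i, ContinuousOn (fun m : Fin n → ℝ => (orthoPoly (momentAt m) l ^ 2).coeff i) G := by
    intro i
    simp_rw [sq]
    exact continuousOn_coeff_mul h h i
  exact ⟨continuousOn_momentFunctional h2 fun m => (natDegree_orthoPoly_sq _ l).le,
    continuousOn_momentFunctional (continuousOn_coeff_mul (fun _ => continuousOn_const) h2)
      fun m => (natDegree_X_mul_orthoPoly_sq _ l).le⟩

/-- The recurrence divides only by squared norms of index at most `l - 1`, which are positive in the
interior when `2 * l ≤ n + 1`. -/
theorem continuousOn_coeff_orthoPoly (l : ℕ) (hl : 2 * l ≤ n + 1) : ∀ i,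
    ContinuousOn (fun m : Fin n → ℝ => (orthoPoly (momentAt m) l).coeff i)
      (interior (momentSpace univ n)) := by
  induction l using Nat.twoStepInduction with
  | zero => intro i; simp_rw [orthoPoly_zero]; exact continuousOn_const
  | one =>
    intro i
    simp_rw [orthoPoly_one, coeff_sub, momentFunctional_one, div_one]
    exact continuousOn_const.sub (continuousOn_coeff_C (continuousOn_momentFunctional
      (fun _ => continuousOn_const) fun _ => natDegree_X_le) i)
  | more j h0 h1 =>
    intro i
    have c0 := h0 (by omega)
    have c1 := h1 (by omega)
    obtain ⟨a0, -⟩ := continuousOn_momentFunctional_orthoPoly_sq c0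
    obtain ⟨a1, b1⟩ := continuousOn_momentFunctional_orthoPoly_sq c1
    simp_rw [orthoPoly_succ_succ, coeff_sub]
    refine (continuousOn_coeff_mul (fun i => ?_) c1 i).sub
      (continuousOn_coeff_mul (continuousOn_coeff_C (a1.div a0 fun m hm =>
        (momentFunctional_orthoPoly_sq_pos hm (by omega)).ne')) c0 i)
    simp_rw [coeff_sub]
    exact continuousOn_const.sub (continuousOn_coeff_C (b1.div a1 fun m hm =>
        (momentFunctional_orthoPoly_sq_pos hm (by omega)).ne') i)

end Continuity

theorem orthoPoly_momentAt_init {n : ℕ} (m : Fin (n + 1) → ℝ) {l : ℕ} (hl : 2 * l ≤ n + 1) :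
    orthoPoly (momentAt (Fin.init m)) l = orthoPoly (momentAt m) l :=
  orthoPoly_congr l fun i hi => momentAt_init m (by omega)

theorem momentFunctional_monic_succ {n : ℕ} (m : Fin (n + 1) → ℝ) {p : ℝ[X]} (hp : p.Monic)
    (hd : p.natDegree = n + 1) : momentFunctional (momentAt m) p =
      m (Fin.last n) - -momentFunctional (momentAt (Fin.init m)) p := by
  have hc : p.coeff (n + 1) = 1 := by rw [← hd]; exact hp
  rw [momentFunctional_momentAt_succ m hd.le, hc]
  ring

theorem momentFunctional_init {n : ℕ} (m : Fin (n + 1) → ℝ) {p : ℝ[X]} (hd : p.natDegree ≤ n) :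
    momentFunctional (momentAt (Fin.init m)) p = momentFunctional (momentAt m) p :=
  momentFunctional_congr hd fun _ hi => momentAt_init m hi

theorem prod_realLine_weights {n : ℕ} {m : Fin n → ℝ} (hm : m ∈ interior (momentSpace univ n)) :
    ∏ j ∈ Finset.Icc 1 n, alternating (fun _ => (1 : ℝ)) (fun t => t) j (realLineCoord n m j) =
      momentFunctional (momentAt m) (orthoPoly (momentAt m) (n / 2) ^ 2) := by
  rw [prod_alternating_one _ _ (realLineCoord_even m), prod_recurrenceBeta hm (by omega)]

theorem triangularCoordinates_realLine :
    TriangularCoordinates (fun n => interior (momentSpace univ n)) realLineCoord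
      (alternating univ (Ioi 0)) (alternating (fun _ => 1) fun t => t) where
  isOpen _ := isOpen_interior
  zero_eq := by rw [momentSpace_zero MeasurableSet.univ univ_nonempty, interior_univ]
  coord_init n m _ j hj := realLineCoord_init m (Finset.mem_Icc.1 hj).2
  mem_succ_iff n m := by
    rcases Nat.even_or_odd' n with ⟨l, rfl | rfl⟩
    · rw [mem_interior_univ_succ_odd, alternating, if_pos ⟨l, rfl⟩]
      simp
    · rw [mem_interior_univ_succ_even, alternating,
        if_neg (by rw [Nat.not_odd_iff_even]; exact ⟨l + 1, by ring⟩)]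
      refine and_congr_right fun hm => ?_
      have e : realLineCoord (2 * l + 1 + 1) m (2 * l + 1 + 1) =
        recurrenceBeta (momentAt m) (l + 1) := realLineCoord_even m (l + 1)
      have h1 := momentFunctional_orthoPoly_sq_pos hm (l := l) (by omega)
      rw [orthoPoly_momentAt_init m (by omega),
        momentFunctional_init m (by rw [natDegree_orthoPoly_sq]; omega)] at h1
      rw [e, recurrenceBeta, Nat.add_sub_cancel, mem_Ioi, div_pos_iff_of_pos_right h1]
  isOpen_range j := alternating_of_forall isOpen_univ isOpen_Ioi j
  weight_pos j t ht := by
    unfold alternating at ht ⊢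
    split_ifs at ht ⊢
    exacts [one_pos, ht]
  weight_cont j := by
    unfold alternating
    split_ifs
    exacts [continuousOn_const, continuousOn_id]
  affine n := by
    rcases Nat.even_or_odd' n with ⟨l, rfl | rfl⟩
    -- In both parities the numerator of the new coefficient is the mean of a monic polynomial of
    -- degree `n + 1`, so the new moment enters with coefficient one; the denominator is the product
    -- of the earlier `β`'s.
    · refine ⟨fun m => -momentFunctional (momentAt m) (X * orthoPoly (momentAt m) l ^ 2), 1, one_pos,
        (continuousOn_momentFunctional_orthoPoly_sq
          (continuousOn_coeff_orthoPoly l (by omega))).2.neg, fun m hm => ?_⟩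
      beta_reduce
      rw [one_mul, prod_realLine_weights hm, realLineCoord_odd, recurrenceAlpha, Nat.add_sub_cancel,
        momentFunctional_monic_succ m (monic_X.mul ((orthoPoly_monic _ l).pow 2))
          (natDegree_X_mul_orthoPoly_sq _ l),
        show 2 * l / 2 = l by omega, orthoPoly_momentAt_init m (l := l) (by omega),
        momentFunctional_init m (p := orthoPoly (momentAt m) l ^ 2)
          (by rw [natDegree_orthoPoly_sq])]
    · refine ⟨fun m => -momentFunctional (momentAt m) (orthoPoly (momentAt m) (l + 1) ^ 2), 1, one_pos,
        (continuousOn_momentFunctional_orthoPoly_sq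
          (continuousOn_coeff_orthoPoly (l + 1) (by omega))).1.neg, fun m hm => ?_⟩
      have e : realLineCoord (2 * l + 1 + 1) m (2 * l + 1 + 1) =
        recurrenceBeta (momentAt m) (l + 1) := realLineCoord_even m (l + 1)
      beta_reduce
      rw [one_mul, prod_realLine_weights hm, e, recurrenceBeta, Nat.add_sub_cancel,
        momentFunctional_monic_succ m ((orthoPoly_monic _ (l + 1)).pow 2)
          (natDegree_orthoPoly_sq _ (l + 1)),
        orthoPoly_momentAt_init m (l := l + 1) (by omega), show (2 * l + 1) / 2 = l by omega,
        orthoPoly_momentAt_init m (l := l) (by omega),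
        momentFunctional_init m (p := orthoPoly (momentAt m) l ^ 2)
          (by rw [natDegree_orthoPoly_sq]; omega)]

/-! ### Integrability of the one-coordinate factors and compact sublevel sets of `W`. -/

theorem setLIntegral_ofReal_ne_top_of_le {f g : ℝ → ℝ} {D A B : Set ℝ} {M : ℝ} (hD : D ⊆ A ∪ B)
    (hA : MeasurableSet A) (hAv : volume A ≠ ⊤) (hfA : ∀ t ∈ A, f t ≤ M)
    (hB : MeasurableSet B) (hg : IntegrableOn g B) (hfB : ∀ t ∈ B, f t ≤ g t) :
    ∫⁻ t in D, ENNReal.ofReal (f t) ≠ ⊤ := by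
  refine ne_top_of_le_ne_top ?_ ((lintegral_mono_set hD).trans (lintegral_union_le _ A B))
  refine ENNReal.add_ne_top.2 ⟨?_, ?_⟩
  · refine ne_top_of_le_ne_top ?_ (setLIntegral_mono' (g := fun _ => ENNReal.ofReal M) hA
      fun t ht => ENNReal.ofReal_le_ofReal (hfA t ht))
    rw [setLIntegral_const]
    exact ENNReal.mul_ne_top ENNReal.ofReal_ne_top hAv
  · exact ne_top_of_le_ne_top hg.lintegral_lt_top.ne
      (setLIntegral_mono' hB fun t ht => ENNReal.ofReal_le_ofReal (hfB t ht))

theorem exists_forall_le_of_continuousOn {V : ℝ → ℝ} {S : Set ℝ} (hS : IsCompact S)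
    (hV : ContinuousOn V S) : ∃ c : ℝ, ∀ t ∈ S, c ≤ V t := by
  obtain ⟨c, hc⟩ := (hS.image_of_continuousOn hV).bddBelow
  exact ⟨c, fun t ht => hc ⟨t, ht, rfl⟩⟩

theorem exp_neg_mul_le {N : ℕ} {c v : ℝ} (h : c ≤ v) :
    Real.exp (-(N : ℝ) * v) ≤ Real.exp (-(N : ℝ) * c) :=
  Real.exp_le_exp.2 (mul_le_mul_of_nonpos_left h (by simp))

section UnitInterval

variable {V : ℝ → ℝ}

theorem lintegral_unitInterval_ne_top (hV : ContinuousOn V (Icc 0 1)) (N r : ℕ) :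
    ∫⁻ t in Ioo (0 : ℝ) 1, ENNReal.ofReal (Real.exp (-(N : ℝ) * V t) * (t * (1 - t)) ^ r) ≠ ⊤ := by
  obtain ⟨c, hc⟩ := exists_forall_le_of_continuousOn isCompact_Icc hV
  refine setLIntegral_ofReal_ne_top_of_le (g := 0) (A := Ioo 0 1) (B := ∅)
    (M := Real.exp (-(N : ℝ) * c)) (by simp) measurableSet_Ioo (by simp) (fun t ht => ?_)
    MeasurableSet.empty (by simp) (by simp)
  refine (mul_le_of_le_one_right (Real.exp_pos _).le (pow_le_one₀ ?_ ?_)).trans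
    (exp_neg_mul_le (hc t (Ioo_subset_Icc_self ht))) <;> nlinarith [ht.1, ht.2]

/-- As `V` is bounded below, a bound on `W` keeps `t (1 - t)` away from zero. -/
theorem exists_isCompact_sublevel_unitInterval (hV : ContinuousOn V (Icc 0 1)) (K : ℝ) :
    ∃ C ⊆ Ioo (0 : ℝ) 1, IsCompact C ∧
      ∀ t ∈ Ioo (0 : ℝ) 1, V t - Real.log (t * (1 - t)) ≤ K → t ∈ C := by
  obtain ⟨c, hc⟩ := exists_forall_le_of_continuousOn isCompact_Icc hV
  refine ⟨Icc 0 1 ∩ {t | Real.exp (c - K) ≤ t * (1 - t)}, fun t ⟨ht, ht'⟩ => ?_,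
    isCompact_Icc.inter_right (isClosed_le continuous_const (by fun_prop)), fun t ht hK => ?_⟩
  · have : 0 < t * (1 - t) := (Real.exp_pos _).trans_le ht'
    constructor <;> by_contra! h <;> nlinarith [ht.1, ht.2]
  · refine ⟨Ioo_subset_Icc_self ht, ?_⟩
    have := hc t (Ioo_subset_Icc_self ht)
    exact (Real.le_log_iff_exp_le (mul_pos ht.1 (sub_pos.2 ht.2))).1 (by linarith)

end UnitInterval

section HalfLine

variable {V : ℝ → ℝ} {R : ℝ}

/-- On the tail the integrand is at most `t ^ (r - 2 N)`, and `r < N` makes the exponent at most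
`-2`. -/
theorem lintegral_halfLine_ne_top (hV : ContinuousOn V (Ici 0)) (hR : 1 ≤ R)
    (hVR : ∀ t, R ≤ t → 2 * Real.log t ≤ V t) {N r : ℕ} (hr : r < N) :
    ∫⁻ t in Ioi (0 : ℝ), ENNReal.ofReal (Real.exp (-(N : ℝ) * V t) * t ^ r) ≠ ⊤ := by
  obtain ⟨c, hc⟩ := exists_forall_le_of_continuousOn (isCompact_Icc (a := 0) (b := R))
    (hV.mono Icc_subset_Ici_self)
  refine setLIntegral_ofReal_ne_top_of_le (g := fun t => t ^ (-2 : ℝ)) (A := Icc 0 R) (B := Ioi R)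
    (M := Real.exp (-(N : ℝ) * c) * R ^ r) (fun t ht => ?_) measurableSet_Icc (by simp)
    (fun t ht => ?_) measurableSet_Ioi
    (integrableOn_Ioi_rpow_of_lt (by norm_num) (by linarith)) fun t ht => ?_
  · rcases le_or_gt t R with h | h
    exacts [Or.inl ⟨(mem_Ioi.1 ht).le, h⟩, Or.inr h]
  · exact mul_le_mul (exp_neg_mul_le (hc t ht)) (pow_le_pow_left₀ ht.1 ht.2 r)
      (pow_nonneg ht.1 r) (Real.exp_pos _).le
  · have ht1 : 1 < t := hR.trans_lt ht
    have hlog : 0 < Real.log t := Real.log_pos ht1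
    have hr' : (r : ℝ) + 1 ≤ N := by exact_mod_cast hr
    calc Real.exp (-(N : ℝ) * V t) * t ^ r
        ≤ Real.exp (-(N : ℝ) * (2 * Real.log t)) * t ^ r :=
          mul_le_mul_of_nonneg_right (exp_neg_mul_le (hVR t (mem_Ioi.1 ht).le)) (by positivity)
      _ = Real.exp (Real.log t * (-(N : ℝ) * 2 + r)) := by
          rw [mul_add, Real.exp_add, mul_comm (Real.log t) r, Real.exp_nat_mul,
            Real.exp_log (by linarith)]
          congr 2
          ring
      _ ≤ Real.exp (Real.log t * -2) :=
          Real.exp_le_exp.2 (mul_le_mul_of_nonneg_left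
            (by have : (0 : ℝ) ≤ r := r.cast_nonneg; linarith) hlog.le)
      _ = t ^ (-2 : ℝ) := by rw [Real.rpow_def_of_pos (by linarith)]

/-- Near zero `-log t` blows up while `V` is bounded below; on the tail `V t - log t ≥ log t`. -/
theorem exists_isCompact_sublevel_halfLine (hV : ContinuousOn V (Ici 0)) (hR : 1 ≤ R)
    (hVR : ∀ t, R ≤ t → 2 * Real.log t ≤ V t) (K : ℝ) :
    ∃ C ⊆ Ioi (0 : ℝ), IsCompact C ∧ ∀ t ∈ Ioi (0 : ℝ), V t - Real.log t ≤ K → t ∈ C := by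
  obtain ⟨c, hc⟩ := exists_forall_le_of_continuousOn (isCompact_Icc (a := 0) (b := R))
    (hV.mono Icc_subset_Ici_self)
  refine ⟨Icc (min 1 (Real.exp (c - K))) (max R (Real.exp K)), fun t ht => ?_, isCompact_Icc,
    fun t (ht : 0 < t) hK => ?_⟩
  · exact (lt_min one_pos (Real.exp_pos _)).trans_le ht.1
  · rcases le_total t R with h | h
    · refine ⟨(min_le_right _ _).trans ?_, h.trans (le_max_left _ _)⟩
      have := hc t ⟨ht.le, h⟩
      exact (Real.le_log_iff_exp_le ht).1 (by linarith)
    · refine ⟨(min_le_left _ _).trans (hR.trans h), le_trans ?_ (le_max_right _ _)⟩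
      have := hVR t h
      exact (Real.log_le_iff_le_exp ht).1 (by linarith)

end HalfLine

section RealLine

variable {V : ℝ → ℝ} {R ε : ℝ}

theorem integrableOn_abs_rpow (hR : 0 < R) (hε : 0 < ε) :
    IntegrableOn (fun t : ℝ => |t| ^ (-(1 + ε))) (Iio (-R) ∪ Ioi R) := by
  have h : IntegrableOn (fun t : ℝ => |t| ^ (-(1 + ε))) (Ioi R) :=
    (integrableOn_Ioi_rpow_of_lt (a := -(1 + ε)) (by linarith) hR).congr_fun
      (fun t ht => by simp only [abs_of_pos (hR.trans ht)]) measurableSet_Ioi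
  refine IntegrableOn.union ?_ h
  have h' := h
  rw [← neg_neg R] at h'
  simpa using h'.comp_neg_Iio

/-- The weight of the `α`'s is one, so no power has to be compensated; for `N = 1` the decay `|t| ^
(-(1 + ε))` is what makes the tails integrable. -/
theorem lintegral_realLine_ne_top (hV : Continuous V) (hR : 1 ≤ R) (hε : 0 < ε)
    (hVR : ∀ t, R ≤ |t| → (1 + ε) * Real.log |t| ≤ V t) {N : ℕ} (hN : 1 ≤ N) :
    ∫⁻ t, ENNReal.ofReal (Real.exp (-(N : ℝ) * V t)) ≠ ⊤ := by
  obtain ⟨c, hc⟩ := exists_forall_le_of_continuousOn (isCompact_Icc (a := -R) (b := R))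
    hV.continuousOn
  rw [← setLIntegral_univ]
  refine setLIntegral_ofReal_ne_top_of_le (A := Icc (-R) R)
    (M := Real.exp (-(N : ℝ) * c)) (fun t _ => ?_) measurableSet_Icc (by simp)
    (fun t ht => exp_neg_mul_le (hc t ht)) (measurableSet_Iio.union measurableSet_Ioi)
    (integrableOn_abs_rpow (R := R) (by linarith) hε) fun t ht => ?_
  · rcases lt_or_ge t (-R) with h | h
    · exact Or.inr (Or.inl h)
    · rcases le_or_gt t R with h' | h'
      exacts [Or.inl ⟨h, h'⟩, Or.inr (Or.inr h')]
  · have ht1 : R ≤ |t| := by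
      rcases ht with h | h
      · rw [le_abs]; right; linarith [mem_Iio.1 h]
      · rw [le_abs]; left; exact (mem_Ioi.1 h).le
    have hlog : 0 ≤ Real.log |t| := Real.log_nonneg (hR.trans ht1)
    have hN' : (1 : ℝ) ≤ N := by exact_mod_cast hN
    rw [Real.rpow_def_of_pos (by linarith)]
    refine (exp_neg_mul_le (hVR t ht1)).trans (Real.exp_le_exp.2 ?_)
    have : 0 ≤ (1 + ε) * Real.log |t| := by positivity
    nlinarith

theorem exists_isCompact_sublevel_realLine (hR : 1 ≤ R) (hε : 0 < ε)
    (hVR : ∀ t, R ≤ |t| → (1 + ε) * Real.log |t| ≤ V t) (K : ℝ) :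
    ∃ C : Set ℝ, IsCompact C ∧ ∀ t, V t ≤ K → t ∈ C := by
  refine ⟨Icc (-max R (Real.exp K)) (max R (Real.exp K)), isCompact_Icc, fun t hK => ?_⟩
  rw [mem_Icc, ← abs_le]
  rcases le_total |t| R with h | h
  · exact h.trans (le_max_left _ _)
  · refine le_trans ?_ (le_max_right _ _)
    have hlog : 0 ≤ Real.log |t| := Real.log_nonneg (hR.trans h)
    have := hVR t h
    exact (Real.log_le_iff_le_exp (by linarith)).1 (by nlinarith)

end RealLine

/-! ### The three cases assembled. -/

theorem mul_log_le_of_le_div_log {c x v : ℝ} (hx : 1 < x) (h : c ≤ v / Real.log x) :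
    c * Real.log x ≤ v := (le_div_iff₀ (Real.log_pos hx)).1 h

theorem two_mul_log_le_of_le_div_log {c x v : ℝ} (hc : 2 ≤ c) (hx : 1 < x)
    (h : c ≤ v / Real.log x) : 2 * Real.log x ≤ v :=
  (mul_le_mul_of_nonneg_right hc (Real.log_pos hx).le).trans (mul_log_le_of_le_div_log hx h)

theorem theorem3p3 {Ω : Type*} [MeasurableSpace Ω] (P : Measure Ω) [IsProbabilityMeasure P]
    (k : ℕ) (hk : 1 ≤ k) (V₁ V₂ : ℝ → ℝ) :
    -- the compact interval `[a, b]`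
    (∀ a b : ℝ, a < b →
      ContDiffOn ℝ 2 V₁ (Ioo 0 1) → ContinuousOn V₁ (Icc 0 1) →
      ContDiffOn ℝ 2 V₂ (Ioo 0 1) → ContinuousOn V₂ (Icc 0 1) →
      ∀ W₁ W₂ : ℝ → ℝ,
      W₁ = (fun p => V₁ p - Real.log (p * (1 - p))) →
      W₂ = (fun p => V₂ p - Real.log (p * (1 - p))) →
      ∀ p₁ p₂ : ℝ,
      IsUniqueMinimizerOn W₁ (Ioo 0 1) p₁ → IsUniqueMinimizerOn W₂ (Ioo 0 1) p₂ →
      (∀ n, 1 ≤ n → IsProbabilityMeasure (momentLaw (Icc a b) (compactCoord a b) V₁ V₂ n)) ∧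
      ∀ (m : ∀ n, Ω → momentSpace (Icc a b) n) (X : ℕ → Ω → momentSpace (Icc a b) k),
      (∀ n, 1 ≤ n → HasLaw (m n) (momentLaw (Icc a b) (compactCoord a b) V₁ V₂ n) P) →
      (∀ n (h : k ≤ n) ω, X n ω = firstMoments h (m n ω)) →
      SatisfiesLDP P X (fun n => (n : ℝ))
        (momentRate (Icc a b) (compactCoord a b) W₁ W₂ p₁ p₂ k)) ∧
    -- the half line `[0, ∞)`
    (ContDiffOn ℝ 2 V₁ (Ioi 0) → ContinuousOn V₁ (Ici 0) →
      ContDiffOn ℝ 2 V₂ (Ioi 0) → ContinuousOn V₂ (Ici 0) →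
      (∃ ε > 0, ∀ᶠ z : ℝ in atTop, 2 + ε ≤ V₁ z / Real.log z ∧ 2 + ε ≤ V₂ z / Real.log z) →
      ∀ W₁ W₂ : ℝ → ℝ,
      W₁ = (fun z => V₁ z - Real.log z) →
      W₂ = (fun z => V₂ z - Real.log z) →
      ∀ z₁ z₂ : ℝ,
      IsUniqueMinimizerOn W₁ (Ioi 0) z₁ → IsUniqueMinimizerOn W₂ (Ioi 0) z₂ →
      (∀ n, 1 ≤ n → IsProbabilityMeasure (momentLaw (Ici 0) halfLineCoord V₁ V₂ n)) ∧
      ∀ (m : ∀ n, Ω → momentSpace (Ici 0) n) (X : ℕ → Ω → momentSpace (Ici 0) k),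
      (∀ n, 1 ≤ n → HasLaw (m n) (momentLaw (Ici 0) halfLineCoord V₁ V₂ n) P) →
      (∀ n (h : k ≤ n) ω, X n ω = firstMoments h (m n ω)) →
      SatisfiesLDP P X (fun n => (n : ℝ))
        (momentRate (Ici 0) halfLineCoord W₁ W₂ z₁ z₂ k)) ∧
    -- the real line
    (ContDiff ℝ 2 V₁ →
      ContDiffOn ℝ 2 V₂ (Ioi 0) → ContinuousOn V₂ (Ici 0) →
      (∃ ε > 0, ∃ R : ℝ, (∀ α : ℝ, R ≤ |α| → 1 + ε ≤ V₁ α / Real.log |α|) ∧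
        ∀ β : ℝ, R ≤ β → 3 + ε ≤ V₂ β / Real.log β) →
      ∀ W₁ W₂ : ℝ → ℝ,
      W₁ = V₁ →
      W₂ = (fun β => V₂ β - Real.log β) →
      ∀ α β : ℝ,
      IsUniqueMinimizerOn W₁ univ α → IsUniqueMinimizerOn W₂ (Ioi 0) β →
      (∀ n, 1 ≤ n → IsProbabilityMeasure (momentLaw univ realLineCoord V₁ V₂ n)) ∧
      ∀ (m : ∀ n, Ω → momentSpace univ n) (X : ℕ → Ω → momentSpace univ k),
      (∀ n, 1 ≤ n → HasLaw (m n) (momentLaw univ realLineCoord V₁ V₂ n) P) →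
      (∀ n (h : k ≤ n) ω, X n ω = firstMoments h (m n ω)) →
      SatisfiesLDP P X (fun n => (n : ℝ))
        (momentRate univ realLineCoord W₁ W₂ α β k)) := by
  refine ⟨?_, ?_, ?_⟩
  · rintro a b hab - hV₁ - hV₂ W₁ W₂ rfl rfl p₁ p₂ hp₁ hp₂
    have T := triangularCoordinates_Icc hab
    have hV : ∀ j, ContinuousOn (alternating V₁ V₂ j) (alternating (Ioo 0 1) (Ioo 0 1) j) := by
      intro j
      unfold alternating
      split_ifs
      exacts [hV₁.mono Ioo_subset_Icc_self, hV₂.mono Ioo_subset_Icc_self]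
    have hint : ∀ N : ℕ, ∀ j, ∀ r < N, ∫⁻ t in alternating (Ioo (0 : ℝ) 1) (Ioo 0 1) j,
        ENNReal.ofReal (Real.exp (-(N : ℝ) * alternating V₁ V₂ j t) *
          alternating (fun p => p * (1 - p)) (fun p => p * (1 - p)) j t ^ r) ≠ ⊤ := by
      intro N j r _
      unfold alternating
      split_ifs
      exacts [lintegral_unitInterval_ne_top hV₁ N r, lintegral_unitInterval_ne_top hV₂ N r]
    refine ⟨fun n _ => isProbabilityMeasure_momentLaw T hV
      (alternating_of_forall ⟨p₁, hp₁.1⟩ ⟨p₂, hp₂.1⟩) (hint n)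
      (nullMeasurableSet_momentSpace _ n), fun m X hm hX =>
      satisfiesLDP_of_triangularCoordinates P T (nullMeasurableSet_momentSpace _) hV hint
        (fun j t _ => ?_) (fun j K => ?_) hp₁ hp₂ k m X hm hX hk⟩
    all_goals
      unfold alternating
      split_ifs
    exacts [rfl, rfl, exists_isCompact_sublevel_unitInterval hV₁ K,
      exists_isCompact_sublevel_unitInterval hV₂ K]
  · rintro - hV₁ - hV₂ ⟨ε, hε, hev⟩ W₁ W₂ rfl rfl z₁ z₂ hz₁ hz₂
    obtain ⟨R, hR, hVR⟩ : ∃ R : ℝ, 1 ≤ R ∧ ∀ t, R ≤ t →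
        2 * Real.log t ≤ V₁ t ∧ 2 * Real.log t ≤ V₂ t := by
      obtain ⟨R, hR⟩ := eventually_atTop.1 hev
      -- Beyond `2` the logarithm is positive, so the bound on the quotient may be multiplied out.
      refine ⟨max R 2, one_le_two.trans (le_max_right _ _), fun t ht => ?_⟩
      have ht1 : 1 < t := one_lt_two.trans_le ((le_max_right _ _).trans ht)
      exact (hR t ((le_max_left _ _).trans ht)).imp
        (two_mul_log_le_of_le_div_log (by linarith) ht1)
        (two_mul_log_le_of_le_div_log (by linarith) ht1)
    have hVR₁ := fun t ht => (hVR t ht).1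
    have hVR₂ := fun t ht => (hVR t ht).2
    have T := triangularCoordinates_halfLine
    have hV : ∀ j, ContinuousOn (alternating V₁ V₂ j) (alternating (Ioi 0) (Ioi 0) j) := by
      intro j
      unfold alternating
      split_ifs
      exacts [hV₁.mono Ioi_subset_Ici_self, hV₂.mono Ioi_subset_Ici_self]
    have hint : ∀ N : ℕ, ∀ j, ∀ r < N, ∫⁻ t in alternating (Ioi (0 : ℝ)) (Ioi 0) j,
        ENNReal.ofReal (Real.exp (-(N : ℝ) * alternating V₁ V₂ j t) *
          alternating (fun z => z) (fun z => z) j t ^ r) ≠ ⊤ := by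
      intro N j r hr
      unfold alternating
      split_ifs
      exacts [lintegral_halfLine_ne_top hV₁ hR hVR₁ hr, lintegral_halfLine_ne_top hV₂ hR hVR₂ hr]
    refine ⟨fun n _ => isProbabilityMeasure_momentLaw T hV
      (alternating_of_forall ⟨z₁, hz₁.1⟩ ⟨z₂, hz₂.1⟩) (hint n)
      (nullMeasurableSet_momentSpace _ n), fun m X hm hX =>
      satisfiesLDP_of_triangularCoordinates P T (nullMeasurableSet_momentSpace _) hV hint
        (fun j t _ => ?_) (fun j K => ?_) hz₁ hz₂ k m X hm hX hk⟩
    all_goals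
      unfold alternating
      split_ifs
    exacts [rfl, rfl, exists_isCompact_sublevel_halfLine hV₁ hR hVR₁ K,
      exists_isCompact_sublevel_halfLine hV₂ hR hVR₂ K]
  · rintro hV₁ - hV₂ ⟨ε, hε, R, hR₁, hR₂⟩ W₁ W₂ rfl rfl α β hα hβ
    have h2 : (1 : ℝ) < max R 2 := one_lt_two.trans_le (le_max_right _ _)
    have hVR₁ : ∀ t, max R 2 ≤ |t| → (1 + ε) * Real.log |t| ≤ W₁ t := fun t ht =>
      mul_log_le_of_le_div_log (h2.trans_le ht) (hR₁ t ((le_max_left _ _).trans ht))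
    -- The factor `2` is all that the half-line estimates ask for, so they also serve the `β`
    -- coordinates.
    have hVR₂ : ∀ t, max R 2 ≤ t → 2 * Real.log t ≤ V₂ t := fun t ht =>
      two_mul_log_le_of_le_div_log (by linarith) (h2.trans_le ht)
        (hR₂ t ((le_max_left _ _).trans ht))
    have T := triangularCoordinates_realLine
    have hV : ∀ j, ContinuousOn (alternating W₁ V₂ j) (alternating univ (Ioi 0) j) := by
      intro j
      unfold alternating
      split_ifs
      exacts [hV₁.continuous.continuousOn, hV₂.mono Ioi_subset_Ici_self]
    have hint : ∀ N : ℕ, ∀ j, ∀ r < N, ∫⁻ t in alternating (univ : Set ℝ) (Ioi 0) j,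
        ENNReal.ofReal (Real.exp (-(N : ℝ) * alternating W₁ V₂ j t) *
          alternating (fun _ => 1) (fun t => t) j t ^ r) ≠ ⊤ := by
      intro N j r hr
      unfold alternating
      split_ifs
      · simpa only [one_pow, mul_one, setLIntegral_univ] using
          lintegral_realLine_ne_top hV₁.continuous h2.le hε hVR₁ (Nat.one_le_of_lt hr)
      · exact lintegral_halfLine_ne_top hV₂ h2.le hVR₂ hr
    refine ⟨fun n _ => isProbabilityMeasure_momentLaw T hV
      (alternating_of_forall ⟨α, hα.1⟩ ⟨β, hβ.1⟩) (hint n)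
      (nullMeasurableSet_momentSpace _ n), fun m X hm hX =>
      satisfiesLDP_of_triangularCoordinates P T (nullMeasurableSet_momentSpace _) hV hint
        (fun j t _ => ?_) (fun j K => ?_) hα hβ k m X hm hX hk⟩
    all_goals
      unfold alternating
      split_ifs
    · rw [Real.log_one, sub_zero]
    · rfl
    · obtain ⟨C, hC, h⟩ := exists_isCompact_sublevel_realLine h2.le hε hVR₁ K
      exact ⟨C, subset_univ C, hC, fun t _ => h t⟩
    · exact exists_isCompact_sublevel_halfLine hV₂ h2.le hVR₂ K
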